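/- **Setting.** Let $K\ge 1$ be the number of arms. At time $t=1,2,\dots$ the reward $X_{t,k}$ of arm $k$ has distribution $\nu_{t,k}$ with mean $\mu_{t,k}$ and is independent of the past (rewards, decisions, external randomness used to break ties). For every $t\le T$ the laws $\nu_{t,1},\dots,\nu_{t,K}$ belong to one common one-parameter exponential family $P_\theta(dx)\propto e^{\theta x}\rho(dx)$ with finite means; the base measure $\rho$ may change at each breakpoint. At each $t\le T$ the optimal arm $k^\star_t$ is unique. There are constants $\omega>0$ and $D$ such that, for all $t\le T$ and $k\ne k_t^\star$, writing $\xi=\frac12(\mu_{t,k}+\mu_{t,k^\star_t})$, one has $\mu_{t,k^\star_t}-\mu_{t,k}\le D$, $\mathrm{kl}(\xi,\mu_{t,k})\ge\omega$ and $\mathrm{kl}(\xi,\mu_{t,k_t^\star})\ge\omega$, where $\mathrm{kl}(\mu,\mu')$ is the Kullback–Leibler divergence between the members of the family at time $t$ with means $\mu$ and $\mu'$. There are at most $\Gamma_T\geq 1$ breakpoints, i.e. times $1\le t\le T-1$ with $\nu_{t,k}\neq\nu_{t+1,k}$ for some $k$. **Algorithm SW-LB-SDA with window $\tau\ge1$.**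 It works in rounds; in round $r$ a non-empty set $\mathcal A_r$ of arms is pulled, one after the other, each pull taking one time step; $\mathcal A_1$ contains all arms. Let $N_k^\tau(r)$ be the number of pulls of arm $k$ in the rounds $s\ge1$ with $r-\tau<s\le r$. - *Duels.* At round $r$, with leader $\ell(r)$, a challenger $k\neq\ell(r)$ is selected if (i) $N_k^\tau(r)\le\sqrt{\log\tau}$, or (ii) its diversity flag is raised, or (iii) the mean of its last $N_k^\tau(r)$ observations is at least the mean of the last $\min(N_k^\tau(r),N_{\ell(r)}^\tau(r))$ observations of the leader. $\mathcal A_{r+1}$ is the set of selected challengers, or $\{\ell(r)\}$ if there is none. - *Diversity flag.* With $L=\lceil (K-1)(\log\tau)^2\rceil$, the flag of $k\neq\ell(r)$ is raised at round $r$ if $r>L$, $N_k^\tau(r)\le(\log\tau)^2$ and, for every $s\in\{r-L,\dots,r-1\}$, $\ell(s)=\ell(r)$ and neither $\ell(r)$ nor $k$ is in $\mathcal A_{s+1}$. - *Leader.* $\ell(1)$ maximizes $N_k^\tau(1)$. If $N_{\ell(r)}^\tau(r+1)<\min(r,\tau)/(2K)$, then $\ell(r+1)$ maximizes $N_k^\tau(r+1)$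 over all arms; otherwise it maximizes it over $\mathcal B_r\cup\{\ell(r)\}$, where $\mathcal B_r=\{k\in\mathcal A_{r+1}: N_k^\tau(r+1)\ge\min(r,\tau)/K\}$. Ties are broken by any non-anticipating rule. **Theorem.** For all $K$, $\omega>0$, $D$ and $0<c_1\le c_2$ there is a constant $C$ such that for all $T\ge2$, all $\Gamma_T\ge1$, every environment as above with these $K,\omega,D$ and at most $\Gamma_T$ breakpoints up to time $T$, and every integer window $\tau\ge1$ with $$c_1\sqrt{T\log T/\Gamma_T}\ \le\ \tau\ \le\ c_2\sqrt{T\log T/\Gamma_T},$$ the dynamic regret of SW-LB-SDA with window $\tau$ satisfies $$\mathcal R_T=\mathbb E\Big[\sum_{t=1}^T\big(\max_k\mu_{t,k}-\mu_{t,A_t}\big)\Big]\ \le\ C\sqrt{T\,\Gamma_T\log T},$$ where $A_t$ is the arm pulled at time $t$. -/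

import Mathlib

open MeasureTheory ProbabilityTheory

namespace SWBandit

noncomputable section

/-! ## Bandit models and abruptly changing environments -/

/-- Mean of a reward distribution. -/
def mean (p : Measure ℝ) : ℝ := ∫ x, x ∂p

/-- The member with natural parameter `θ` of the one-parameter exponential family with base
measure `ρ`: the density with respect to `ρ` is `exp (θ x - Ψ θ)`,
`Ψ θ = log (∫ exp (θ x) dρ)`. -/
def expFam (ρ : Measure ℝ) (θ : ℝ) : Measure ℝ := ρ.tilted (fun x => θ * x)

/-- Parameters `θ` for which `expFam ρ θ` is a probability measure with a finite mean. -/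
def IsParam (ρ : Measure ℝ) (θ : ℝ) : Prop :=
  ρ ≠ 0 ∧ Integrable (fun x => Real.exp (θ * x)) ρ ∧ Integrable (fun x => x) (expFam ρ θ)

/-- For two members `θ, θ'` of the family with base `ρ`: the member `η` whose mean is the midpoint
`ξ` of their means satisfies `kl (ξ, mean θ) ≥ ω` and `kl (ξ, mean θ') ≥ ω`. -/
def MidpointSeparated (ρ : Measure ℝ) (ω θ θ' : ℝ) : Prop :=
  ∃ η : ℝ, IsParam ρ η ∧
    mean (expFam ρ η) = (mean (expFam ρ θ) + mean (expFam ρ θ')) / 2 ∧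
    ENNReal.ofReal ω ≤ InformationTheory.klDiv (expFam ρ η) (expFam ρ θ) ∧
    ENNReal.ofReal ω ≤ InformationTheory.klDiv (expFam ρ η) (expFam ρ θ')

/-- A stationary `K`-armed model: all arms lie in one common one-parameter exponential family,
the optimal arm `b` is unique, every gap is at most `D`, and every suboptimal arm is separated
from `b` with constant `ω`. -/
def IsExpFamModel {K : ℕ} (ω D : ℝ) (p : Fin K → Measure ℝ) : Prop :=
  ∃ (ρ : Measure ℝ) (θ : Fin K → ℝ),
    (∀ k, IsParam ρ (θ k) ∧ p k = expFam ρ (θ k)) ∧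
    ∃ b : Fin K, ∀ k, k ≠ b →
      mean (p k) < mean (p b) ∧ mean (p b) - mean (p k) ≤ D ∧
      MidpointSeparated ρ ω (θ k) (θ b)

open Classical in
/-- Number of breakpoints up to time `T`: the `t ∈ {1, …, T - 1}` at which the distribution of
some arm changes between `t` and `t + 1`. -/
def numBreakpoints {K : ℕ} (ν : ℕ → Fin K → Measure ℝ) (T : ℕ) : ℕ :=
  ((Finset.Ico 1 T).filter (fun t => ∃ k, ν t k ≠ ν (t + 1) k)).card

/-- Mean of the best arm at time `t`. -/
def bestMean {K : ℕ} (ν : ℕ → Fin K → Measure ℝ) (t : ℕ) : ℝ := ⨆ k, mean (ν t k)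

/-! ## Rounds, pulls and observations

Rounds and times are numbered from `1`. `A r` is the set of arms pulled at round `r`; they are
pulled one after the other, in increasing order, each taking one time step. `x t k` is the reward
obtained when arm `k` is pulled at time `t`. -/

variable {K : ℕ}

/-- Number of pulls (time steps) before round `r`. -/
def pullsBefore (A : ℕ → Finset (Fin K)) (r : ℕ) : ℕ := ∑ s ∈ Finset.Ico 1 r, (A s).card

/-- Time at which arm `k ∈ A r` is pulled during round `r`. -/
def pullTime (A : ℕ → Finset (Fin K)) (r : ℕ) (k : Fin K) : ℕ :=
  pullsBefore A r + ((A r).filter (fun j => j ≤ k)).card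

/-- Arm `k` is the arm pulled at time `t`. -/
def PulledAt (A : ℕ → Finset (Fin K)) (t : ℕ) (k : Fin K) : Prop :=
  ∃ r, 1 ≤ r ∧ k ∈ A r ∧ pullTime A r k = t

/-- `N_k(r)`: number of pulls of arm `k` in rounds `1, …, r`. -/
def count (A : ℕ → Finset (Fin K)) (k : Fin K) (r : ℕ) : ℕ :=
  ((Finset.Icc 1 r).filter (fun s => k ∈ A s)).card

/-- `N_k^τ(r)`: number of pulls of arm `k` in the last `τ` rounds `r - τ + 1, …, r`. -/
def windowCount (τ : ℕ) (A : ℕ → Finset (Fin K)) (k : Fin K) (r : ℕ) : ℕ :=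
  ((Finset.Icc 1 r).filter (fun s => r < s + τ ∧ k ∈ A s)).card

/-- Average of the last `n` observations of arm `k` available at the end of round `r`, i.e. of
those with index in `{N_k(r) - n + 1, …, N_k(r)}`. -/
def lastBlockMean (A : ℕ → Finset (Fin K)) (x : ℕ → Fin K → ℝ) (k : Fin K) (r n : ℕ) : ℝ :=
  (∑ s ∈ (Finset.Icc 1 r).filter (fun s => k ∈ A s ∧ count A k r < count A k s + n),
    x (pullTime A s k) k) / n

/-! ## The algorithm SW-LB-SDA with window `τ`

`l r` is the leader at round `r`, and `A (r + 1)` is the set of arms pulled as an outcome of the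
duels of round `r`. -/

/-- Number of rounds `⌈(K - 1) (log τ)²⌉` monitored by the diversity flags. -/
def flagLength (K τ : ℕ) : ℕ := ⌈((K : ℝ) - 1) * Real.log τ ^ 2⌉₊

/-- Diversity flag of arm `k` at round `r`: for the last `flagLength K τ` rounds the leader has
been one and the same arm other than `k`, it has not been pulled, `k` has not been pulled, and
`N_k^τ(r) ≤ (log τ)²`. -/
def DiversityFlag (τ : ℕ) (l : ℕ → Fin K) (A : ℕ → Finset (Fin K)) (k : Fin K) (r : ℕ) : Prop :=
  flagLength K τ < r ∧ k ≠ l r ∧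
    (∀ s, s < r → r ≤ s + flagLength K τ → l s = l r ∧ l r ∉ A (s + 1) ∧ k ∉ A (s + 1)) ∧
    (windowCount τ A k r : ℝ) ≤ Real.log τ ^ 2

/-- The challenger `k` wins its duel against the leader at round `r`: the mean of its
observations in the window is at least the mean of the last `min (N_k^τ, N_ℓ^τ)` observations of
the leader. -/
def WinsDuel (τ : ℕ) (x : ℕ → Fin K → ℝ) (l : ℕ → Fin K) (A : ℕ → Finset (Fin K))
    (k : Fin K) (r : ℕ) : Prop :=
  lastBlockMean A x (l r) r (min (windowCount τ A k r) (windowCount τ A (l r) r)) ≤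
    lastBlockMean A x k r (windowCount τ A k r)

open Classical in
/-- Challengers selected at round `r`: forced exploration, raised diversity flag, or won duel. -/
def winners (τ : ℕ) (x : ℕ → Fin K → ℝ) (l : ℕ → Fin K) (A : ℕ → Finset (Fin K)) (r : ℕ) :
    Finset (Fin K) :=
  Finset.univ.filter (fun k => k ≠ l r ∧
    ((windowCount τ A k r : ℝ) ≤ Real.sqrt (Real.log τ) ∨ DiversityFlag τ l A k r ∨
      WinsDuel τ x l A k r))

/-- `k` maximizes `N^τ(r)` over the set of arms `S`. -/
def IsArgmax (τ : ℕ) (A : ℕ → Finset (Fin K)) (r : ℕ) (S : Set (Fin K)) (k : Fin K) : Prop :=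
  k ∈ S ∧ ∀ j ∈ S, windowCount τ A j r ≤ windowCount τ A k r

/-- The arms of `A (r + 1)` with `N_k^τ(r + 1) ≥ min (r, τ) / K`. -/
def eligible (τ : ℕ) (A : ℕ → Finset (Fin K)) (r : ℕ) : Set (Fin K) :=
  {k | k ∈ A (r + 1) ∧ ((min r τ : ℕ) : ℝ) / K ≤ windowCount τ A k (r + 1)}

/-- The leaders `l` and pulled sets `A` form a run of SW-LB-SDA with window `τ` on the reward
table `x`. Ties in the choice of the leader may be broken in any way. -/
structure IsRun (τ : ℕ) (x : ℕ → Fin K → ℝ) (l : ℕ → Fin K) (A : ℕ → Finset (Fin K)) : Prop where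
  /-- every arm is drawn at round `1` -/
  first_round : A 1 = Finset.univ
  /-- the selected challengers are pulled -/
  pull_winners : ∀ r, 1 ≤ r → (winners τ x l A r).Nonempty → A (r + 1) = winners τ x l A r
  /-- if there is none, the leader is pulled -/
  pull_leader : ∀ r, 1 ≤ r → ¬ (winners τ x l A r).Nonempty → A (r + 1) = {l r}
  /-- the first leader -/
  first_leader : IsArgmax τ A 1 Set.univ (l 1)
  /-- the leader has too few observations: all arms are candidates -/
  leader_low : ∀ r, 1 ≤ r →
    (windowCount τ A (l r) (r + 1) : ℝ) < ((min r τ : ℕ) : ℝ) / (2 * K) →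
      IsArgmax τ A (r + 1) Set.univ (l (r + 1))
  /-- otherwise only the current leader and the eligible arms are candidates -/
  leader_keep : ∀ r, 1 ≤ r →
    ((min r τ : ℕ) : ℝ) / (2 * K) ≤ (windowCount τ A (l r) (r + 1) : ℝ) →
      IsArgmax τ A (r + 1) (eligible τ A r ∪ {l r}) (l (r + 1))

/-! ## The algorithm in a random environment -/

variable {Ω : Type*} [mΩ : MeasurableSpace Ω]

/-- `X t k` is the reward of arm `k` at time `t`: it has distribution `ν t k`, is known at time `t`
and is independent of the information `ℱ (t - 1)` available before time `t`. -/
structure IsEnvironment (P : Measure Ω) (ℱ : Filtration ℕ mΩ) (ν : ℕ → Fin K → Measure ℝ)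
    (X : ℕ → Fin K → Ω → ℝ) : Prop where
  adapted : ∀ t k, 1 ≤ t → Measurable[ℱ t] (X t k)
  law : ∀ t k, 1 ≤ t → P.map (X t k) = ν t k
  indep : ∀ t k, 1 ≤ t →
    Indep (MeasurableSpace.comap (X t k) inferInstance) (ℱ (t - 1)) P

/-- The random leaders `l` and pulled sets `A` are produced by SW-LB-SDA with window `τ` in the
environment `X`, using only the information available: if `t` pulls have been made by the end of
round `r`, then `l r` and `A (r + 1)` are determined by `ℱ t` (which may hold external
randomness, used to break ties). -/
structure IsPolicyRun (P : Measure Ω) (ℱ : Filtration ℕ mΩ) (X : ℕ → Fin K → Ω → ℝ) (τ : ℕ)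
    (l : Ω → ℕ → Fin K) (A : Ω → ℕ → Finset (Fin K)) : Prop where
  isRun : ∀ w, IsRun τ (fun t k => X t k w) (l w) (A w)
  nonanticipating : ∀ r t, 1 ≤ r → ∀ (j : Fin K) (S : Finset (Fin K)),
    MeasurableSet[ℱ t] {w | pullsBefore (A w) (r + 1) = t ∧ l w r = j ∧ A w (r + 1) = S}

open Classical in
/-- Dynamic regret `𝔼 [∑_{t ≤ T} (μ*_t - μ_{A_t, t})]`, where `A_t` is the arm pulled at time `t`. -/
def dynamicRegret (P : Measure Ω) (ν : ℕ → Fin K → Measure ℝ) (A : Ω → ℕ → Finset (Fin K))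
    (T : ℕ) : ℝ :=
  ∫ w, (∑ t ∈ Finset.Icc 1 T, ∑ k : Fin K,
    if PulledAt (A w) t k then bestMean ν t - mean (ν t k) else 0) ∂P

end

end SWBandit

namespace SWBandit

/-! ## Exponential families -/

/-! Time is cut into blocks of length `W = 10 * τ * K`. The best arm is locked at a time if it leads
the last completed round with at least `3τ/(4K)` observations in the window. Call a block clean if
the laws do not change on it and its predecessor; at most `2 + 2Γ` blocks are not
(`card_not_clean_le`). On a clean block (`Clean.step`), off an event of probability at most `1/τ`, a
locked arm stays locked and costs only `O(log τ)` pulls of other arms; an unlocked one is locked at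
the end with conditional probability at least `1/2`, whatever the past. Hence the probabilities `u
j` of being unlocked satisfy `u (j+1) ≤ u j / 2 + 1/τ`, plus `1` if the block is not clean. Summing,
and charging a full block for every failure, gives regret of order `τ Γ + (T/τ) log τ`, which the
prescribed window balances.

Concentration: the member of the family with the midpoint mean `ξ` is the Chernoff tilt for both
arms, so the KL conditions say that `E exp (lam (X - ξ)) ≤ exp (-ω)` with tilts of opposite signs.
As pulls are chosen predictably, an exponential supermartingale bounds by `exp (-N ω)` the
probability that a given block of `N` successive observations lies on the wrong side of `ξ`
(`measureReal_selected_le`). With `n` of order `log τ`, all blocks of length at least `n` are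
simultaneously right, and the best arm wins every duel with `n` observations on both sides
(`Reliable.sepAt`).

Staying locked (`LockedAt.step`): other arms are pulled only while they have few observations, so
the leader keeps most rounds and nobody can overtake it. Its frequent pulls also keep every
diversity flag down, which improves the pull threshold from `(log τ)²` to `n`.

Getting locked (`lockedAt_of_reliable`): if the best arm never leads with `τ/K` observations, it
loses the lead for good. With `n` observations it would be pulled in every round and would fill the
window, and then the lead would have to pass to a different arm in each round; so it always has
fewer than `n`. The diversity flags then force, in each stretch of `L + 1` rounds, a pull of the
best arm, a shortage of the leader (at most once) or a fresh observation of a leader to which the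
best arm loses. A lost duel uses a block length between `n₁`, just above the forced exploration
`√(log τ)`, and `n`, so it needs a bad short block of the best arm or one of the leader. The former
are unlikely because the best arm has few pulls; about `τ / (log τ)²` of the latter would be needed,
whereas their expected number is of order `τ log τ exp (-ω √(log τ))`. A union bound and Markov's
inequality conclude, because `exp (-ω √(log τ))` beats every power of `log τ`. -/

theorem IsParam.isProbabilityMeasure {ρ : Measure ℝ} {θ : ℝ} (h : IsParam ρ θ) :
    IsProbabilityMeasure (expFam ρ θ) := by
  have : NeZero ρ := ⟨h.1⟩
  exact isProbabilityMeasure_tilted h.2.1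

theorem expFam_tilted {ρ : Measure ℝ} {θ η : ℝ} (hθ : IsParam ρ θ) :
    (expFam ρ θ).tilted (fun x => (η - θ) * x) = expFam ρ η := by
  unfold expFam
  rw [tilted_tilted hθ.2.1]
  congr 1
  ext x
  simp only [Pi.add_apply]
  ring

theorem integrable_exp_expFam {ρ : Measure ℝ} {θ η : ℝ} (hη : IsParam ρ η) :
    Integrable (fun x => Real.exp ((η - θ) * x)) (expFam ρ θ) := by
  unfold expFam
  by_cases hθ : Integrable (fun x => Real.exp (θ * x)) ρ
  · rw [integrable_tilted_iff hθ]
    refine hη.2.1.congr (Filter.Eventually.of_forall fun x => ?_)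
    simp only [smul_eq_mul, ← Real.exp_add]
    congr 1
    ring
  · rw [tilted_of_not_integrable hθ]
    exact integrable_zero_measure

/-- A Chernoff bound read off from the Kullback–Leibler divergence of two members of the family. -/
theorem integral_exp_le_of_le_klDiv {ρ : Measure ℝ} {θ η ω : ℝ} (hθ : IsParam ρ θ)
    (hη : IsParam ρ η) (hω : ENNReal.ofReal ω ≤ InformationTheory.klDiv (expFam ρ η) (expFam ρ θ))
    (hω0 : 0 < ω) :
    ∫ x, Real.exp ((η - θ) * (x - mean (expFam ρ η))) ∂(expFam ρ θ) ≤ Real.exp (-ω) := by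
  have hP := hθ.isProbabilityMeasure
  have hQ := hη.isProbabilityMeasure
  set P := expFam ρ θ with hPdef
  set Q := expFam ρ η with hQdef
  have hint : Integrable (fun x => Real.exp ((η - θ) * x)) P := integrable_exp_expFam hη
  have hQP : P.tilted (fun x => (η - θ) * x) = Q := expFam_tilted hθ
  have hac : Q ≪ P := hQP ▸ tilted_absolutelyContinuous _ _
  have hllr : llr Q P =ᵐ[Q]
      fun x => (η - θ) * x - Real.log (∫ x, Real.exp ((η - θ) * x) ∂P) := by
    refine hac.ae_le ?_
    have := log_rnDeriv_tilted_left_self hint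
    rw [hQP] at this
    exact this
  have hI : Integrable (fun x : ℝ => x) Q := hη.2.2
  have hint2 : Integrable (fun x => (η - θ) * x - Real.log (∫ x, Real.exp ((η - θ) * x) ∂P)) Q :=
    (hI.const_mul _).sub (integrable_const _)
  have hkl := InformationTheory.klDiv_of_ac_of_integrable hac (hint2.congr hllr.symm)
  rw [hkl, integral_congr_ae hllr, integral_sub (hI.const_mul _) (integrable_const _),
    integral_const_mul] at hω
  simp only [integral_const, probReal_univ, smul_eq_mul, one_mul, add_sub_cancel_right] at hω
  -- Truncation at zero leaves the alternative `ω ≤ 0`, excluded by `hω0`.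
  rw [ENNReal.ofReal_le_ofReal_iff'] at hω
  have hω' : ω ≤ (η - θ) * mean Q - Real.log (∫ x, Real.exp ((η - θ) * x) ∂P) := by
    rcases hω with h | h
    · exact h
    · linarith
  have hpos : 0 < ∫ x, Real.exp ((η - θ) * x) ∂P := integral_exp_pos hint
  have h1 : ∫ x, Real.exp ((η - θ) * (x - mean Q)) ∂P
      = Real.exp (-((η - θ) * mean Q)) * ∫ x, Real.exp ((η - θ) * x) ∂P := by
    rw [← integral_const_mul]
    congr 1
    ext x
    rw [← Real.exp_add]
    congr 1
    ring
  rw [h1, ← Real.exp_log (mul_pos (Real.exp_pos _) hpos), Real.exp_le_exp,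
    Real.log_mul (Real.exp_pos _).ne' hpos.ne', Real.log_exp]
  linarith

/-- The tilting parameter of the Chernoff bound has the sign of the deviation. -/
theorem mul_mean_sub_neg {ρ : Measure ℝ} {θ η ω : ℝ} (hθ : IsParam ρ θ)
    (hη : IsParam ρ η) (hω : ENNReal.ofReal ω ≤ InformationTheory.klDiv (expFam ρ η) (expFam ρ θ))
    (hω0 : 0 < ω) :
    (η - θ) * (mean (expFam ρ θ) - mean (expFam ρ η)) < 0 := by
  have hP := hθ.isProbabilityMeasure
  have h1 := integral_exp_le_of_le_klDiv hθ hη hω hω0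
  have hI : Integrable (fun x : ℝ => x) (expFam ρ θ) := hθ.2.2
  have hint : Integrable (fun x => Real.exp ((η - θ) * (x - mean (expFam ρ η)))) (expFam ρ θ) := by
    refine ((integrable_exp_expFam (θ := θ) hη).const_mul
      (Real.exp (-((η - θ) * mean (expFam ρ η))))).congr (Filter.Eventually.of_forall fun x => ?_)
    simp only [← Real.exp_add]
    congr 1
    ring
  have hc : Integrable (fun x : ℝ => (η - θ) * (x - mean (expFam ρ η))) (expFam ρ θ) :=
    (hI.sub (integrable_const _)).const_mul _
  -- Since `1 + u ≤ exp u`, an exponential moment below `1` forces the linear term to have negative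
  -- mean.
  have h2 : ∫ x, ((η - θ) * (x - mean (expFam ρ η)) + 1) ∂(expFam ρ θ) ≤
      ∫ x, Real.exp ((η - θ) * (x - mean (expFam ρ η))) ∂(expFam ρ θ) := by
    refine integral_mono ?_ hint fun x => Real.add_one_le_exp _
    exact hc.add (integrable_const _)
  rw [integral_add hc (integrable_const _), integral_const_mul,
    integral_sub hI (integrable_const _)] at h2
  simp only [integral_const, probReal_univ, smul_eq_mul, one_mul] at h2
  have h3 : Real.exp (-ω) < 1 := by rw [Real.exp_lt_one_iff]; linarith
  change (η - θ) * ((∫ x, x ∂(expFam ρ θ)) - _) < 0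
  linarith

/-- `p` deviates from its mean towards `ξ` with exponential rate at least `ω` at tilt `lam`. -/
def ExpBound (p : Measure ℝ) (ω lam ξ : ℝ) : Prop :=
  ∫⁻ x, ENNReal.ofReal (Real.exp (lam * (x - ξ))) ∂p ≤ ENNReal.ofReal (Real.exp (-ω))

theorem expBound_expFam {ρ : Measure ℝ} {θ η ω : ℝ} (hθ : IsParam ρ θ)
    (hη : IsParam ρ η) (hω : ENNReal.ofReal ω ≤ InformationTheory.klDiv (expFam ρ η) (expFam ρ θ))
    (hω0 : 0 < ω) : ExpBound (expFam ρ θ) ω (η - θ) (mean (expFam ρ η)) := by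
  have hint : Integrable (fun x => Real.exp ((η - θ) * (x - mean (expFam ρ η)))) (expFam ρ θ) := by
    refine ((integrable_exp_expFam (θ := θ) hη).const_mul
      (Real.exp (-((η - θ) * mean (expFam ρ η))))).congr (Filter.Eventually.of_forall fun x => ?_)
    simp only [← Real.exp_add]
    congr 1
    ring
  unfold ExpBound
  rw [← ofReal_integral_eq_lintegral_ofReal hint (Filter.Eventually.of_forall fun x => by positivity)]
  exact ENNReal.ofReal_le_ofReal (integral_exp_le_of_le_klDiv hθ hη hω hω0)

/-- What the regret analysis uses of a stationary model with best arm `b`: bounded positive gaps,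
and thresholds `ξ k` that separate exponentially the arm `k` from the best arm. -/
structure Separated {K : ℕ} (ω D : ℝ) (p : Fin K → Measure ℝ) (b : Fin K) : Prop where
  gap_pos : ∀ k, k ≠ b → mean (p k) < mean (p b)
  gap_le : ∀ k, k ≠ b → mean (p b) - mean (p k) ≤ D
  sep : ∀ k, k ≠ b → ∃ lam lam' ξ : ℝ, 0 < lam ∧ lam' < 0 ∧ ExpBound (p k) ω lam ξ ∧
    ExpBound (p b) ω lam' ξ

/-- The midpoint member `η` serves as tilt for both arms: its mean lies above that of `k` and below
that of `b`, so the tilts `η - θ k` and `η - θ b` have opposite signs while the threshold is common.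
-/
theorem IsExpFamModel.exists_separated {K : ℕ} {ω D : ℝ} {p : Fin K → Measure ℝ} (hω : 0 < ω)
    (h : IsExpFamModel ω D p) : ∃ b, Separated ω D p b := by
  obtain ⟨ρ, θ, hp, b, hb⟩ := h
  refine ⟨b, fun k hk => (hb k hk).1, fun k hk => (hb k hk).2.1, fun k hk => ?_⟩
  obtain ⟨h1, -, η, hη, hm, hkl, hkl'⟩ := hb k hk
  rw [(hp k).2, (hp b).2] at *
  refine ⟨η - θ k, η - θ b, mean (expFam ρ η), ?_, ?_,
    expBound_expFam (hp k).1 hη hkl hω, expBound_expFam (hp b).1 hη hkl' hω⟩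
  · have := mul_mean_sub_neg (hp k).1 hη hkl hω
    rw [hm] at this
    nlinarith
  · have := mul_mean_sub_neg (hp b).1 hη hkl' hω
    rw [hm] at this
    nlinarith

theorem Separated.unique {K : ℕ} {ω D : ℝ} {p : Fin K → Measure ℝ} {b b' : Fin K}
    (h : Separated ω D p b) (h' : Separated ω D p b') : b = b' := by
  by_contra hne
  exact lt_asymm (h.gap_pos b' (Ne.symm hne)) (h'.gap_pos b hne)

theorem Separated.iSup_mean {K : ℕ} {ω D : ℝ} {p : Fin K → Measure ℝ} {b : Fin K}
    (h : Separated ω D p b) : ⨆ k, mean (p k) = mean (p b) := by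
  have : Nonempty (Fin K) := ⟨b⟩
  refine le_antisymm (ciSup_le fun k => ?_) (le_ciSup (f := fun k => mean (p k)) (Set.finite_range _).bddAbove b)
  rcases eq_or_ne k b with rfl | hk
  · exact le_rfl
  · exact (h.gap_pos k hk).le

/-! ## Counting pulls -/

section Counting

variable {K : ℕ} {A : ℕ → Finset (Fin K)}

/-- Number of rounds `s ∈ (x, y]` in which arm `k` is pulled. -/
def pulls (A : ℕ → Finset (Fin K)) (k : Fin K) (x y : ℕ) : ℕ :=
  ((Finset.Ioc x y).filter (fun s => k ∈ A s)).card

theorem pulls_self (k : Fin K) (x : ℕ) : pulls A k x x = 0 := by simp [pulls]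

theorem pulls_succ (k : Fin K) {x y : ℕ} (h : x ≤ y) :
    pulls A k x (y + 1) = pulls A k x y + if k ∈ A (y + 1) then 1 else 0 := by
  unfold pulls
  rw [← Finset.insert_Ioc_right_eq_Ioc_add_one h, Finset.filter_insert]
  split_ifs with hk
  · rw [Finset.card_insert_of_notMem (by simp)]
  · rfl

theorem pulls_add (k : Fin K) {x y z : ℕ} (h : x ≤ y) (h' : y ≤ z) :
    pulls A k x y + pulls A k y z = pulls A k x z := by
  unfold pulls
  rw [← Finset.card_union_of_disjoint, ← Finset.filter_union, Finset.Ioc_union_Ioc_eq_Ioc h h']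
  exact Finset.disjoint_filter_filter (Finset.Ioc_disjoint_Ioc_of_le le_rfl)

theorem pulls_le (k : Fin K) (x y : ℕ) : pulls A k x y ≤ y - x :=
  (Finset.card_filter_le _ _).trans (by simp)

theorem pulls_mono (k : Fin K) {x x' y y' : ℕ} (hx : x' ≤ x) (hy : y ≤ y') :
    pulls A k x y ≤ pulls A k x' y' :=
  Finset.card_le_card (Finset.filter_subset_filter _ (Finset.Ioc_subset_Ioc hx hy))

theorem windowCount_eq_pulls (τ : ℕ) (k : Fin K) (r : ℕ) :
    windowCount τ A k r = pulls A k (r - τ) r := by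
  unfold windowCount pulls
  congr 1
  ext s
  simp only [Finset.mem_filter, Finset.mem_Icc, Finset.mem_Ioc]
  constructor
  · rintro ⟨⟨h1, h2⟩, h3, h4⟩
    exact ⟨⟨by omega, h2⟩, h4⟩
  · rintro ⟨⟨h1, h2⟩, h4⟩
    exact ⟨⟨by omega, h2⟩, by omega, h4⟩

theorem count_eq_pulls (k : Fin K) (r : ℕ) : count A k r = pulls A k 0 r := rfl

theorem windowCount_le (τ : ℕ) (k : Fin K) (r : ℕ) : windowCount τ A k r ≤ τ := by
  rw [windowCount_eq_pulls]
  exact (pulls_le _ _ _).trans (by omega)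

theorem pulls_le_windowCount {τ : ℕ} (k : Fin K) {x r : ℕ} (h : r ≤ x + τ) :
    pulls A k x r ≤ windowCount τ A k r := by
  rw [windowCount_eq_pulls]
  exact pulls_mono k (by omega) le_rfl

theorem windowCount_le_succ (τ : ℕ) (k : Fin K) (r : ℕ) :
    windowCount τ A k r ≤ windowCount τ A k (r + 1) + 1 := by
  rw [windowCount_eq_pulls, windowCount_eq_pulls,
    ← pulls_add (A := A) k (x := r - τ) (y := min r (r + 1 - τ)) (z := r) (by omega) (by omega)]
  have h1 := pulls_le (A := A) k (r - τ) (min r (r + 1 - τ))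
  have h2 : pulls A k (min r (r + 1 - τ)) r ≤ pulls A k (r + 1 - τ) (r + 1) := by
    rcases le_total r (r + 1 - τ) with h | h
    · rw [min_eq_left h, pulls_self]; omega
    · rw [min_eq_right h]
      exact pulls_mono k le_rfl (by omega)
  omega

theorem windowCount_succ_le (τ : ℕ) (k : Fin K) (r : ℕ) :
    windowCount τ A k (r + 1) ≤ windowCount τ A k r + if k ∈ A (r + 1) then 1 else 0 := by
  rw [windowCount_eq_pulls, windowCount_eq_pulls]
  calc pulls A k (r + 1 - τ) (r + 1) ≤ pulls A k (r - τ) (r + 1) := pulls_mono k (by omega) le_rfl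
    _ = _ := pulls_succ k (by omega)

/-- If an arm is only pulled when it has at most `n` pulls in the window, then it is pulled at
most `n + 1` times in a stretch of rounds not longer than the window. -/
theorem pulls_le_of_windowCount_le {τ n x y : ℕ} {k : Fin K} (hxy : x ≤ y) (hy : y ≤ x + τ)
    (h : ∀ s, x ≤ s → s < y → k ∈ A (s + 1) → windowCount τ A k s ≤ n) :
    pulls A k x y ≤ n + 1 := by
  induction y, hxy using Nat.le_induction with
  | base => simp [pulls_self]
  | succ y hxy ih =>
    rw [pulls_succ k hxy]
    split_ifs with hk
    -- Just before the last pull, all earlier pulls of the stretch are still in the window, so there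
    -- are at most `n` of them.
    · have := h y hxy (by omega) hk
      have := pulls_le_windowCount (A := A) k (τ := τ) (x := x) (r := y) (by omega)
      omega
    · have := ih (by omega) fun s h1 h2 => h s h1 (by omega)
      omega

/-- The same over a long stretch of rounds. -/
theorem pulls_le_mul_of_windowCount_le {τ n x y m : ℕ} {k : Fin K} (hxy : x ≤ y)
    (hy : y ≤ x + m * τ)
    (h : ∀ s, x ≤ s → s < y → k ∈ A (s + 1) → windowCount τ A k s ≤ n) :
    pulls A k x y ≤ m * (n + 1) := by
  induction m generalizing y with
  | zero =>
    obtain rfl : y = x := by omega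
    simp [pulls_self]
  | succ m ih =>
    have e : (m + 1) * τ = m * τ + τ := by ring
    have e' : (m + 1) * (n + 1) = m * (n + 1) + (n + 1) := by ring
    rcases le_total y (x + m * τ) with hle | hle
    · have := ih hxy hle h
      omega
    · rw [← pulls_add k (y := x + m * τ) (by omega) hle]
      have h1 := ih (y := x + m * τ) (by omega) le_rfl fun s hs hs' => h s hs (by omega)
      have h2 := pulls_le_of_windowCount_le (A := A) (k := k) (τ := τ) (n := n) (x := x + m * τ)
        (y := y) hle (by omega) fun s hs hs' => h s (by omega) hs'
      omega

/-- If some arm other than `b` is pulled whenever `b` is not, the pulls of the other arms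
account for the rounds in which `b` is not pulled. -/
theorem le_pulls_add_of_forall {x y n : ℕ} {b : Fin K}
    (h : ∀ s, x ≤ s → s < y → b ∉ A (s + 1) → ∃ k, k ≠ b ∧ k ∈ A (s + 1))
    (hn : ∀ k, k ≠ b → pulls A k x y ≤ n) : y - x ≤ pulls A b x y + (K - 1) * n := by
  have hsub : Finset.Ioc x y ⊆ ((Finset.Ioc x y).filter (fun s => b ∈ A s)) ∪
      (Finset.univ.erase b).biUnion (fun k => (Finset.Ioc x y).filter (fun s => k ∈ A s)) := by
    intro s hs
    rw [Finset.mem_union]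
    by_cases hb : b ∈ A s
    · exact Or.inl (Finset.mem_filter.2 ⟨hs, hb⟩)
    · right
      obtain ⟨h1, h2⟩ := Finset.mem_Ioc.1 hs
      obtain ⟨s, rfl⟩ : ∃ u, s = u + 1 := ⟨s - 1, by omega⟩
      obtain ⟨k, hk, hkA⟩ := h s (by omega) (by omega) hb
      exact Finset.mem_biUnion.2 ⟨k, by simp [hk], Finset.mem_filter.2 ⟨hs, hkA⟩⟩
  have h1 := (Finset.card_le_card hsub).trans (Finset.card_union_le _ _)
  rw [Nat.card_Ioc] at h1
  refine h1.trans (Nat.add_le_add_left ?_ _)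
  refine (Finset.card_biUnion_le_card_mul _ _ n fun k hk => hn k (by simpa using hk)).trans ?_
  simp

theorem min_le_sum_windowCount {τ : ℕ} (hA : ∀ r, 1 ≤ r → (A r).Nonempty) (r : ℕ) :
    min r τ ≤ ∑ k, windowCount τ A k r := by
  have hsub : Finset.Ioc (r - τ) r ⊆
      Finset.univ.biUnion (fun k => (Finset.Ioc (r - τ) r).filter (fun s => k ∈ A s)) := by
    intro s hs
    obtain ⟨k, hk⟩ := hA s (by have := (Finset.mem_Ioc.1 hs).1; omega)
    exact Finset.mem_biUnion.2 ⟨k, by simp, Finset.mem_filter.2 ⟨hs, hk⟩⟩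
  have h1 := (Finset.card_le_card hsub).trans Finset.card_biUnion_le
  rw [Nat.card_Ioc] at h1
  simp only [windowCount_eq_pulls]
  unfold pulls
  omega

end Counting

/-! ## Elementary properties of a run -/

section Run

variable {K : ℕ} {τ : ℕ} {x : ℕ → Fin K → ℝ} {l : ℕ → Fin K} {A : ℕ → Finset (Fin K)}

theorem mem_winners {k : Fin K} {r : ℕ} : k ∈ winners τ x l A r ↔ k ≠ l r ∧
    ((windowCount τ A k r : ℝ) ≤ Real.sqrt (Real.log τ) ∨ DiversityFlag τ l A k r ∨
      WinsDuel τ x l A k r) := by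
  simp [winners]

namespace IsRun

variable (h : IsRun τ x l A)
include h

theorem nonempty {r : ℕ} (hr : 1 ≤ r) : (A r).Nonempty := by
  obtain ⟨r, rfl⟩ : ∃ u, r = u + 1 := ⟨r - 1, by omega⟩
  rcases Nat.eq_zero_or_pos r with rfl | hr'
  · rw [h.first_round]
    exact ⟨l 0, by simp⟩
  · by_cases hw : (winners τ x l A r).Nonempty
    · rwa [h.pull_winners r hr' hw]
    · rw [h.pull_leader r hr' hw]
      simp

theorem mem_of_mem_winners {r : ℕ} (hr : 1 ≤ r) {k : Fin K} (hk : k ∈ winners τ x l A r) :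
    k ∈ A (r + 1) := by
  rwa [h.pull_winners r hr ⟨k, hk⟩]

theorem mem_winners_of_mem {r : ℕ} (hr : 1 ≤ r) {k : Fin K} (hk : k ∈ A (r + 1))
    (hkl : k ≠ l r) : k ∈ winners τ x l A r := by
  by_cases hw : (winners τ x l A r).Nonempty
  · rwa [h.pull_winners r hr hw] at hk
  · rw [h.pull_leader r hr hw] at hk
    exact absurd (by simpa using hk) hkl

theorem eq_leader_of_mem {r : ℕ} (hr : 1 ≤ r) (hl : l r ∈ A (r + 1)) {k : Fin K}
    (hk : k ∈ A (r + 1)) : k = l r := by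
  by_cases hw : (winners τ x l A r).Nonempty
  · rw [h.pull_winners r hr hw] at hl
    exact absurd rfl (mem_winners.1 hl).1
  · rw [h.pull_leader r hr hw] at hk
    simpa using hk

theorem exists_ne_of_notMem {r : ℕ} (hr : 1 ≤ r) {b : Fin K} (hb : b ∉ A (r + 1)) :
    ∃ k, k ≠ b ∧ k ∈ A (r + 1) := by
  obtain ⟨k, hk⟩ := h.nonempty (r := r + 1) (by omega)
  exact ⟨k, fun e => hb (e ▸ hk), hk⟩

/-- Pigeonhole: each round of the window pulls some arm, so the most pulled of the `K` arms has at
least a fraction `1/K` of the rounds. -/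
theorem argmax_ge {r : ℕ} {k : Fin K} (hk : IsArgmax τ A r Set.univ k) :
    ((min r τ : ℕ) : ℝ) / K ≤ windowCount τ A k r := by
  have hK : 0 < K := Fin.pos k
  rw [div_le_iff₀ (by exact_mod_cast hK)]
  have h1 := min_le_sum_windowCount (τ := τ) (fun r hr => h.nonempty hr) r
  have h2 : ∑ j, windowCount τ A j r ≤ ∑ _j : Fin K, windowCount τ A k r :=
    Finset.sum_le_sum fun j _ => hk.2 j (Set.mem_univ _)
  rw [Finset.sum_const, Finset.card_univ, Fintype.card_fin, smul_eq_mul, mul_comm] at h2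
  exact_mod_cast h1.trans h2

/-- The leader lacks observations at the end of round `r + 1`. -/
theorem ge_of_low {r : ℕ} (hr : 1 ≤ r) (hτ : τ ≤ r)
    (hl : (windowCount τ A (l r) (r + 1) : ℝ) < τ / (2 * K)) :
    (τ : ℝ) / K ≤ windowCount τ A (l (r + 1)) (r + 1) := by
  have := h.argmax_ge (h.leader_low r hr (by rwa [min_eq_right hτ]))
  rwa [min_eq_right (by omega)] at this

/-- A new leader is elected among all arms after a shortage of the old one, or among the eligible
arms, which have just been pulled; either way it starts with a full share `τ/K`. The gap between the
shares `τ/K` and `τ/(2K)` gives the leadership its inertia. -/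
theorem change {r : ℕ} (hr : 1 ≤ r) (hτ : τ ≤ r) (hne : l (r + 1) ≠ l r) :
    (τ : ℝ) / K ≤ windowCount τ A (l (r + 1)) (r + 1) ∧
      ((windowCount τ A (l r) (r + 1) : ℝ) < τ / (2 * K) ∨ l (r + 1) ∈ A (r + 1)) := by
  rcases lt_or_ge (windowCount τ A (l r) (r + 1) : ℝ) (τ / (2 * K)) with hl | hl
  · exact ⟨h.ge_of_low hr hτ hl, Or.inl hl⟩
  · have h1 := (h.leader_keep r hr (by rwa [min_eq_right hτ])).1
    rcases h1 with h1 | h1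
    · have h2 := h1.2
      rw [min_eq_right hτ] at h2
      exact ⟨h2, Or.inr h1.1⟩
    · exact absurd h1 hne

/-- This makes the leader's side of a duel always long enough: past the first window, only the
challenger can lack observations. -/
theorem leader_ge {r : ℕ} (hr : 1 ≤ r) (hτ : τ < r) :
    (τ : ℝ) / (2 * K) ≤ windowCount τ A (l r) r := by
  obtain ⟨r, rfl⟩ : ∃ u, r = u + 1 := ⟨r - 1, by omega⟩
  rcases Nat.eq_zero_or_pos r with rfl | hr'
  · have : τ = 0 := by omega
    simp [this]
  have hK : (0 : ℝ) < K := by exact_mod_cast Fin.pos (l 0)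
  have hle : (τ : ℝ) / (2 * K) ≤ τ / K := by
    gcongr
    linarith
  by_cases hne : l (r + 1) = l r
  · rcases lt_or_ge (windowCount τ A (l r) (r + 1) : ℝ) (τ / (2 * K)) with hl | hl
    · exact hle.trans (h.ge_of_low hr' (by omega) hl)
    · rwa [hne]
  · exact hle.trans (h.change hr' (by omega) hne).1

end IsRun

end Run

/-! ## Dynamics of the leader -/

section Dynamics

variable {K : ℕ} {τ n : ℕ} {x : ℕ → Fin K → ℝ} {l : ℕ → Fin K} {A : ℕ → Finset (Fin K)} {b : Fin K}

theorem windowCount_le_succ_of_mem {k : Fin K} {r : ℕ} (hτ : 1 ≤ τ) (hk : k ∈ A (r + 1)) :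
    windowCount τ A k r ≤ windowCount τ A k (r + 1) := by
  rw [windowCount_eq_pulls, windowCount_eq_pulls, pulls_succ (x := r + 1 - τ) k (by omega),
    if_pos hk, ← pulls_add (A := A) k (x := r - τ) (y := r + 1 - τ) (z := r) (by omega) (by omega)]
  have := pulls_le (A := A) k (r - τ) (r + 1 - τ)
  omega

theorem pulls_eq_of_forall {k : Fin K} {x y : ℕ} (h : ∀ s, x < s → s ≤ y → k ∈ A s) :
    pulls A k x y = y - x := by
  unfold pulls
  rw [Finset.filter_true_of_mem, Nat.card_Ioc]
  intro s hs
  exact h s (Finset.mem_Ioc.1 hs).1 (Finset.mem_Ioc.1 hs).2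

theorem pulls_lt_of_notMem {k : Fin K} {x y s : ℕ} (h1 : x < s) (h2 : s ≤ y) (hs : k ∉ A s) :
    pulls A k x y < y - x := by
  unfold pulls
  rw [← Nat.card_Ioc]
  refine Finset.card_lt_card (Finset.filter_ssubset.2 ⟨s, Finset.mem_Ioc.2 ⟨h1, h2⟩, hs⟩)

/-- With at least `n` observations on both sides, the duels between the best arm `b` and the
other arms are won by `b`. -/
def SepAt (τ : ℕ) (x : ℕ → Fin K → ℝ) (l : ℕ → Fin K) (A : ℕ → Finset (Fin K)) (b : Fin K)
    (n r : ℕ) : Prop :=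
  (l r = b → ∀ k, k ≠ b → n ≤ windowCount τ A k r → n ≤ windowCount τ A b r →
    ¬ WinsDuel τ x l A k r) ∧
  (l r ≠ b → n ≤ windowCount τ A b r → n ≤ windowCount τ A (l r) r → WinsDuel τ x l A b r)

/-- The window `τ` is large enough compared with the number `n` of observations from which the
empirical means are reliable. -/
structure Admissible (K τ n : ℕ) : Prop where
  two_le : 2 ≤ K
  sqrt_le : Real.sqrt (Real.log τ) ≤ n
  le_sq : (n : ℝ) ≤ Real.log τ ^ 2
  sq_ge : 2 * (K : ℝ) ≤ Real.log τ ^ 2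
  sq_le : 4 * (K : ℝ) ^ 2 * (Real.log τ ^ 2 + 4) ≤ τ

/-- Largest integer below `(log τ)²`. -/
noncomputable def sqFloor (τ : ℕ) : ℕ := ⌊Real.log τ ^ 2⌋₊

theorem sqFloor_le (τ : ℕ) : (sqFloor τ : ℝ) ≤ Real.log τ ^ 2 := Nat.floor_le (sq_nonneg _)

theorem le_sqFloor {m τ : ℕ} (h : (m : ℝ) ≤ Real.log τ ^ 2) : m ≤ sqFloor τ := Nat.le_floor h

namespace Admissible

variable (ha : Admissible K τ n)
include ha

theorem two_le_cast : (2 : ℝ) ≤ K := by exact_mod_cast ha.two_le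

theorem four_mul_le : 4 * (K : ℝ) * ((K : ℝ) * (sqFloor τ + 4)) ≤ τ := by
  have h1 := ha.two_le_cast
  have h2 := sqFloor_le τ
  calc 4 * (K : ℝ) * ((K : ℝ) * (sqFloor τ + 4)) = 4 * (K : ℝ) ^ 2 * (sqFloor τ + 4) := by ring
    _ ≤ 4 * (K : ℝ) ^ 2 * (Real.log τ ^ 2 + 4) := by gcongr
    _ ≤ τ := ha.sq_le

theorem add_le : K + 16 ≤ τ := by
  have h1 := ha.two_le_cast
  have h2 := ha.sq_ge
  have h3 := ha.sq_le
  have : (K : ℝ) + 16 ≤ τ := by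
    calc (K : ℝ) + 16 ≤ 4 * 2 ^ 2 * (2 * K + 4) := by linarith
      _ ≤ 4 * (K : ℝ) ^ 2 * (Real.log τ ^ 2 + 4) := by gcongr
      _ ≤ τ := h3
  exact_mod_cast this

theorem flagLength_le : flagLength K τ ≤ τ := by
  refine Nat.ceil_le.2 ?_
  have := ha.sq_le
  have := ha.two_le_cast
  nlinarith [sq_nonneg (Real.log τ),
    mul_nonneg (sq_nonneg (Real.log τ)) (by linarith : (0 : ℝ) ≤ (K : ℝ) - 2)]

/-- The left side bounds the rounds of one window that a reliable leader cedes to the other arms.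
The margin `τ/(4K)` separates the locking level `3τ/(4K)` from the shortage level `τ/(2K)` and from
the election level `τ/K`. -/
theorem loss_le : (((K - 1) * (sqFloor τ + 1) : ℕ) : ℝ) ≤ τ / (4 * K) := by
  have h1 := ha.two_le_cast
  have h2 := ha.four_mul_le
  rw [le_div_iff₀ (by positivity)]
  have h3 : (((K - 1) * (sqFloor τ + 1) : ℕ) : ℝ) ≤ K * (sqFloor τ + 4) := by
    rw [Nat.cast_mul]
    gcongr
    · exact_mod_cast Nat.sub_le K 1
    · push_cast; linarith
  nlinarith

theorem sqFloor_lt : (sqFloor τ : ℝ) + 1 < τ / (2 * K) := by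
  have h1 := ha.two_le_cast
  have h2 := ha.four_mul_le
  rw [lt_div_iff₀ (by positivity)]
  have : (0 : ℝ) ≤ sqFloor τ := by positivity
  nlinarith [mul_nonneg this (sub_nonneg.2 h1), mul_nonneg (mul_nonneg this (sub_nonneg.2 h1)) (sub_nonneg.2 h1), mul_nonneg this (by linarith : (0:ℝ) ≤ K)]

theorem le_sqFloor' : n ≤ sqFloor τ := le_sqFloor ha.le_sq

theorem lt_of_ge {m : ℕ} (h : (τ : ℝ) / (2 * K) ≤ m) : n ≤ m := by
  have h1 := ha.sqFloor_lt
  have h2 : (n : ℝ) ≤ sqFloor τ := by exact_mod_cast ha.le_sqFloor'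
  have : (n : ℝ) ≤ m := by linarith
  exact_mod_cast this

end Admissible

namespace IsRun

variable (h : IsRun τ x l A) (ha : Admissible K τ n)
include h ha

/-- Under a leader `b`, the other arms are only pulled when they have few observations. -/
theorem windowCount_le_of_pull {r : ℕ} (hr : τ < r) (hs : SepAt τ x l A b n r) (hl : l r = b)
    {k : Fin K} (hk : k ≠ b) (hkA : k ∈ A (r + 1)) : windowCount τ A k r ≤ sqFloor τ := by
  have hw := mem_winners.1 (h.mem_winners_of_mem (by omega) hkA (hl ▸ hk))
  rcases hw.2 with h1 | h1 | h1
  · exact le_sqFloor (h1.trans (ha.sqrt_le.trans ha.le_sq))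
  · exact le_sqFloor h1.2.2.2
  -- A challenger with more than `(log τ)² ≥ n` observations meets a leader with at least `τ/(2K) ≥
  -- n`, so separation rules out its victory.
  · by_contra hlt
    push Not at hlt
    have hn := ha.le_sqFloor'
    refine hs.1 hl k hk (by omega) ?_ h1
    have := h.leader_ge (r := r) (by omega) hr
    rw [hl] at this
    exact ha.lt_of_ge this

/-- Within a window length each other arm is pulled at most `sqFloor τ + 1` times, and `b` takes all
rounds in which none of them is pulled. -/
theorem le_pulls_of_leader {r v : ℕ} (hr : τ < r) (hrv : r ≤ v) (hv : v ≤ r + τ)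
    (hs : ∀ s, r ≤ s → s < v → SepAt τ x l A b n s) (hl : ∀ s, r ≤ s → s < v → l s = b) :
    v - r ≤ pulls A b r v + (K - 1) * (sqFloor τ + 1) := by
  refine le_pulls_add_of_forall (fun s h1 h2 hb => ?_) fun k hk => ?_
  · exact h.exists_ne_of_notMem (by omega) hb
  · refine pulls_le_of_windowCount_le (τ := τ) hrv hv fun s h1 h2 hkA => ?_
    exact h.windowCount_le_of_pull ha (by omega) (hs s h1 h2) (hl s h1 h2) hk hkA

/-- The loss is counted once, not once per window: after a full window of leadership the count is
nearly `τ` whatever it was before, and earlier each observation that expires makes room for one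
round led by `b`. -/
theorem le_windowCount_of_leader {r v : ℕ} (hr : τ < r) (hrv : r ≤ v)
    (hs : ∀ s, r ≤ s → s < v → SepAt τ x l A b n s) (hl : ∀ s, r ≤ s → s < v → l s = b) :
    windowCount τ A b r ≤ windowCount τ A b v + (K - 1) * (sqFloor τ + 1) ∧
      (r + τ ≤ v → τ ≤ windowCount τ A b v + (K - 1) * (sqFloor τ + 1)) := by
  have hfull : r + τ ≤ v → τ ≤ windowCount τ A b v + (K - 1) * (sqFloor τ + 1) := by
    intro hv
    have := h.le_pulls_of_leader ha (r := v - τ) (v := v) (by omega) (by omega) (by omega)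
      (fun s h1 h2 => hs s (by omega) h2) (fun s h1 h2 => hl s (by omega) h2)
    rw [windowCount_eq_pulls]
    omega
  refine ⟨?_, hfull⟩
  rcases le_total (r + τ) v with hv | hv
  · exact (windowCount_le τ b r).trans (hfull hv)
  · have h1 := h.le_pulls_of_leader ha (r := r) (v := v) hr hrv hv hs hl
    rw [windowCount_eq_pulls, windowCount_eq_pulls,
      ← pulls_add (A := A) b (x := v - τ) (y := r) (z := v) (by omega) hrv,
      ← pulls_add (A := A) b (x := r - τ) (y := v - τ) (z := r) (by omega) (by omega)]
    have := pulls_le (A := A) b (r - τ) (v - τ)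
    omega

/-- A best arm with enough observations stays the leader. -/
theorem leader_persists {r v : ℕ} (hr : τ < r)
    (hs : ∀ s, r ≤ s → s < v → SepAt τ x l A b n s) (hl : l r = b)
    (hN : 3 * (τ : ℝ) / (4 * K) ≤ windowCount τ A b r) :
    ∀ s, r ≤ s → s ≤ v → l s = b := by
  have hK := ha.two_le_cast
  suffices H : ∀ s, r ≤ s → s ≤ v → ∀ t, r ≤ t → t ≤ s → l t = b from
    fun s h1 h2 => H s h1 h2 s h1 le_rfl
  intro s h1
  induction s, h1 using Nat.le_induction with
  | base => intro _ t ht ht'; rwa [le_antisymm ht' ht]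
  | succ s hs1 ih =>
    intro hsv t ht hts
    have ih' := ih (by omega)
    rcases Nat.lt_or_ge t (s + 1) with hlt | hge
    · exact ih' t ht (by omega)
    obtain rfl : t = s + 1 := by omega
    by_contra hne
    have hls := ih' s hs1 le_rfl
    have hc := h.change (r := s) (by omega) (by omega) (by rwa [hls])
    have hw := (h.le_windowCount_of_leader ha (v := s + 1) hr (by omega)
      (fun u h1 h2 => hs u h1 (by omega)) (fun u h1 h2 => ih' u h1 (by omega))).1
    have hw' : (windowCount τ A b r : ℝ) ≤
        windowCount τ A b (s + 1) + ((K - 1) * (sqFloor τ + 1) : ℕ) := by exact_mod_cast hw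
    have hloss := ha.loss_le
    -- A shortage would need a loss above `τ/(4K)`. A rival elected with `τ/K` observations has just
    -- been pulled under `b`, hence has at most `sqFloor τ + 1`.
    rcases hc.2 with hlow | hmem
    · rw [hls] at hlow
      have : 3 * (τ : ℝ) / (4 * K) = τ / (2 * K) + τ / (4 * K) := by
        field_simp; ring
      linarith
    · have h2 := h.windowCount_le_of_pull ha (by omega) (hs s hs1 (by omega)) hls hne hmem
      have h3 := windowCount_succ_le (A := A) τ (l (s + 1)) s
      rw [if_pos hmem] at h3
      have h4 : (windowCount τ A (l (s + 1)) (s + 1) : ℝ) ≤ sqFloor τ + 1 := by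
        exact_mod_cast h3.trans (by omega)
      have h5 := ha.sqFloor_lt
      have h6 : (τ : ℝ) / (2 * K) ≤ τ / K := by
        gcongr
        linarith
      linarith [hc.1]

/-- No diversity flag is raised under the leader `b`. -/
theorem not_diversityFlag {r : ℕ} {k : Fin K} (hr : τ + flagLength K τ < r)
    (hs : ∀ s, r ≤ s + flagLength K τ → s < r → SepAt τ x l A b n s) (hl : l r = b) :
    ¬ DiversityFlag τ l A k r := by
  rintro ⟨-, hkb, hfl, -⟩
  set L := flagLength K τ with hL
  have hK := ha.two_le_cast
  rw [hl] at hfl hkb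
  have hsq := sqFloor_le τ
  have hLτ : L ≤ τ := ha.flagLength_le
  have hp : ∀ j, j ≠ b → pulls A j (r - L) r ≤ sqFloor τ + 1 := fun j hj =>
    pulls_le_of_windowCount_le (τ := τ) (by omega) (by omega) fun s h1 h2 hjA =>
      h.windowCount_le_of_pull ha (by omega) (hs s (by omega) h2) (hfl s h2 (by omega)).1 hj hjA
  have hz : ∀ j, (j = b ∨ j = k) → pulls A j (r - L) r = 0 := by
    intro j hj
    unfold pulls
    rw [Finset.card_eq_zero, Finset.filter_eq_empty_iff]
    intro s hs hjs
    obtain ⟨h1, h2⟩ := Finset.mem_Ioc.1 hs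
    obtain ⟨s, rfl⟩ : ∃ u, s = u + 1 := ⟨s - 1, by omega⟩
    have := hfl s (by omega) (by omega)
    rcases hj with rfl | rfl
    · exact this.2.1 hjs
    · exact this.2.2 hjs
  -- During the flagged rounds neither `b` nor `k` is pulled, so the other `K - 2` arms must account
  -- for all `L` rounds.
  have hsum : L ≤ ∑ j ∈ (Finset.univ.erase b).erase k, pulls A j (r - L) r := by
    have h1 : Finset.Ioc (r - L) r ⊆ ((Finset.univ.erase b).erase k).biUnion
        (fun j => (Finset.Ioc (r - L) r).filter (fun s => j ∈ A s)) := by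
      intro s hsI
      obtain ⟨h1, h2⟩ := Finset.mem_Ioc.1 hsI
      obtain ⟨s, rfl⟩ : ∃ u, s = u + 1 := ⟨s - 1, by omega⟩
      have := hfl s (by omega) (by omega)
      obtain ⟨j, hj⟩ := h.nonempty (r := s + 1) (by omega)
      refine Finset.mem_biUnion.2 ⟨j, ?_, Finset.mem_filter.2 ⟨hsI, hj⟩⟩
      simp only [Finset.mem_erase, Finset.mem_univ, and_true]
      exact ⟨fun e => this.2.2 (e ▸ hj), fun e => this.2.1 (e ▸ hj)⟩
    have h2 := (Finset.card_le_card h1).trans Finset.card_biUnion_le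
    rw [Nat.card_Ioc] at h2
    exact le_trans (by omega) h2
  have hle : L ≤ (K - 2) * (sqFloor τ + 1) := by
    refine hsum.trans ((Finset.sum_le_card_nsmul _ _ (sqFloor τ + 1) fun j hj => hp j ?_).trans ?_)
    · simp only [Finset.mem_erase, Finset.mem_univ, and_true] at hj
      exact hj.2
    · rw [Finset.card_erase_of_mem (by simpa using hkb), Finset.card_erase_of_mem (by simp),
        Finset.card_univ, Fintype.card_fin, smul_eq_mul]
      exact le_of_eq (by rw [Nat.sub_sub])
  have hLge : ((K : ℝ) - 1) * Real.log τ ^ 2 ≤ L := Nat.le_ceil _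
  have hle' : (L : ℝ) ≤ ((K : ℝ) - 2) * (sqFloor τ + 1) := by
    have : (L : ℝ) ≤ (((K - 2) * (sqFloor τ + 1) : ℕ) : ℝ) := by exact_mod_cast hle
    rwa [Nat.cast_mul, Nat.cast_sub ha.two_le, Nat.cast_add, Nat.cast_one, Nat.cast_ofNat] at this
  have := ha.sq_ge
  -- The flag length `(K - 1)(log τ)²` exceeds `(K - 2)((log τ)² + 1)`, because `(log τ)² ≥ 2K > K -
  -- 2`.
  nlinarith [mul_le_mul_of_nonneg_left hsq (by linarith : (0:ℝ) ≤ (K:ℝ) - 2)]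

/-- Under a leader `b` which is reliably the best arm, the other arms are only pulled when they
have at most `n` observations. -/
theorem windowCount_le_of_pull' {r : ℕ} {k : Fin K} (hr : τ + flagLength K τ < r)
    (hs : ∀ s, r ≤ s + flagLength K τ → s ≤ r → SepAt τ x l A b n s) (hl : l r = b)
    (hk : k ≠ b) (hkA : k ∈ A (r + 1)) : windowCount τ A k r ≤ n := by
  have hw := mem_winners.1 (h.mem_winners_of_mem (by omega) hkA (hl ▸ hk))
  rcases hw.2 with h1 | h1 | h1
  · exact_mod_cast h1.trans ha.sqrt_le
  · exact absurd h1 (h.not_diversityFlag ha hr (fun s h1 h2 => hs s h1 h2.le) hl)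
  · by_contra hlt
    push Not at hlt
    refine (hs r (by omega) le_rfl).1 hl k hk (by omega) ?_ h1
    have := h.leader_ge (r := r) (by omega) (by omega)
    rw [hl] at this
    exact ha.lt_of_ge this

end IsRun

end Dynamics

/-! ## How the best arm becomes the leader -/

section Acquisition

variable {K : ℕ} {τ n : ℕ} {x : ℕ → Fin K → ℝ} {l : ℕ → Fin K} {A : ℕ → Finset (Fin K)} {b : Fin K}

/-- Arm `b` is the leader at round `r` and has at least `τ / K` observations in the window. -/
def LeadsAt (τ : ℕ) (l : ℕ → Fin K) (A : ℕ → Finset (Fin K)) (b : Fin K) (r : ℕ) : Prop :=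
  l r = b ∧ (τ : ℝ) / K ≤ windowCount τ A b r

/-- The leader of round `s` lacks observations at the end of round `s + 1`. -/
def LowAt (τ : ℕ) (l : ℕ → Fin K) (A : ℕ → Finset (Fin K)) (s : ℕ) : Prop :=
  (windowCount τ A (l s) (s + 1) : ℝ) < τ / (2 * K)

namespace IsRun

/-- Taking the lead requires `τ/K` observations at that very moment, so an arm that never leads with
that many cannot come back. -/
theorem leader_ne_of_not_leadsAt (h : IsRun τ x l A) {r v : ℕ} (hr : 1 ≤ r) (hτ : τ ≤ r)
    (hl : l r ≠ b) (hno : ∀ s, r ≤ s → s ≤ v → ¬ LeadsAt τ l A b s) :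
    ∀ s, r ≤ s → s ≤ v → l s ≠ b := by
  intro s h1
  induction s, h1 using Nat.le_induction with
  | base => exact fun _ => hl
  | succ s hs ih =>
    intro hsv he
    have h1 := ih (by omega)
    have h2 := (h.change (r := s) (by omega) (by omega) (by rw [he]; exact Ne.symm h1)).1
    rw [he] at h2
    exact hno (s + 1) (by omega) hsv ⟨he, h2⟩

variable (h : IsRun τ x l A) (ha : Admissible K τ n)
include h ha

/-- A whole window of reliable leadership would itself provide `τ/K` observations. -/
theorem exists_leader_ne {r : ℕ} (hr : τ < r)
    (hs : ∀ s, r ≤ s → s < r + τ → SepAt τ x l A b n s)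
    (hno : ∀ s, r ≤ s → s ≤ r + τ → ¬ LeadsAt τ l A b s) :
    ∃ s, r ≤ s ∧ s ≤ r + τ ∧ l s ≠ b := by
  by_contra hcon
  push Not at hcon
  have hK := ha.two_le_cast
  have h1 := (h.le_windowCount_of_leader ha (b := b) (v := r + τ) hr (by omega) hs
    (fun s h1 h2 => hcon s h1 h2.le)).2 le_rfl
  refine hno (r + τ) (by omega) le_rfl ⟨hcon _ (by omega) le_rfl, ?_⟩
  have h2 : (τ : ℝ) ≤ windowCount τ A b (r + τ) + ((K - 1) * (sqFloor τ + 1) : ℕ) := by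
    exact_mod_cast h1
  have h3 := ha.loss_le
  have h4 : (τ : ℝ) / K ≤ τ / 2 := by gcongr
  have h5 : (τ : ℝ) / (4 * K) ≤ τ / 2 := by gcongr; linarith
  linarith

/-- A best arm with `n` observations is pulled until it becomes the leader. -/
theorem windowCount_lt_of_leader_ne {r v : ℕ} (hr : τ < r)
    (hs : ∀ s, r ≤ s → s ≤ v → SepAt τ x l A b n s) (hl : ∀ s, r ≤ s → s ≤ v → l s ≠ b)
    (hv : r + τ + K + 1 ≤ v) : windowCount τ A b r < n := by
  by_contra hn
  push Not at hn
  have hτ := ha.add_le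
  have hK := ha.two_le_cast
  have hstep : ∀ s, r ≤ s → s ≤ v → n ≤ windowCount τ A b s → b ∈ A (s + 1) := by
    intro s h1 h2 h3
    refine h.mem_of_mem_winners (by omega) (mem_winners.2 ⟨Ne.symm (hl s h1 h2), Or.inr (Or.inr ?_)⟩)
    exact (hs s h1 h2).2 (hl s h1 h2) h3 (ha.lt_of_ge (h.leader_ge (by omega) (by omega)))
  have hN : ∀ s, r ≤ s → s ≤ v → n ≤ windowCount τ A b s := by
    intro s h1
    induction s, h1 using Nat.le_induction with
    | base => exact fun _ => hn
    | succ s h1 ih =>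
      intro h2
      exact (ih (by omega)).trans (windowCount_le_succ_of_mem (by omega)
        (hstep s h1 (by omega) (ih (by omega))))
  have hmem : ∀ s, r ≤ s → s ≤ v → b ∈ A (s + 1) := fun s h1 h2 => hstep s h1 h2 (hN s h1 h2)
  -- Once `b` occupies the whole window it is a candidate for the lead, so whoever is preferred to
  -- it must also have been pulled in every round of the window.
  have hfull : ∀ s, r + τ ≤ s → s < v → τ ≤ windowCount τ A (l (s + 1)) (s + 1) := by
    intro s h1 h2
    have hb : windowCount τ A b (s + 1) = τ := by
      rw [windowCount_eq_pulls, pulls_eq_of_forall]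
      · omega
      · intro t h3 h4
        obtain ⟨t, rfl⟩ : ∃ u, t = u + 1 := ⟨t - 1, by omega⟩
        exact hmem t (by omega) (by omega)
    rcases lt_or_ge (windowCount τ A (l s) (s + 1) : ℝ) (((min s τ : ℕ) : ℝ) / (2 * K)) with hc | hc
    · have := (h.leader_low s (by omega) hc).2 b (Set.mem_univ _)
      rwa [hb] at this
    · have := (h.leader_keep s (by omega) hc).2 b (Or.inl ⟨hmem s (by omega) (by omega), ?_⟩)
      · rwa [hb] at this
      · rw [hb, min_eq_right (by omega)]
        exact div_le_self (by positivity) (by linarith)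
  -- A leader is not pulled in a round that pulls the challenger `b`; it then misses a round of the
  -- window and cannot lead again while that round is inside. So `K` successive rounds need `K`
  -- distinct leaders among the `K - 1` arms other than `b`.
  have hdiff : ∀ s t, r + τ + 1 ≤ s → s < t → t ≤ r + τ + K → l s ≠ l t := by
    intro s t h1 h2 h3 he
    obtain ⟨t, rfl⟩ : ∃ u, t = u + 1 := ⟨t - 1, by omega⟩
    have hns : l s ∉ A (s + 1) := fun hm =>
      hl s (by omega) (by omega)
        (h.eq_leader_of_mem (by omega) hm (hmem s (by omega) (by omega))).symm
    have h4 := hfull t (by omega) (by omega)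
    rw [← he, windowCount_eq_pulls] at h4
    have := pulls_lt_of_notMem (x := t + 1 - τ) (y := t + 1) (by omega) (by omega) hns
    omega
  have hcard := Finset.card_le_card_of_injOn (s := Finset.Icc (r + τ + 1) (r + τ + K))
    (t := Finset.univ.erase b) l
    (fun s hsm => by
      have := Finset.mem_Icc.1 hsm
      simpa using hl s (by omega) (by omega))
    (fun s h1 t h2 he => by
      have h1 := Finset.mem_Icc.1 h1
      have h2 := Finset.mem_Icc.1 h2
      rcases lt_trichotomy s t with hlt | heq | hlt
      · exact absurd he (hdiff s t h1.1 hlt h2.2)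
      · exact heq
      · exact absurd he.symm (hdiff t s h2.1 hlt h1.2))
  rw [Nat.card_Icc, Finset.card_erase_of_mem (by simp), Finset.card_univ, Fintype.card_fin] at hcard
  have := ha.two_le
  omega

/-- Thanks to the diversity flags, a best arm that is neither the leader nor pulled for a while
faces a leader which gets new observations, or which lacks observations. -/
theorem exists_new_observation {q : ℕ} (hq : τ + flagLength K τ < q)
    (hb : ∀ s, q ≤ s + flagLength K τ → s ≤ q → b ∉ A (s + 1)) (hl : l q ≠ b)
    (hN : windowCount τ A b q < n) :
    ∃ s, q < s + 1 + flagLength K τ ∧ s < q ∧ (LowAt τ l A s ∨ l (s + 1) ∈ A (s + 1)) := by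
  have hfl : ¬ DiversityFlag τ l A b q := fun hf =>
    hb q (by omega) le_rfl (h.mem_of_mem_winners (by omega) (mem_winners.2 ⟨Ne.symm hl, Or.inr (Or.inl hf)⟩))
  have hN' : (windowCount τ A b q : ℝ) ≤ Real.log τ ^ 2 := by
    refine le_trans ?_ ha.le_sq
    exact_mod_cast hN.le
  by_contra hcon
  push Not at hcon
  refine hfl ⟨by omega, Ne.symm hl, fun s h1 h2 => ?_, hN'⟩
  -- Without shortage, a change of leader promotes an arm just pulled, which would already be a new
  -- observation of the leader. So the leader is constant and unpulled, and the flag of `b` is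
  -- raised after all.
  have hconst : ∀ s, q ≤ s + flagLength K τ → s < q → l (s + 1) = l s := by
    intro s h1 h2
    by_contra hne
    have h3 := hcon s (by omega) h2
    rcases (h.change (r := s) (by omega) (by omega) hne).2 with h4 | h4
    · exact h3.1 h4
    · exact h3.2 h4
  have hall : ∀ d, d ≤ q → q ≤ (q - d) + flagLength K τ → l (q - d) = l q := by
    intro d
    induction d with
    | zero => intro _ _; rfl
    | succ d ih =>
      intro h3 h4
      have h5 := hconst (q - (d + 1)) h4 (by omega)
      rw [show q - (d + 1) + 1 = q - d by omega] at h5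
      rw [← h5]
      exact ih (by omega) (by omega)
  have hls := hall (q - s) (by omega) (by omega)
  rw [show q - (q - s) = s by omega] at hls
  refine ⟨hls, fun hm => ?_, hb s h2 h1.le⟩
  have h3 := hconst s h2 h1
  exact (hcon s (by omega) h1).2 (by rw [h3, hls]; exact hm)

/-- A shortage installs a leader with `τ/K` observations. Afterwards the count of the current leader
drops by at most one per round, or restarts from at least `τ/K` at a change, so it takes `τ/(2K)`
rounds to fall short again. -/
theorem low_separated {s t : ℕ} (hs : τ ≤ s) (hst : s < t) (h1 : LowAt τ l A s)
    (h2 : LowAt τ l A t) : (τ : ℝ) / (2 * K) < t - s := by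
  have hτ := ha.add_le
  have hK := ha.two_le_cast
  have H : ∀ u, s + 1 ≤ u → (τ : ℝ) / K ≤ windowCount τ A (l u) u + (u - (s + 1)) := by
    intro u hu
    induction u, hu using Nat.le_induction with
    | base =>
      have := h.ge_of_low (by omega) hs h1
      push_cast
      linarith
    | succ u hu ih =>
      by_cases hc : l (u + 1) = l u
      · rw [hc]
        have : (windowCount τ A (l u) u : ℝ) ≤ windowCount τ A (l u) (u + 1) + 1 := by
          exact_mod_cast windowCount_le_succ τ (l u) u
        push_cast
        linarith
      · have := (h.change (r := u) (by omega) (by omega) hc).1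
        have h3 : (s : ℝ) + 1 ≤ u := by exact_mod_cast hu
        push_cast
        linarith
  have h3 := H t (by omega)
  have h4 : (windowCount τ A (l t) t : ℝ) ≤ windowCount τ A (l t) (t + 1) + 1 := by
    exact_mod_cast windowCount_le_succ τ (l t) t
  unfold LowAt at h2
  have h5 : (τ : ℝ) / K = τ / (2 * K) + τ / (2 * K) := by
    field_simp; ring
  linarith

open Classical in
/-- While the best arm is neither the leader nor often pulled, the leader gets many new
observations. -/
theorem le_card_new_observations {y m : ℕ} (hy : τ + flagLength K τ < y)
    (hm : ((m * (flagLength K τ + 1) : ℕ) : ℝ) ≤ τ / (2 * K))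
    (hl : ∀ s, y ≤ s → s ≤ y + m * (flagLength K τ + 1) → l s ≠ b)
    (hN : ∀ s, y ≤ s → s ≤ y + m * (flagLength K τ + 1) → windowCount τ A b s < n) :
    m ≤ n + 1 + ((Finset.Ioc y (y + m * (flagLength K τ + 1))).filter
      (fun s => l s ∈ A s ∧ b ∉ A (s + 1))).card := by
  set L := flagLength K τ with hL
  set Y := y + m * (L + 1) with hY
  have hK := ha.two_le_cast
  have hτ := ha.add_le
  have hmτ : m * (L + 1) ≤ τ := by
    have h1 : (τ : ℝ) / (2 * K) ≤ τ := div_le_self (by positivity) (by linarith)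
    exact_mod_cast hm.trans h1
  have hp : pulls A b y Y ≤ n := by
    have h1 := pulls_le_windowCount (A := A) (τ := τ) b (x := y) (r := Y) (by omega)
    have h2 := hN Y (by omega) le_rfl
    omega
  have hlow : ((Finset.Ioc y Y).filter (fun s => LowAt τ l A (s - 1))).card ≤ 1 := by
    rw [Finset.card_le_one]
    have key : ∀ s ∈ (Finset.Ioc y Y).filter (fun s => LowAt τ l A (s - 1)),
        ∀ t ∈ (Finset.Ioc y Y).filter (fun s => LowAt τ l A (s - 1)), ¬ s < t := by
      intro s hs t ht hst
      obtain ⟨hs1, hs2⟩ := Finset.mem_filter.1 hs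
      obtain ⟨ht1, ht2⟩ := Finset.mem_filter.1 ht
      rw [Finset.mem_Ioc] at hs1 ht1
      have h1 := h.low_separated ha (s := s - 1) (t := t - 1) (by omega) (by omega) hs2 ht2
      have h2 : t - 1 ≤ (s - 1) + m * (L + 1) := by omega
      have h3 : ((t - 1 : ℕ) : ℝ) ≤ ((s - 1 : ℕ) : ℝ) + ((m * (L + 1) : ℕ) : ℝ) := by
        exact_mod_cast h2
      linarith
    intro s hs t ht
    have h1 := key s hs t ht
    have h2 := key t ht s hs
    omega
  set B := (Finset.Ioc y Y).filter (fun s => l s ∈ A s ∧ b ∉ A (s + 1)) with hB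
  set S := ((Finset.Ioc y Y).filter (fun s => b ∈ A s) ∪
    (Finset.Ioc y Y).filter (fun s => LowAt τ l A (s - 1))) ∪ B with hS
  have hScard : S.card ≤ n + 1 + B.card := by
    refine (Finset.card_union_le _ _).trans ?_
    have h1 := Finset.card_union_le ((Finset.Ioc y Y).filter (fun s => b ∈ A s))
      ((Finset.Ioc y Y).filter (fun s => LowAt τ l A (s - 1)))
    have h2 : ((Finset.Ioc y Y).filter (fun s => b ∈ A s)).card ≤ n := hp
    omega
  refine le_trans ?_ hScard
  -- Each of the `m` disjoint stretches contributes an element of `S`. A stretch has `L + 1` rounds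
  -- rather than `L`, so that it also contains the round after the new observation, in which `b` is
  -- known not to be pulled.
  have hchunk : ∀ g ∈ Finset.range m, ∃ s ∈ S, y + g * (L + 1) < s ∧ s ≤ y + (g + 1) * (L + 1) := by
    intro g hg
    have hg' : (g + 1) * (L + 1) ≤ m * (L + 1) :=
      Nat.mul_le_mul_right _ (Finset.mem_range.1 hg)
    have e : (g + 1) * (L + 1) = g * (L + 1) + (L + 1) := by ring
    by_cases hc : ∃ s, y + g * (L + 1) < s ∧ s ≤ y + (g + 1) * (L + 1) ∧ b ∈ A s
    · obtain ⟨s, h1, h2, h3⟩ := hc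
      refine ⟨s, ?_, h1, h2⟩
      refine Finset.mem_union_left _ (Finset.mem_union_left _ (Finset.mem_filter.2 ⟨?_, h3⟩))
      exact Finset.mem_Ioc.2 ⟨by omega, by omega⟩
    · push Not at hc
      obtain ⟨s, h1, h2, h3⟩ := h.exists_new_observation ha (b := b) (q := y + g * (L + 1) + L)
        (by omega) (fun s h1 h2 => hc (s + 1) (by omega) (by omega))
        (hl _ (by omega) (by omega)) (hN _ (by omega) (by omega))
      refine ⟨s + 1, ?_, by omega, by omega⟩
      have hmem : s + 1 ∈ Finset.Ioc y Y := Finset.mem_Ioc.2 ⟨by omega, by omega⟩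
      rcases h3 with h3 | h3
      · exact Finset.mem_union_left _ (Finset.mem_union_right _ (Finset.mem_filter.2 ⟨hmem, h3⟩))
      · exact Finset.mem_union_right _
          (Finset.mem_filter.2 ⟨hmem, h3, hc (s + 1 + 1) (by omega) (by omega)⟩)
  choose! f hfS hf1 hf2 using hchunk
  have hcard := Finset.card_le_card_of_injOn (s := Finset.range m) (t := S) f hfS (by
    intro g hg g' hg' he
    have a1 := hf1 g hg
    have a2 := hf2 g hg
    have a3 := hf1 g' hg'
    have a4 := hf2 g' hg'
    rw [he] at a1 a2
    have b1 : g < g' + 1 := by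
      by_contra hcon
      have := Nat.mul_le_mul_right (L + 1) (not_lt.1 hcon)
      omega
    have b2 : g' < g + 1 := by
      by_contra hcon
      have := Nat.mul_le_mul_right (L + 1) (not_lt.1 hcon)
      omega
    omega)
  simpa using hcard

end IsRun

end Acquisition

/-! ## Rounds and times -/

section Times

variable {K : ℕ} {A : ℕ → Finset (Fin K)}

theorem pullsBefore_succ {r : ℕ} (hr : 1 ≤ r) :
    pullsBefore A (r + 1) = pullsBefore A r + (A r).card := by
  unfold pullsBefore
  rw [Finset.sum_Ico_succ_top hr]

theorem pullsBefore_one : pullsBefore A 1 = 0 := by simp [pullsBefore]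

theorem pullsBefore_mono {r s : ℕ} (h : r ≤ s) : pullsBefore A r ≤ pullsBefore A s :=
  Finset.sum_le_sum_of_subset (Finset.Ico_subset_Ico_right h)

theorem le_pullsBefore (hA : ∀ r, 1 ≤ r → (A r).Nonempty) (r : ℕ) : r ≤ pullsBefore A (r + 1) := by
  induction r with
  | zero => omega
  | succ r ih =>
    rw [pullsBefore_succ (by omega)]
    have := (hA (r + 1) (by omega)).card_pos
    omega

theorem pullsBefore_add_le {r : ℕ} (hr : 1 ≤ r) (m : ℕ) :
    pullsBefore A (r + m) ≤ pullsBefore A r + m * K := by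
  induction m with
  | zero => simp
  | succ m ih =>
    rw [← add_assoc, pullsBefore_succ (by omega), add_mul, one_mul]
    have := Finset.card_le_univ (A (r + m))
    rw [Fintype.card_fin] at this
    omega

theorem pullsBefore_lt_pullTime {r : ℕ} {k : Fin K} (hk : k ∈ A r) :
    pullsBefore A r < pullTime A r k := by
  unfold pullTime
  have : 0 < ((A r).filter (fun j => j ≤ k)).card :=
    Finset.card_pos.2 ⟨k, Finset.mem_filter.2 ⟨hk, le_rfl⟩⟩
  omega

theorem pullTime_le {r : ℕ} (hr : 1 ≤ r) (k : Fin K) :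
    pullTime A r k ≤ pullsBefore A (r + 1) := by
  rw [pullsBefore_succ hr]
  unfold pullTime
  have := Finset.card_filter_le (A r) (fun j => j ≤ k)
  omega

theorem pullTime_lt_of_lt {r s : ℕ} {j k : Fin K} (hr : 1 ≤ r) (hrs : r < s) (hk : k ∈ A s) :
    pullTime A r j < pullTime A s k :=
  ((pullTime_le hr j).trans (pullsBefore_mono hrs)).trans_lt (pullsBefore_lt_pullTime hk)

theorem pullTime_lt_of_arm_lt {r : ℕ} {j k : Fin K} (hjk : j < k) (hk : k ∈ A r) :
    pullTime A r j < pullTime A r k := by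
  unfold pullTime
  refine Nat.add_lt_add_left (Finset.card_lt_card ?_) _
  rw [Finset.ssubset_iff_of_subset
    (Finset.monotone_filter_right _ fun i _ (hij : i ≤ j) => hij.trans hjk.le)]
  exact ⟨k, Finset.mem_filter.2 ⟨hk, le_rfl⟩, fun hm => not_le.2 hjk (Finset.mem_filter.1 hm).2⟩

theorem pullTime_inj {r s : ℕ} {j k : Fin K} (hr : 1 ≤ r) (hs : 1 ≤ s) (hj : j ∈ A r)
    (hk : k ∈ A s) (h : pullTime A r j = pullTime A s k) : r = s ∧ j = k := by
  rcases lt_trichotomy r s with hlt | rfl | hlt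
  · exact absurd h (pullTime_lt_of_lt hr hlt hk).ne
  · refine ⟨rfl, ?_⟩
    rcases lt_trichotomy j k with hlt | heq | hlt
    · exact absurd h (pullTime_lt_of_arm_lt hlt hk).ne
    · exact heq
    · exact absurd h.symm (pullTime_lt_of_arm_lt hlt hj).ne
  · exact absurd h.symm (pullTime_lt_of_lt hs hlt hj).ne

theorem PulledAt.unique {t : ℕ} {j k : Fin K} (hj : PulledAt A t j) (hk : PulledAt A t k) :
    j = k := by
  obtain ⟨r, hr, hjr, h1⟩ := hj
  obtain ⟨s, hs, hks, h2⟩ := hk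
  exact (pullTime_inj hr hs hjr hks (h1.trans h2.symm)).2

open Classical in
/-- Number of pulls of arm `k` up to time `t`. -/
noncomputable def pullCount (A : ℕ → Finset (Fin K)) (k : Fin K) (t : ℕ) : ℕ :=
  ((Finset.Icc 1 t).filter (fun s => PulledAt A s k)).card

theorem pullCount_mono (k : Fin K) {s t : ℕ} (h : s ≤ t) : pullCount A k s ≤ pullCount A k t := by
  classical
  exact Finset.card_le_card (Finset.filter_subset_filter _ (Finset.Icc_subset_Icc_right h))

theorem pullCount_le_add (k : Fin K) (s t : ℕ) :
    pullCount A k t ≤ pullCount A k s + (t - s) := by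
  classical
  unfold pullCount
  have : (Finset.Icc 1 t).filter (fun s => PulledAt A s k) ⊆
      (Finset.Icc 1 s).filter (fun s => PulledAt A s k) ∪ Finset.Ioc s t := by
    intro u hu
    simp only [Finset.mem_filter, Finset.mem_Icc, Finset.mem_union, Finset.mem_Ioc] at hu ⊢
    by_cases hus : u ≤ s
    · exact Or.inl ⟨⟨hu.1.1, hus⟩, hu.2⟩
    · exact Or.inr ⟨by omega, hu.1.2⟩
  refine (Finset.card_le_card this).trans ((Finset.card_union_le _ _).trans ?_)
  simp

theorem pullCount_eq_count (k : Fin K) {r t : ℕ}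
    (h1 : ∀ s, 1 ≤ s → s ≤ r → k ∈ A s → pullTime A s k ≤ t)
    (h2 : ∀ s, r < s → k ∈ A s → t < pullTime A s k) : pullCount A k t = count A k r := by
  classical
  have : (Finset.Icc 1 t).filter (fun s => PulledAt A s k) =
      ((Finset.Icc 1 r).filter (fun s => k ∈ A s)).image (fun s => pullTime A s k) := by
    ext u
    simp only [Finset.mem_filter, Finset.mem_Icc, Finset.mem_image]
    constructor
    · rintro ⟨⟨hu1, hu2⟩, s, hs, hks, rfl⟩
      refine ⟨s, ⟨⟨hs, ?_⟩, hks⟩, rfl⟩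
      by_contra hlt
      exact absurd (h2 s (by omega) hks) (by omega)
    · rintro ⟨s, ⟨⟨hs1, hs2⟩, hks⟩, rfl⟩
      refine ⟨⟨?_, h1 s hs1 hs2 hks⟩, s, hs1, hks, rfl⟩
      have := pullsBefore_lt_pullTime hks
      omega
  unfold pullCount
  rw [this, Finset.card_image_of_injOn]
  · rfl
  · intro s hs s' hs' he
    simp only [Finset.coe_filter, Finset.mem_Icc, Set.mem_ofPred_eq] at hs hs'
    exact (pullTime_inj hs.1.1 hs'.1.1 hs.2 hs'.2 he).1

theorem pullCount_pullTime {k : Fin K} {r : ℕ} (hr : 1 ≤ r) (hk : k ∈ A r) :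
    pullCount A k (pullTime A r k) = count A k r := by
  refine pullCount_eq_count k (fun s hs hsr hks => ?_) fun s hrs hks => pullTime_lt_of_lt hr hrs hks
  rcases hsr.lt_or_eq with hlt | rfl
  · exact (pullTime_lt_of_lt hs hlt hk).le
  · exact le_rfl

theorem pullCount_pullsBefore (k : Fin K) (r : ℕ) :
    pullCount A k (pullsBefore A (r + 1)) = count A k r :=
  pullCount_eq_count k
    (fun _ hs hsr _ => (pullTime_le hs k).trans (pullsBefore_mono (by omega)))
    fun _ hrs hks => (pullsBefore_mono hrs).trans_lt (pullsBefore_lt_pullTime hks)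

theorem pullCount_le_count {k : Fin K} {a r : ℕ} (h : a ≤ pullsBefore A (r + 1)) :
    pullCount A k a ≤ count A k r := by
  rw [← pullCount_pullsBefore]
  exact pullCount_mono k h

theorem count_le_pullCount_add {k : Fin K} {a b r : ℕ} (h : pullsBefore A (r + 1) ≤ b) :
    count A k r ≤ pullCount A k a + (b - a) := by
  rw [← pullCount_pullsBefore]
  exact (pullCount_mono k h).trans (pullCount_le_add k a b)

theorem count_mono (k : Fin K) {r s : ℕ} (h : r ≤ s) : count A k r ≤ count A k s :=
  pulls_mono k le_rfl h

theorem count_lt_of_mem {k : Fin K} {r s : ℕ} (h : r < s) (hk : k ∈ A s) :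
    count A k r < count A k s := by
  obtain ⟨s, rfl⟩ : ∃ u, s = u + 1 := ⟨s - 1, by omega⟩
  have h1 := count_mono (A := A) k (show r ≤ s by omega)
  have h2 : count A k (s + 1) = count A k s + if k ∈ A (s + 1) then 1 else 0 :=
    pulls_succ k (Nat.zero_le s)
  rw [if_pos hk] at h2
  omega

theorem count_eq_add_windowCount (τ : ℕ) (k : Fin K) (r : ℕ) :
    count A k (r - τ) + windowCount τ A k r = count A k r := by
  rw [windowCount_eq_pulls, count_eq_pulls, count_eq_pulls]
  exact pulls_add k (Nat.zero_le _) (Nat.sub_le _ _)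

/-! ## Blocks of consecutive observations of an arm -/

open Classical in
/-- Times in `(a, b]` of the pulls of arm `k` with numbers `i, …, i + n - 1` after time `a`. -/
noncomputable def blockTimes (A : ℕ → Finset (Fin K)) (k : Fin K) (a b i n : ℕ) : Finset ℕ :=
  (Finset.Ioc a b).filter (fun t => PulledAt A t k ∧ pullCount A k a + i ≤ pullCount A k t ∧
    pullCount A k t < pullCount A k a + i + n)

/-- The running count rises by exactly one at each pull, so the last `n` values correspond to `n`
rounds. -/
theorem card_lastBlock (k : Fin K) {r n : ℕ} (hn : n ≤ count A k r) :
    ((Finset.Icc 1 r).filter (fun s => k ∈ A s ∧ count A k r < count A k s + n)).card = n := by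
  induction r generalizing n with
  | zero =>
    have : n = 0 := by simpa [count] using hn
    simp [this]
  | succ r ih =>
    have h2 : count A k (r + 1) = count A k r + if k ∈ A (r + 1) then 1 else 0 :=
      pulls_succ k (Nat.zero_le r)
    rw [← Finset.insert_Icc_right_eq_Icc_add_one (by omega), Finset.filter_insert]
    by_cases hk : k ∈ A (r + 1)
    · rw [if_pos hk] at h2
      rcases n with - | n
      · rw [if_neg (by omega), Finset.card_eq_zero, Finset.filter_eq_empty_iff]
        intro s hs
        have := count_mono (A := A) k (show s ≤ r + 1 by have := (Finset.mem_Icc.1 hs).2; omega)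
        omega
      · rw [if_pos ⟨hk, by omega⟩, Finset.card_insert_of_notMem (by simp)]
        congr 1
        refine Eq.trans (congrArg _ (Finset.filter_congr fun s _ => ?_)) (ih (n := n) (by omega))
        rw [h2]
        constructor <;> rintro ⟨h3, h4⟩ <;> exact ⟨h3, by omega⟩
    · rw [if_neg hk] at h2
      rw [if_neg (fun hc => hk hc.1), h2]
      exact ih (by omega)

/-- The algorithm numbers observations backwards from a random round, whereas probabilities need
blocks numbered forwards from the deterministic time `a`. The offset is the number, after `a`, of
the first pull of the last block. -/
theorem blockTimes_eq_image {k : Fin K} {a b r n : ℕ} (hb : pullsBefore A (r + 1) ≤ b)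
    (hn : pullCount A k a + n ≤ count A k r) :
    blockTimes A k a b (count A k r + 1 - n - pullCount A k a) n =
      ((Finset.Icc 1 r).filter (fun s => k ∈ A s ∧ count A k r < count A k s + n)).image
        (fun s => pullTime A s k) := by
  ext t
  simp only [blockTimes, Finset.mem_filter, Finset.mem_Ioc, Finset.mem_image, Finset.mem_Icc]
  constructor
  · rintro ⟨⟨h1, h2⟩, ⟨s, hs, hks, rfl⟩, h3, h4⟩
    rw [pullCount_pullTime hs hks] at h3 h4
    refine ⟨s, ⟨⟨hs, ?_⟩, hks, by omega⟩, rfl⟩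
    by_contra hlt
    have := count_lt_of_mem (A := A) (k := k) (r := r) (s := s) (by omega) hks
    omega
  · rintro ⟨s, ⟨⟨hs1, hs2⟩, hks, hc⟩, rfl⟩
    have h5 := count_mono (A := A) k hs2
    have h6 := pullCount_pullTime hs1 hks
    refine ⟨⟨?_, ?_⟩, ⟨s, hs1, hks, rfl⟩, by omega, by omega⟩
    · by_contra hle
      have := pullCount_mono (A := A) k (not_lt.1 hle)
      omega
    · exact ((pullTime_le hs1 k).trans (pullsBefore_mono (by omega))).trans hb

/-- The observations of the block are on the side of `ξ` given by the sign of `lam`. -/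
def BadBlock (A : ℕ → Finset (Fin K)) (x : ℕ → Fin K → ℝ) (a b : ℕ) (k : Fin K) (i n : ℕ)
    (lam ξ : ℝ) : Prop :=
  (blockTimes A k a b i n).card = n ∧ 0 ≤ ∑ t ∈ blockTimes A k a b i n, lam * (x t k - ξ)

theorem badBlock_iff {x : ℕ → Fin K → ℝ} {k : Fin K} {a b r n : ℕ} {lam ξ : ℝ} (hn0 : 1 ≤ n)
    (hb : pullsBefore A (r + 1) ≤ b) (hn : pullCount A k a + n ≤ count A k r) :
    BadBlock A x a b k (count A k r + 1 - n - pullCount A k a) n lam ξ ↔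
      0 ≤ lam * (lastBlockMean A x k r n - ξ) := by
  have himg := blockTimes_eq_image (a := a) hb hn
  have hinj : Set.InjOn (fun s => pullTime A s k)
      ((Finset.Icc 1 r).filter (fun s => k ∈ A s ∧ count A k r < count A k s + n) : Set ℕ) := by
    intro s hs s' hs' he
    simp only [Finset.coe_filter, Finset.mem_Icc, Set.mem_ofPred_eq] at hs hs'
    exact (pullTime_inj hs.1.1 hs'.1.1 hs.2.1 hs'.2.1 he).1
  have hcard : (blockTimes A k a b (count A k r + 1 - n - pullCount A k a) n).card = n := by
    rw [himg, Finset.card_image_of_injOn hinj, card_lastBlock k (by omega)]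
  have hsum : ∑ t ∈ blockTimes A k a b (count A k r + 1 - n - pullCount A k a) n,
      lam * (x t k - ξ) = n * (lam * (lastBlockMean A x k r n - ξ)) := by
    have hn' : (n : ℝ) ≠ 0 := by positivity
    rw [← Finset.mul_sum, Finset.sum_sub_distrib, Finset.sum_const, hcard, himg,
      Finset.sum_image hinj, nsmul_eq_mul]
    unfold lastBlockMean
    field_simp
  have hpos : (0 : ℝ) < n := by exact_mod_cast hn0
  unfold BadBlock
  rw [hcard, hsum]
  simp only [true_and]
  exact mul_nonneg_iff_of_pos_left hpos

/-- In times `(a, b]`, all blocks of arm `k` whose starting number is at most `M` and whose length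
is between `n₁` and `n₂` deviate from `ξ` in the direction opposite to `lam`. -/
def GoodBlocks (A : ℕ → Finset (Fin K)) (x : ℕ → Fin K → ℝ) (a b : ℕ) (k : Fin K) (M n₁ n₂ : ℕ)
    (lam ξ : ℝ) : Prop :=
  ∀ i n, 1 ≤ i → i ≤ M → n₁ ≤ n → n ≤ n₂ → ¬ BadBlock A x a b k i n lam ξ

theorem GoodBlocks.mul_neg {x : ℕ → Fin K → ℝ} {k : Fin K} {a b r n M n₁ n₂ : ℕ} {lam ξ : ℝ}
    (h : GoodBlocks A x a b k M n₁ n₂ lam ξ) (hn0 : 1 ≤ n)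
    (hb : pullsBefore A (r + 1) ≤ b) (hn : pullCount A k a + n ≤ count A k r)
    (hM : count A k r ≤ pullCount A k a + M) (h1 : n₁ ≤ n) (h2 : n ≤ n₂) :
    lam * (lastBlockMean A x k r n - ξ) < 0 := by
  have := h (count A k r + 1 - n - pullCount A k a) n (by omega) (by omega) h1 h2
  rw [badBlock_iff hn0 hb hn] at this
  exact not_le.1 this

/-- In times `(a, b]`, all blocks of at least `n` observations are on the right side of the
thresholds `ξ`. -/
def Reliable (A : ℕ → Finset (Fin K)) (x : ℕ → Fin K → ℝ) (a b n : ℕ) (best : Fin K)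
    (lam lam' ξ : Fin K → ℝ) : Prop :=
  ∀ k, k ≠ best → GoodBlocks A x a b k (b - a) n (b - a) (lam k) (ξ k) ∧
    GoodBlocks A x a b best (b - a) n (b - a) (lam' k) (ξ k)

/-- All observations used in the duel were made in `(a, b]`, and the two empirical means lie on
opposite sides of the threshold `ξ` of the challenger or leader opposed to `best`. -/
theorem Reliable.sepAt {x : ℕ → Fin K → ℝ} {l : ℕ → Fin K} {τ a b n r : ℕ} {best : Fin K}
    {lam lam' ξ : Fin K → ℝ} (hlam : ∀ k, k ≠ best → 0 < lam k ∧ lam' k < 0)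
    (h : Reliable A x a b n best lam lam' ξ) (hn : 1 ≤ n)
    (ha : a ≤ pullsBefore A (r - τ + 1)) (hb : pullsBefore A (r + 1) ≤ b) :
    SepAt τ x l A best n r := by
  have hab : a ≤ b := (ha.trans (pullsBefore_mono (by omega))).trans hb
  have key : ∀ (k : Fin K) (m : ℕ), m ≤ windowCount τ A k r →
      pullCount A k a + m ≤ count A k r ∧ count A k r ≤ pullCount A k a + (b - a) := by
    intro k m hm
    refine ⟨?_, count_le_pullCount_add hb⟩
    have h1 := count_eq_add_windowCount (A := A) τ k r
    have h2 := pullCount_le_count (k := k) ha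
    omega
  have sub : ∀ k, k ≠ best → ∀ m, n ≤ m → m ≤ windowCount τ A k r →
      lastBlockMean A x k r m < ξ k := by
    intro k hk m h1 h2
    obtain ⟨h3, h4⟩ := key k m h2
    have h5 := (h k hk).1.mul_neg (r := r) (n := m) (by omega) hb h3 h4 h1 (by omega)
    have := (hlam k hk).1
    nlinarith
  have top : ∀ k, k ≠ best → ∀ m, n ≤ m → m ≤ windowCount τ A best r →
      ξ k < lastBlockMean A x best r m := by
    intro k hk m h1 h2
    obtain ⟨h3, h4⟩ := key best m h2
    have h5 := (h k hk).2.mul_neg (r := r) (n := m) (by omega) hb h3 h4 h1 (by omega)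
    have := (hlam k hk).2
    nlinarith
  constructor
  · intro hl k hk h1 h2 hw
    unfold WinsDuel at hw
    rw [hl] at hw
    have h3 := sub k hk _ h1 le_rfl
    have h4 := top k hk _ (le_min h1 h2) (min_le_right _ _)
    linarith
  · intro hl h1 h2
    unfold WinsDuel
    have h3 := sub (l r) hl _ (le_min h1 h2) (min_le_right _ _)
    have h4 := top (l r) hl _ h1 le_rfl
    linarith

open Classical in
/-- New observations of a leader that prevent the best arm from being pulled belong to bad blocks
of the leader. -/
theorem card_new_observations_le {x : ℕ → Fin K → ℝ} {l : ℕ → Fin K} {τ a b n n₁ M y y' : ℕ}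
    {best : Fin K} {lam lam' ξ : Fin K → ℝ} (hrun : IsRun τ x l A) (hadm : Admissible K τ n)
    (hlam : ∀ k, k ≠ best → 0 < lam k ∧ lam' k < 0) (hτy : τ < y)
    (hn₁ : Real.sqrt (Real.log τ) < n₁) (hn₁' : ∀ m : ℕ, Real.sqrt (Real.log τ) < m → n₁ ≤ m)
    (hgood : ∀ k, k ≠ best → GoodBlocks A x a b best M n₁ n (lam' k) (ξ k))
    (ha : a ≤ pullsBefore A (y - τ + 1)) (hb : pullsBefore A (y' + 1) ≤ b)
    (hM : count A best y' ≤ pullCount A best a + M)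
    (hl : ∀ s, y ≤ s → s ≤ y' → l s ≠ best)
    (hN : ∀ s, y ≤ s → s ≤ y' → windowCount τ A best s < n) :
    ((Finset.Ioc y y').filter (fun s => l s ∈ A s ∧ best ∉ A (s + 1))).card ≤
      ((((Finset.univ.erase best) ×ˢ (Finset.Icc 1 (b - a))) ×ˢ (Finset.Icc n₁ n)).filter
        (fun q => BadBlock A x a b q.1.1 (q.1.2 + 1 - q.2) q.2 (lam q.1.1) (ξ q.1.1))).card := by
  -- A counted round is encoded by its leader, the number of that leader's latest pull, and the
  -- duel's block length. As `best` lost with a block on the right side of `ξ`, the leader's block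
  -- of the same length ending at this pull is bad. The leader is pulled in each counted round, so
  -- the pull number identifies the round.
  refine Finset.card_le_card_of_injOn
    (fun s => ((l s, count A (l s) s - pullCount A (l s) a), windowCount τ A best s)) ?_ ?_
  · intro s hs
    obtain ⟨hs1, hs2, hs3⟩ := Finset.mem_filter.1 hs
    obtain ⟨hy1, hy2⟩ := Finset.mem_Ioc.1 hs1
    have hls := hl s hy1.le hy2
    have hNs := hN s hy1.le hy2
    have has : a ≤ pullsBefore A (s - τ + 1) := ha.trans (pullsBefore_mono (by omega))
    have hbs : pullsBefore A (s + 1) ≤ b := (pullsBefore_mono (by omega)).trans hb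
    have hab : a ≤ b := (has.trans (pullsBefore_mono (by omega))).trans hbs
    have hwin : best ∉ winners τ x l A s := fun hm => hs3 (hrun.mem_of_mem_winners (by omega) hm)
    rw [mem_winners] at hwin
    push Not at hwin
    obtain ⟨hw1, -, hw3⟩ := hwin (Ne.symm hls)
    have hNl : n ≤ windowCount τ A (l s) s := hadm.lt_of_ge (hrun.leader_ge (by omega) (by omega))
    have hn1s := hn₁' _ hw1
    have hone : 1 ≤ n₁ := by
      by_contra hc
      have : n₁ = 0 := by omega
      rw [this] at hn₁
      have := Real.sqrt_nonneg (Real.log τ)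
      simp at hn₁
      linarith
    unfold WinsDuel at hw3
    rw [min_eq_left (by omega), not_le] at hw3
    have hcb := count_eq_add_windowCount (A := A) τ best s
    have hpb := pullCount_le_count (k := best) has
    have hcl := count_eq_add_windowCount (A := A) τ (l s) s
    have hpl := pullCount_le_count (k := l s) has
    have h5 := (hgood (l s) hls).mul_neg (r := s) (n := windowCount τ A best s) (by omega) hbs
      (by omega) ((count_mono best hy2).trans hM) hn1s hNs.le
    have hneg := (hlam (l s) hls).2
    have hpos := (hlam (l s) hls).1
    have h6 : ξ (l s) < lastBlockMean A x best s (windowCount τ A best s) := by nlinarith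
    have h7 := count_le_pullCount_add (k := l s) (a := a) hbs
    have h8 := (badBlock_iff (A := A) (x := x) (k := l s) (a := a) (lam := lam (l s)) (ξ := ξ (l s))
      (n := windowCount τ A best s) (by omega) hbs (by omega)).2
        (mul_nonneg hpos.le (by linarith))
    refine Finset.mem_filter.2 ⟨Finset.mem_product.2 ⟨Finset.mem_product.2
      ⟨by simpa using hls, Finset.mem_Icc.2 ⟨by dsimp only; omega, by dsimp only; omega⟩⟩,
      Finset.mem_Icc.2 ⟨hn1s, hNs.le⟩⟩, ?_⟩
    convert h8 using 1
    simp only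
    omega
  · intro s hs s' hs' he
    obtain ⟨hs1, hs2, -⟩ := Finset.mem_filter.1 hs
    obtain ⟨hs1', hs2', -⟩ := Finset.mem_filter.1 hs'
    simp only [Prod.mk.injEq] at he
    obtain ⟨⟨he1, he2⟩, -⟩ := he
    rw [← he1] at he2 hs2'
    have hge : ∀ u ∈ Finset.Ioc y y', pullCount A (l s) a ≤ count A (l s) u := fun u hu =>
      pullCount_le_count (ha.trans (pullsBefore_mono (by have := (Finset.mem_Ioc.1 hu).1; omega)))
    have g1 := hge s hs1
    have g2 := hge s' hs1'
    rcases lt_trichotomy s s' with hlt | heq | hlt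
    · have := count_lt_of_mem hlt hs2'
      omega
    · exact heq
    · have := count_lt_of_mem hlt hs2
      omega

end Times

/-! ## Locking the best arm -/

section Lock

variable {K : ℕ} {A : ℕ → Finset (Fin K)} {τ n : ℕ} {x : ℕ → Fin K → ℝ} {l : ℕ → Fin K}
  {best : Fin K}

/-- At time `t`, arm `best` is the leader of the last completed round, with many observations. -/
def LockedAt (τ : ℕ) (l : ℕ → Fin K) (A : ℕ → Finset (Fin K)) (best : Fin K) (t : ℕ) : Prop :=
  ∃ r, 1 ≤ r ∧ pullsBefore A (r + 1) ≤ t ∧ t < pullsBefore A (r + 2) ∧ l r = best ∧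
    3 * (τ : ℝ) / (4 * K) ≤ windowCount τ A best r

theorem exists_round (hA : ∀ r, 1 ≤ r → (A r).Nonempty) {t : ℕ} (ht : K ≤ t) :
    ∃ r, 1 ≤ r ∧ pullsBefore A (r + 1) ≤ t ∧ t < pullsBefore A (r + 2) := by
  classical
  have hex : ∃ r, t < pullsBefore A (r + 2) := ⟨t, by
    have : t + 1 ≤ pullsBefore A (t + 2) := le_pullsBefore hA (t + 1)
    omega⟩
  have h1 : pullsBefore A 2 ≤ t := by
    have := pullsBefore_add_le (A := A) (le_refl 1) 1
    rw [pullsBefore_one] at this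
    simp only [Nat.reduceAdd] at this
    omega
  have hpos : 1 ≤ Nat.find hex := by
    by_contra hc
    have h2 := Nat.find_spec hex
    rw [show Nat.find hex = 0 by omega] at h2
    simp only [zero_add] at h2
    omega
  refine ⟨Nat.find hex, hpos, ?_, Nat.find_spec hex⟩
  have := Nat.find_min hex (m := Nat.find hex - 1) (by omega)
  rw [show Nat.find hex - 1 + 2 = Nat.find hex + 1 by omega] at this
  omega

/-- A round lasts at most `K` time steps, so `m * K` steps complete at least `m` rounds; this
explains the factors `K` in all time lengths. -/
theorem mul_lt_of_rounds {r v t u m : ℕ} (hr : pullsBefore A (r + 1) ≤ t)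
    (hv : u < pullsBefore A (v + 2)) (hrv : r ≤ v + 1) (h : t + m * K ≤ u) : r + m ≤ v := by
  have h1 := pullsBefore_add_le (A := A) (r := r + 1) (by omega) (v + 1 - r)
  rw [show r + 1 + (v + 1 - r) = v + 2 by omega] at h1
  have h2 : m * K < (v + 1 - r) * K := by omega
  have := Nat.lt_of_mul_lt_mul_right h2
  omega

theorem round_mono {r v t u : ℕ} (hr : pullsBefore A (r + 1) ≤ t)
    (hv : u < pullsBefore A (v + 2)) (h : t ≤ u) : r ≤ v := by
  by_contra hlt
  have := pullsBefore_mono (A := A) (show v + 2 ≤ r + 1 by omega)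
  omega

theorem le_pullsBefore_sub {r t a d : ℕ} (h : t < pullsBefore A (r + 2)) (hd : a + (d + 1) * K ≤ t) :
    d ≤ r ∧ a ≤ pullsBefore A (r - d + 1) := by
  have h1 := mul_lt_of_rounds (A := A) (r := 0) (v := r) (t := 0) (u := t) (m := d + 1)
    (by rw [zero_add, pullsBefore_one]) h (by omega) (by omega)
  refine ⟨by omega, ?_⟩
  have h2 := pullsBefore_add_le (A := A) (r := r - d + 1) (by omega) (d + 1)
  rw [show r - d + 1 + (d + 1) = r + 2 by omega] at h2
  omega

open Classical in
/-- A locked best arm stays locked as long as the blocks of observations are reliable, and few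
other arms are pulled meanwhile. -/
theorem LockedAt.step {a₀ a b m : ℕ} {lam lam' ξ : Fin K → ℝ} (hrun : IsRun τ x l A)
    (hadm : Admissible K τ n) (hn : 1 ≤ n) (hlam : ∀ k, k ≠ best → 0 < lam k ∧ lam' k < 0)
    (hrel : Reliable A x a₀ b n best lam lam' ξ) (ha : a₀ + 3 * τ * K ≤ a)
    (hb : a + 3 * τ * K ≤ b) (hm : b - a + 1 ≤ m * τ) (hlock : LockedAt τ l A best a) :
    LockedAt τ l A best b ∧
      ((Finset.Ioc a b).filter (fun t => ∃ k, k ≠ best ∧ PulledAt A t k)).card ≤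
        K * (m * (n + 1)) := by
  obtain ⟨r, hr, hra, hra', hl, hN⟩ := hlock
  have hA : ∀ r, 1 ≤ r → (A r).Nonempty := fun r hr => hrun.nonempty hr
  have hK := hadm.two_le
  have hKc := hadm.two_le_cast
  have hτ := hadm.add_le
  have hL := hadm.flagLength_le
  have e1 : 3 * τ * K = (3 * τ) * K := rfl
  have hKτ : K ≤ 3 * τ * K := Nat.le_mul_of_pos_left _ (by omega)
  obtain ⟨v, hv, hvb, hvb'⟩ := exists_round hA (t := b) (by omega)
  have hrv : r ≤ v := round_mono hra hvb' (by omega)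
  have hrv' := mul_lt_of_rounds hra hvb' (by omega) hb
  -- The `3τ - 1` preceding rounds after `a₀` leave room for the flag length, at most `τ`, followed
  -- backwards by one more window on which the duels depend.
  obtain ⟨hr1, hr2⟩ := le_pullsBefore_sub (d := 3 * τ - 1) (a := a₀) hra'
    (by rw [show 3 * τ - 1 + 1 = 3 * τ by omega]; exact ha)
  have hsep : ∀ s, r ≤ s + flagLength K τ → s ≤ v → SepAt τ x l A best n s := fun s h1 h2 =>
    hrel.sepAt hlam hn (hr2.trans (pullsBefore_mono (by omega)))
      ((pullsBefore_mono (by omega)).trans hvb)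
  have hlead := hrun.leader_persists hadm (r := r) (v := v) (by omega)
    (fun s h1 h2 => hsep s (by omega) h2.le) hl hN
  refine ⟨⟨v, hv, hvb, hvb', hlead v hrv le_rfl, ?_⟩, ?_⟩
  · have h1 := (hrun.le_windowCount_of_leader hadm (r := r) (v := v) (by omega) hrv
      (fun s h1 h2 => hsep s (by omega) h2.le) (fun s h1 h2 => hlead s h1 h2.le)).2 (by omega)
    have h2 : (τ : ℝ) ≤ windowCount τ A best v + ((K - 1) * (sqFloor τ + 1) : ℕ) := by
      exact_mod_cast h1
    have h3 := hadm.loss_le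
    have h4 : 3 * (τ : ℝ) / (4 * K) + τ / (4 * K) = τ / K := by field_simp; ring
    have h5 : (τ : ℝ) / K ≤ τ := div_le_self (by positivity) (by linarith)
    linarith
  -- Each round takes at least one time step. The pulls in `(a, b]` belong to rounds `r + 1, …, v +
  -- 1`, the first and last possibly unfinished at the endpoints, whence the `+ 1` in `hm`.
  · have hlen : v + 1 ≤ r + m * τ := by
      rcases Nat.eq_zero_or_pos (v - r) with h0 | h0
      · omega
      have h1 : ∀ d, pullsBefore A (r + 2) + d ≤ pullsBefore A (r + 2 + d) := by
        intro d
        induction d with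
        | zero => simp
        | succ d ih =>
          have h3 : pullsBefore A (r + 2 + (d + 1)) = _ := pullsBefore_succ (r := r + 2 + d) (by omega)
          have := (hA (r + 2 + d) (by omega)).card_pos
          omega
      have h2 := h1 (v - r - 1)
      rw [show r + 2 + (v - r - 1) = v + 1 by omega] at h2
      omega
    have hk : ∀ k, k ≠ best → pulls A k r (v + 1) ≤ m * (n + 1) := fun k hk =>
      pulls_le_mul_of_windowCount_le (τ := τ) (by omega) hlen fun s h1 h2 hkA =>
        hrun.windowCount_le_of_pull' hadm (r := s) (by omega)
          (fun u h3 h4 => hsep u (by omega) (by omega)) (hlead s h1 (by omega)) hk hkA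
    have hsub : (Finset.Ioc a b).filter (fun t => ∃ k, k ≠ best ∧ PulledAt A t k) ⊆
        (Finset.univ.erase best).biUnion (fun k =>
          ((Finset.Ioc r (v + 1)).filter (fun s => k ∈ A s)).image (fun s => pullTime A s k)) := by
      intro t ht
      obtain ⟨h1, k, hkb, s, hs, hks, rfl⟩ := Finset.mem_filter.1 ht
      obtain ⟨h2, h3⟩ := Finset.mem_Ioc.1 h1
      refine Finset.mem_biUnion.2 ⟨k, by simpa using hkb, Finset.mem_image.2 ⟨s, ?_, rfl⟩⟩
      refine Finset.mem_filter.2 ⟨Finset.mem_Ioc.2 ⟨?_, ?_⟩, hks⟩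
      · by_contra hc
        have h4 := pullTime_le (A := A) hs k
        have h5 := pullsBefore_mono (A := A) (show s + 1 ≤ r + 1 by omega)
        omega
      · by_contra hc
        have h4 := pullsBefore_lt_pullTime hks
        have h5 := pullsBefore_mono (A := A) (show v + 2 ≤ s by omega)
        omega
    refine (Finset.card_le_card hsub).trans ((Finset.card_biUnion_le_card_mul _ _ (m * (n + 1))
      fun k hkm => Finset.card_image_le.trans (hk k (by simpa using hkm))).trans ?_)
    refine Nat.mul_le_mul_right _ ((Finset.card_le_univ _).trans ?_)
    simp

open Classical in
/-- The best arm gets locked within a stretch of time where the blocks of observations are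
reliable, short blocks of the best arm do not deviate, and few short blocks of other arms do. -/
theorem lockedAt_of_reliable {a a' b n₁ m : ℕ} {lam lam' ξ : Fin K → ℝ} (hrun : IsRun τ x l A)
    (hadm : Admissible K τ n) (hn : 1 ≤ n) (hlam : ∀ k, k ≠ best → 0 < lam k ∧ lam' k < 0)
    (hrel : Reliable A x a b n best lam lam' ξ) (haK : K ≤ a) (ha : a' = a + 4 * τ * K)
    (hb : b = a' + 6 * τ * K)
    (hn₁ : Real.sqrt (Real.log τ) < n₁) (hn₁' : ∀ m : ℕ, Real.sqrt (Real.log τ) < m → n₁ ≤ m)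
    (hgood : ∀ k, k ≠ best → GoodBlocks A x a' b best (2 * n) n₁ n (lam' k) (ξ k))
    (hm : ((m * (flagLength K τ + 1) : ℕ) : ℝ) ≤ τ / (2 * K))
    (hbad : n + 1 +
      ((((Finset.univ.erase best) ×ˢ (Finset.Icc 1 (b - a'))) ×ˢ (Finset.Icc n₁ n)).filter
        (fun q => BadBlock A x a' b q.1.1 (q.1.2 + 1 - q.2) q.2 (lam q.1.1) (ξ q.1.1))).card < m) :
    LockedAt τ l A best b := by
  have hA : ∀ r, 1 ≤ r → (A r).Nonempty := fun r hr => hrun.nonempty hr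
  have hK := hadm.two_le
  have hKc := hadm.two_le_cast
  have hτ := hadm.add_le
  have hL := hadm.flagLength_le
  obtain ⟨r, hr, hra, hra'⟩ := exists_round hA haK
  obtain ⟨r', hr', hra1, hra1'⟩ := exists_round hA (t := a') (by omega)
  obtain ⟨v, hv, hvb, hvb'⟩ := exists_round hA (t := b) (by omega)
  have h1 := mul_lt_of_rounds hra hra1' (by have := round_mono hra hra1' (by omega); omega) ha.ge
  have h2 := mul_lt_of_rounds hra1 hvb' (by have := round_mono hra1 hvb' (by omega); omega) hb.ge
  have hmτ : m * (flagLength K τ + 1) ≤ τ := by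
    have h1 : (τ : ℝ) / (2 * K) ≤ τ := div_le_self (by positivity) (by linarith)
    exact_mod_cast hm.trans h1
  have hsep : ∀ s, r + 1 + τ ≤ s → s ≤ v → SepAt τ x l A best n s := fun s h1 h2 =>
    hrel.sepAt hlam hn (hra'.le.trans (pullsBefore_mono (by omega)))
      ((pullsBefore_mono (by omega)).trans hvb)
  by_contra hlock
  -- Leading once with `τ/K` observations is enough: the lead persists and the later loss `τ/(4K)`
  -- still leaves `3τ/(4K)`.
  have hno : ∀ s, r + 1 + τ ≤ s → s ≤ v → ¬ LeadsAt τ l A best s := by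
    rintro s hs hsv ⟨hl, hN⟩
    have h4 : 3 * (τ : ℝ) / (4 * K) + τ / (4 * K) = τ / K := by field_simp; ring
    have h5 : (0 : ℝ) ≤ τ / (4 * K) := by positivity
    have hlead := hrun.leader_persists hadm (r := s) (v := v) (by omega)
      (fun u h1 h2 => hsep u (by omega) h2.le) hl (by linarith)
    refine hlock ⟨v, hv, hvb, hvb', hlead v hsv le_rfl, ?_⟩
    have h6 := (hrun.le_windowCount_of_leader hadm (r := s) (v := v) (by omega) hsv
      (fun u h1 h2 => hsep u (by omega) h2.le) (fun u h1 h2 => hlead u h1 h2.le)).1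
    have h7 : (windowCount τ A best s : ℝ) ≤
        windowCount τ A best v + ((K - 1) * (sqFloor τ + 1) : ℕ) := by exact_mod_cast h6
    have h3 := hadm.loss_le
    linarith
  obtain ⟨r₂, hr2, hr2', hl2⟩ := hrun.exists_leader_ne hadm (b := best) (r := r + 1 + τ) (by omega)
    (fun s h1 h2 => hsep s h1 (by omega)) (fun s h1 h2 => hno s h1 (by omega))
  have hne := hrun.leader_ne_of_not_leadsAt (r := r₂) (v := v) (by omega) (by omega) hl2
    (fun s h1 h2 => hno s (by omega) h2)
  have hN : ∀ s, r₂ ≤ s → s + τ + K + 1 ≤ v → windowCount τ A best s < n := fun s h1 h2 =>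
    hrun.windowCount_lt_of_leader_ne hadm (r := s) (v := v) (by omega)
      (fun u h3 h4 => hsep u (by omega) h4) (fun u h3 h4 => hne u (by omega) h4) h2
  -- From round `y` on, windows contain only observations made after `a'`.
  set y := r' + 1 + τ with hy
  have hle := hrun.le_card_new_observations hadm (b := best) (y := y) (m := m) (by omega) hm
    (fun s h1 h2 => hne s (by omega) (by omega)) (fun s h1 h2 => hN s (by omega) (by omega))
  set y' := y + m * (flagLength K τ + 1) with hy'
  -- At most one pull in round `r' + 1`, fewer than `n` in the window ending at `y`, and fewer than
  -- `n` from `y` to `y'`. Restarting the numbering at `a'`, when the best arm is already starved,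
  -- leaves only `2n` possible blocks of each length; its pulls since `a` are not controlled.
  have hM : count A best y' ≤ pullCount A best a' + 2 * n := by
    have h3 : count A best r' ≤ pullCount A best a' := by
      rw [← pullCount_pullsBefore]
      exact pullCount_mono best hra1
    have h4 : pulls A best r' y + count A best r' = count A best y := by
      rw [add_comm]
      exact pulls_add (x := 0) (y := r') (z := y) best (by omega) (by omega)
    have h5 : pulls A best r' (r' + 1) + pulls A best (r' + 1) y = pulls A best r' y :=
      pulls_add best (by omega) (by omega)
    have h6 : count A best y + pulls A best y y' = count A best y' :=
      pulls_add (x := 0) (y := y) (z := y') best (by omega) (by omega)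
    have h7 := pulls_le (A := A) best r' (r' + 1)
    have h8 := pulls_le_windowCount (A := A) (τ := τ) best (x := r' + 1) (r := y) (by omega)
    have h9 := pulls_le_windowCount (A := A) (τ := τ) best (x := y) (r := y') (by omega)
    have h10 := hN y (by omega) (by omega)
    have h11 := hN y' (by omega) (by omega)
    omega
  have hcard := card_new_observations_le (a := a') (b := b) (y := y) (y' := y') hrun hadm hlam
    (by omega) hn₁ hn₁' hgood
    (hra1'.le.trans (pullsBefore_mono (by omega))) ((pullsBefore_mono (by omega)).trans hvb) hM
    (fun s h1 h2 => hne s (by omega) (by omega)) (fun s h1 h2 => hN s (by omega) (by omega))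
  omega

end Lock

/-! ## Deviations of predictably selected observations -/

section Deviation

open Classical in
/-- A Chernoff bound for observations selected in a predictable way. -/
theorem measureReal_selected_le {Ω : Type*} [mΩ : MeasurableSpace Ω] {P : Measure Ω}
    [IsProbabilityMeasure P] {ℱ : Filtration ℕ mΩ} {Y : ℕ → Ω → ℝ} {p : ℕ → Measure ℝ}
    {ω lam ξ : ℝ} {a b n : ℕ} (hY : ∀ t, a < t → t ≤ b → Measurable[ℱ t] (Y t))
    (hlaw : ∀ t, a < t → t ≤ b → P.map (Y t) = p t)
    (hind : ∀ t, a < t → t ≤ b →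
      Indep (MeasurableSpace.comap (Y t) inferInstance) (ℱ (t - 1)) P)
    (hexp : ∀ t, a < t → t ≤ b → ExpBound (p t) ω lam ξ) {H : ℕ → Set Ω}
    (hH : ∀ t, a < t → t ≤ b → MeasurableSet[ℱ (t - 1)] (H t)) {G : Set Ω}
    (hG : MeasurableSet[ℱ a] G) (hab : a ≤ b) :
    P.real (G ∩ {w | ((Finset.Ioc a b).filter (fun t => w ∈ H t)).card = n ∧
      0 ≤ ∑ t ∈ (Finset.Ioc a b).filter (fun t => w ∈ H t), lam * (Y t w - ξ)}) ≤
      Real.exp (-(n * ω)) * P.real G := by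
  set Z : ℕ → Ω → ENNReal := fun t w =>
    if w ∈ H t then ENNReal.ofReal (Real.exp (lam * (Y t w - ξ) + ω)) else 1 with hZ
  -- The exponential supermartingale, restricted to `G`: a selected time multiplies it by a factor
  -- of conditional mean at most `1`, because selection at `u + 1` is known at time `u` and the
  -- reward is independent of `ℱ u`.
  set f : ℕ → Ω → ENNReal := fun u w =>
    G.indicator (fun _ => 1) w * ∏ t ∈ Finset.Ioc a u, Z t w with hf
  have hφ : Measurable (fun y : ℝ => ENNReal.ofReal (Real.exp (lam * (y - ξ) + ω))) := by
    fun_prop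
  have hZm : ∀ t u, a < t → t ≤ b → t ≤ u → Measurable[ℱ u] (Z t) := by
    intro t u h1 h2 h3
    refine Measurable.ite (ℱ.mono (by omega) _ (hH t h1 h2)) ?_ measurable_const
    exact hφ.comp ((hY t h1 h2).mono (ℱ.mono h3) le_rfl)
  have hfm : ∀ u, a ≤ u → u ≤ b → Measurable[ℱ u] (f u) := by
    intro u h1 h2
    refine Measurable.mul (measurable_const.indicator (ℱ.mono h1 _ hG)) ?_
    refine Finset.measurable_prod _ fun t ht => ?_
    obtain ⟨h3, h4⟩ := Finset.mem_Ioc.1 ht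
    exact hZm t u h3 (by omega) h4
  have hint : ∀ u, a ≤ u → u ≤ b → ∫⁻ w, f u w ∂P ≤ P G := by
    intro u h1
    induction u, h1 using Nat.le_induction with
    | base =>
      intro _
      simp only [hf, Finset.Ioc_self, Finset.prod_empty, mul_one]
      rw [lintegral_indicator_const (ℱ.le a _ hG), one_mul]
    | succ u hu ih =>
      intro hub
      have ih := ih (by omega)
      have hHm : MeasurableSet[ℱ u] (H (u + 1)) := by simpa using hH (u + 1) (by omega) hub
      have hsplit : ∀ w, f (u + 1) w = (H (u + 1))ᶜ.indicator (f u) w +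
          ENNReal.ofReal (Real.exp (lam * (Y (u + 1) w - ξ) + ω)) *
            (H (u + 1)).indicator (f u) w := by
        intro w
        simp only [hf]
        rw [← Finset.insert_Ioc_right_eq_Ioc_add_one hu, Finset.prod_insert (by simp)]
        by_cases hw : w ∈ H (u + 1)
        · simp only [Set.indicator, hw, hZ, Set.mem_compl_iff, not_true_eq_false, if_true,
            if_false, zero_add]
          ring
        · simp only [Set.indicator, hw, hZ, Set.mem_compl_iff, not_false_eq_true, if_true,
            if_false, mul_zero, add_zero, one_mul]
      have hfu := hfm u hu (by omega)
      have hmeas : Measurable ((H (u + 1))ᶜ.indicator (f u)) :=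
        (hfu.indicator hHm.compl).mono (ℱ.le u) le_rfl
      rw [lintegral_congr hsplit, lintegral_add_left hmeas]
      have hYm : Measurable (Y (u + 1)) := (hY (u + 1) (by omega) hub).mono (ℱ.le _) le_rfl
      have hprod : ∫⁻ w, ENNReal.ofReal (Real.exp (lam * (Y (u + 1) w - ξ) + ω)) *
          (H (u + 1)).indicator (f u) w ∂P =
          (∫⁻ w, ENNReal.ofReal (Real.exp (lam * (Y (u + 1) w - ξ) + ω)) ∂P) *
            ∫⁻ w, (H (u + 1)).indicator (f u) w ∂P :=
        lintegral_mul_eq_lintegral_mul_lintegral_of_independent_measurableSpace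
        (Mf := MeasurableSpace.comap (Y (u + 1)) inferInstance) (Mg := ℱ u) (hYm.comap_le) (ℱ.le u)
        (by simpa using hind (u + 1) (by omega) hub) (hφ.comp (comap_measurable _))
        (hfu.indicator hHm)
      rw [hprod]
      have h1 : ∫⁻ w, ENNReal.ofReal (Real.exp (lam * (Y (u + 1) w - ξ) + ω)) ∂P ≤ 1 := by
        have h2 : ∫⁻ w, ENNReal.ofReal (Real.exp (lam * (Y (u + 1) w - ξ) + ω)) ∂P =
            ∫⁻ y, ENNReal.ofReal (Real.exp (lam * (y - ξ) + ω)) ∂(p (u + 1)) := by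
          rw [← hlaw (u + 1) (by omega) hub, lintegral_map hφ hYm]
        rw [h2]
        have h3 : ∀ y : ℝ, ENNReal.ofReal (Real.exp (lam * (y - ξ) + ω)) =
            ENNReal.ofReal (Real.exp ω) * ENNReal.ofReal (Real.exp (lam * (y - ξ))) := by
          intro y
          rw [← ENNReal.ofReal_mul (Real.exp_pos _).le, ← Real.exp_add, add_comm]
        rw [lintegral_congr h3, lintegral_const_mul _ (by fun_prop)]
        refine (mul_le_mul_right (hexp (u + 1) (by omega) hub) _).trans ?_
        rw [← ENNReal.ofReal_mul (Real.exp_pos _).le, ← Real.exp_add]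
        simp
      calc ∫⁻ w, (H (u + 1))ᶜ.indicator (f u) w ∂P + (∫⁻ w, ENNReal.ofReal
            (Real.exp (lam * (Y (u + 1) w - ξ) + ω)) ∂P) * ∫⁻ w, (H (u + 1)).indicator (f u) w ∂P
          ≤ ∫⁻ w, (H (u + 1))ᶜ.indicator (f u) w ∂P + 1 * ∫⁻ w, (H (u + 1)).indicator (f u) w ∂P := by
            gcongr
        _ = ∫⁻ w, f u w ∂P := by
            rw [one_mul, ← lintegral_add_left hmeas]
            refine lintegral_congr fun w => ?_
            by_cases hw : w ∈ H (u + 1) <;> simp [hw]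
        _ ≤ P G := ih
  have hsub : (G ∩ {w | ((Finset.Ioc a b).filter (fun t => w ∈ H t)).card = n ∧
      0 ≤ ∑ t ∈ (Finset.Ioc a b).filter (fun t => w ∈ H t), lam * (Y t w - ξ)}) ⊆
      {w | ENNReal.ofReal (Real.exp (n * ω)) ≤ f b w} := by
    rintro w ⟨hwG, hcard, hsum⟩
    have h1 : f b w = ENNReal.ofReal (Real.exp
        (∑ t ∈ (Finset.Ioc a b).filter (fun t => w ∈ H t), lam * (Y t w - ξ) + n * ω)) := by
      simp only [hf, hZ, Set.indicator_of_mem hwG, one_mul]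
      rw [← Finset.prod_filter, ← ENNReal.ofReal_prod_of_nonneg (fun _ _ => (Real.exp_pos _).le),
        ← Real.exp_sum, Finset.sum_add_distrib, Finset.sum_const, hcard, nsmul_eq_mul]
    change _ ≤ f b w
    rw [h1]
    exact ENNReal.ofReal_le_ofReal (Real.exp_le_exp.2 (by linarith))
  have hmark := meas_ge_le_lintegral_div (μ := P) (f := f b)
    ((hfm b hab le_rfl).mono (ℱ.le b) le_rfl).aemeasurable
    (ε := ENNReal.ofReal (Real.exp (n * ω))) (by simp [Real.exp_pos]) (by simp)
  have h5 := (measure_mono hsub).trans (hmark.trans (ENNReal.div_le_div_right (hint b hab le_rfl) _))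
  have h6 := ENNReal.toReal_mono (by
    refine (ENNReal.div_lt_top (measure_ne_top P G) ?_).ne
    simp [Real.exp_pos]) h5
  rw [ENNReal.toReal_div, ENNReal.toReal_ofReal (Real.exp_pos _).le] at h6
  refine h6.trans (le_of_eq ?_)
  rw [Real.exp_neg, div_eq_inv_mul]
  rfl

/-- Markov's inequality for the number of events that occur. -/
theorem mul_measureReal_card_le {Ω ι : Type*} [MeasurableSpace Ω] {P : Measure Ω}
    [IsProbabilityMeasure P] (Q : Finset ι) (B : ι → Set Ω) (c : ℝ) (S : Set Ω)
    (hS : ∀ w ∈ S, c ≤ ∑ q ∈ Q, (B q).indicator (fun _ => (1 : ℝ)) w) :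
    c * P.real S ≤ ∑ q ∈ Q, P.real (B q) := by
  rcases le_or_gt c 0 with hc | hc
  · exact (mul_nonpos_of_nonpos_of_nonneg hc measureReal_nonneg).trans
      (Finset.sum_nonneg fun _ _ => measureReal_nonneg)
  set g : Ω → ℝ := fun w => ∑ q ∈ Q, (toMeasurable P (B q)).indicator (fun _ => (1 : ℝ)) w with hg
  have hgi : Integrable g P := integrable_finsetSum _ fun q _ =>
    (integrable_const (1 : ℝ)).indicator (measurableSet_toMeasurable _ _)
  have h1 := mul_meas_ge_le_integral_of_nonneg (μ := P) (f := g)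
    (Filter.Eventually.of_forall fun w =>
      Finset.sum_nonneg fun q _ => Set.indicator_nonneg (fun _ _ => zero_le_one) w) hgi c
  have h2 : ∫ w, g w ∂P = ∑ q ∈ Q, P.real (B q) := by
    rw [hg, integral_finsetSum _ fun q _ =>
      (integrable_const (1 : ℝ)).indicator (measurableSet_toMeasurable _ _)]
    refine Finset.sum_congr rfl fun q _ => ?_
    rw [integral_indicator_const _ (measurableSet_toMeasurable _ _), smul_eq_mul, mul_one]
    simp [Measure.real, measure_toMeasurable]
  rw [h2] at h1
  refine le_trans (mul_le_mul_of_nonneg_left (measureReal_mono fun w hw => ?_) hc.le) h1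
  refine (hS w hw).trans (Finset.sum_le_sum fun q _ => ?_)
  exact Set.indicator_le_indicator_of_subset (subset_toMeasurable P (B q))
    (fun _ => zero_le_one) w

end Deviation

/-! ## The information available at a given time -/

section History

variable {K : ℕ} {Ω : Type*} {l : Ω → ℕ → Fin K} {A : Ω → ℕ → Finset (Fin K)}

/-- The rounds completed by time `t` went the same way in `w` and `w'`. -/
def Agree (l : Ω → ℕ → Fin K) (A : Ω → ℕ → Finset (Fin K)) (t : ℕ) (w w' : Ω) : Prop :=
  ∀ r, 1 ≤ r → (pullsBefore (A w) (r + 1) ≤ t ↔ pullsBefore (A w') (r + 1) ≤ t) ∧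
    (pullsBefore (A w) (r + 1) ≤ t → l w r = l w' r ∧ A w (r + 1) = A w' (r + 1))

theorem Agree.symm {t : ℕ} {w w' : Ω} (hag : Agree l A t w w') : Agree l A t w' w := fun r hr =>
  ⟨(hag r hr).1.symm, fun h1 =>
    ⟨((hag r hr).2 ((hag r hr).1.2 h1)).1.symm, ((hag r hr).2 ((hag r hr).1.2 h1)).2.symm⟩⟩

variable [mΩ : MeasurableSpace Ω] {P : Measure Ω} {ℱ : Filtration ℕ mΩ}
  {X : ℕ → Fin K → Ω → ℝ} {τ : ℕ}

namespace IsPolicyRun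

variable (h : IsPolicyRun P ℱ X τ l A)
include h

/-- At most `t` rounds are completed by time `t`, so their course is a finite-valued variable,
measurable by `nonanticipating`; an invariant set is a union of its fibres. -/
theorem measurableSet_of_agree {t : ℕ} {S : Set Ω}
    (hS : ∀ w w', Agree l A t w w' → w ∈ S → w' ∈ S) : MeasurableSet[ℱ t] S := by
  classical
  set f : Ω → Fin t → Option (Fin K × Finset (Fin K)) := fun w i =>
    if pullsBefore (A w) (i + 2) ≤ t then some (l w (i + 1), A w (i + 2)) else none with hf
  have hsome : ∀ i p, MeasurableSet[ℱ t] {w | f w i = some p} := by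
    intro i p
    have : {w | f w i = some p} = ⋃ u ∈ Finset.range (t + 1),
        {w | pullsBefore (A w) (i + 1 + 1) = u ∧ l w (i + 1) = p.1 ∧ A w (i + 1 + 1) = p.2} := by
      ext w
      obtain ⟨j, S'⟩ := p
      simp only [hf, Set.mem_ofPred_eq, Set.mem_iUnion, Finset.mem_range, exists_prop]
      constructor
      · intro hw
        split_ifs at hw with hc
        simp only [Option.some.injEq, Prod.mk.injEq] at hw
        exact ⟨_, Nat.lt_succ_of_le hc, rfl, hw⟩
      · rintro ⟨u, hu, rfl, h1, h2⟩
        rw [if_pos (Nat.le_of_lt_succ hu), h1, ← h2]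
    rw [this]
    refine Finset.measurableSet_biUnion _ fun u hu => ?_
    exact ℱ.mono (Nat.le_of_lt_succ (Finset.mem_range.1 hu)) _
      (h.nonanticipating (i + 1) u (by omega) p.1 p.2)
  have hall : ∀ i o, MeasurableSet[ℱ t] {w | f w i = o} := by
    intro i o
    rcases o with - | p
    · have : {w | f w i = none} = (⋃ p, {w | f w i = some p})ᶜ := by
        ext w
        simp only [Set.mem_ofPred_eq, Set.mem_compl_iff, Set.mem_iUnion, not_exists]
        exact ⟨fun h1 p h2 => by simp [h1] at h2, fun h1 => Option.eq_none_iff_forall_ne_some.2 h1⟩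
      rw [this]
      exact (MeasurableSet.iUnion fun p => hsome i p).compl
    · exact hsome i p
  have hS' : S = ⋃ c ∈ f '' S, ⋂ i, {w | f w i = c i} := by
    ext w
    simp only [Set.mem_iUnion, Set.mem_iInter, Set.mem_ofPred_eq, exists_prop]
    constructor
    · exact fun hw => ⟨f w, ⟨w, hw, rfl⟩, fun _ => rfl⟩
    · rintro ⟨_, ⟨w', hw', rfl⟩, hc⟩
      refine hS w' w ?_ hw'
      intro r hr
      by_cases hrt : r ≤ t
      · have h1 := hc ⟨r - 1, by omega⟩
        simp only [hf] at h1
        rw [show r - 1 + 2 = r + 1 by omega, show r - 1 + 1 = r by omega] at h1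
        split_ifs at h1 with h2 h3 h3
        · simp only [Option.some.injEq, Prod.mk.injEq] at h1
          exact ⟨⟨fun _ => h2, fun _ => h3⟩, fun _ => ⟨h1.1.symm, h1.2.symm⟩⟩
        · exact ⟨⟨fun hh => absurd hh h3, fun hh => absurd hh h2⟩, fun hh => absurd hh h3⟩
      · have h2 := le_pullsBefore (A := A w) (fun r hr => (h.isRun w).nonempty hr) r
        have h3 := le_pullsBefore (A := A w') (fun r hr => (h.isRun w').nonempty hr) r
        exact ⟨⟨fun _ => by omega, fun _ => by omega⟩, fun _ => by omega⟩
  rw [hS']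
  exact MeasurableSet.biUnion (Set.toFinite _).countable fun c _ =>
    MeasurableSet.iInter fun i => hall i (c i)

end IsPolicyRun

namespace Agree

variable {t : ℕ} {w w' : Ω}

variable (h : IsPolicyRun P ℱ X τ l A) (hag : Agree l A t w w')
include h hag

theorem arms_eq {s u : ℕ} (hs : pullsBefore (A w) s ≤ t) (hu : 1 ≤ u) (hus : u ≤ s) :
    A w u = A w' u := by
  obtain ⟨u, rfl⟩ : ∃ v, u = v + 1 := ⟨u - 1, by omega⟩
  rcases Nat.eq_zero_or_pos u with rfl | hpos
  · rw [(h.isRun w).first_round, (h.isRun w').first_round]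
  · exact ((hag u hpos).2 ((pullsBefore_mono hus).trans hs)).2

theorem pullsBefore_eq {s : ℕ} (hs : pullsBefore (A w) s ≤ t) :
    pullsBefore (A w) (s + 1) = pullsBefore (A w') (s + 1) ∧
      pullsBefore (A w) s = pullsBefore (A w') s := by
  unfold pullsBefore
  constructor
  · refine Finset.sum_congr rfl fun u hu => ?_
    obtain ⟨h1, h2⟩ := Finset.mem_Ico.1 hu
    rw [hag.arms_eq h hs h1 (by omega)]
  · refine Finset.sum_congr rfl fun u hu => ?_
    obtain ⟨h1, h2⟩ := Finset.mem_Ico.1 hu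
    rw [hag.arms_eq h hs h1 (by omega)]

theorem mono {u : ℕ} (hut : u ≤ t) : Agree l A u w w' := by
  intro r hr
  refine ⟨⟨fun h1 => ?_, fun h1 => ?_⟩, fun h1 => (hag r hr).2 (h1.trans hut)⟩
  · rwa [← (hag.pullsBefore_eq h (h1.trans hut)).2]
  · rwa [← (hag.symm.pullsBefore_eq h (h1.trans hut)).2]

/-- The bound is `t + 1` because the set pulled in a round is fixed when the preceding round ends;
this is the predictability of the arm pulled at the next time. -/
theorem pulledAt {u : ℕ} {k : Fin K} (hu : u ≤ t + 1) (hk : PulledAt (A w) u k) :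
    PulledAt (A w') u k := by
  obtain ⟨r, hr, hkr, rfl⟩ := hk
  have h1 := pullsBefore_lt_pullTime hkr
  have h2 := hag.arms_eq h (s := r) (u := r) (by omega) hr le_rfl
  refine ⟨r, hr, h2 ▸ hkr, ?_⟩
  unfold pullTime
  rw [(hag.pullsBefore_eq h (s := r) (by omega)).2, h2]

theorem pulledAt_iff {u : ℕ} {k : Fin K} (hu : u ≤ t + 1) :
    PulledAt (A w) u k ↔ PulledAt (A w') u k :=
  ⟨hag.pulledAt h hu, hag.symm.pulledAt h hu⟩

theorem pullCount_eq {u : ℕ} (k : Fin K) (hu : u ≤ t + 1) :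
    pullCount (A w) k u = pullCount (A w') k u := by
  classical
  unfold pullCount
  congr 1
  refine Finset.filter_congr fun s hs => hag.pulledAt_iff h ?_
  exact (Finset.mem_Icc.1 hs).2.trans hu

theorem lockedAt {b : Fin K} (hL : LockedAt τ (l w) (A w) b t) :
    LockedAt τ (l w') (A w') b t := by
  obtain ⟨r, hr, h1, h2, h3, h4⟩ := hL
  refine ⟨r, hr, ((hag r hr).1).1 h1, ?_, ?_, ?_⟩
  · rwa [← (hag.pullsBefore_eq h h1).1]
  · rw [← ((hag r hr).2 h1).1, h3]
  · convert h4 using 2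
    unfold windowCount
    congr 1
    refine Finset.filter_congr fun s hs => ?_
    obtain ⟨h5, h6⟩ := Finset.mem_Icc.1 hs
    rw [hag.arms_eq h h1 h5 (by omega)]

end Agree

theorem IsPolicyRun.measurableSet_lockedAt (h : IsPolicyRun P ℱ X τ l A) (b : Fin K) (t : ℕ) :
    MeasurableSet[ℱ t] {w | LockedAt τ (l w) (A w) b t} :=
  h.measurableSet_of_agree fun _ _ hag hw => hag.lockedAt h hw

theorem IsPolicyRun.measurableSet_mem_blockTimes (h : IsPolicyRun P ℱ X τ l A) (k : Fin K)
    {a b i n t : ℕ} (hat : a < t) :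
    MeasurableSet[ℱ (t - 1)] {w | t ∈ blockTimes (A w) k a b i n} := by
  refine h.measurableSet_of_agree fun w w' hag hw => ?_
  simp only [blockTimes, Set.mem_ofPred_eq, Finset.mem_filter] at hw ⊢
  rwa [← hag.pulledAt_iff h (by omega), ← hag.pullCount_eq h k (by omega),
    ← hag.pullCount_eq h k (by omega)]

end History

/-! ## Choice of the parameters -/

section Parameters

/-- Thresholds on numbers of observations for which the analysis goes through: `n` observations are
reliable, `n₁` is the least number of observations beyond forced exploration, and the best arm is
locked by examining `m` stretches of time of the length monitored by the diversity flags. -/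
structure GoodParameters (K τ : ℕ) (ω : ℝ) (n n₁ m : ℕ) : Prop where
  admissible : Admissible K τ n
  one_le : 1 ≤ n
  lt_n₁ : Real.sqrt (Real.log τ) < n₁
  n₁_le : ∀ j : ℕ, Real.sqrt (Real.log τ) < j → n₁ ≤ j
  mul_le : ((m * (flagLength K τ + 1) : ℕ) : ℝ) ≤ τ / (2 * K)
  lt_m : n + 1 < m
  reliable : 2 * K * (20 * (τ : ℝ) * K) ^ 2 * Real.exp (-(n * ω)) ≤ 1 / τ
  locking : 2 * K * (10 * (τ : ℝ) * K) ^ 2 * Real.exp (-(n * ω)) +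
    2 * K * (n : ℝ) ^ 2 * Real.exp (-(n₁ * ω)) +
    K * (6 * (τ : ℝ) * K) * n * Real.exp (-(n₁ * ω)) / ((m : ℝ) - (n + 1)) ≤ 1 / 2

/-- With `z = ω √(log τ)` the left side is `z⁶ exp (-z) / ω⁶`. This is where forced exploration of
order `√(log τ)` proves sufficient. -/
theorem eventually_log_pow_mul_exp_le {ω ε : ℝ} (hω : 0 < ω) (hε : 0 < ε) :
    ∀ᶠ τ : ℕ in Filter.atTop,
      Real.log τ ^ 3 * Real.exp (-(Real.sqrt (Real.log τ) * ω)) ≤ ε := by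
  have h1 := Real.tendsto_pow_mul_exp_neg_atTop_nhds_zero 6
  have h2 : Filter.Tendsto (fun τ : ℕ => Real.sqrt (Real.log τ) * ω) Filter.atTop Filter.atTop :=
    (Real.tendsto_sqrt_atTop.comp
      (Real.tendsto_log_atTop.comp tendsto_natCast_atTop_atTop)).atTop_mul_const hω
  have h3 := (h1.comp h2).eventually_le_const (show 0 < ε * ω ^ 6 by positivity)
  filter_upwards [h3, Filter.eventually_ge_atTop 1] with τ h4 hτ
  simp only [Function.comp] at h4
  have hl : 0 ≤ Real.log τ := Real.log_nonneg (by exact_mod_cast hτ)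
  have h5 : Real.sqrt (Real.log τ) ^ 6 = Real.log τ ^ 3 := by
    rw [show 6 = 2 * 3 by norm_num, pow_mul, Real.sq_sqrt hl]
  rw [mul_pow, h5] at h4
  have h6 : 0 < ω ^ 6 := by positivity
  nlinarith

theorem eventually_log_pow_le (C : ℝ) :
    ∀ᶠ τ : ℕ in Filter.atTop, C * Real.log τ ^ 3 ≤ τ := by
  have h1 := (Real.isLittleO_pow_log_id_atTop (n := 3)).comp_tendsto
    (tendsto_natCast_atTop_atTop (R := ℝ))
  have h2 := h1.def (show 0 < (|C| + 1)⁻¹ by positivity)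
  filter_upwards [h2, Filter.eventually_ge_atTop 1] with τ h3 hτ
  simp only [Function.comp, id, Real.norm_eq_abs] at h3
  have hl : 0 ≤ Real.log τ := Real.log_nonneg (by exact_mod_cast hτ)
  rw [abs_of_nonneg (pow_nonneg hl 3), abs_of_nonneg (Nat.cast_nonneg τ : (0 : ℝ) ≤ τ), inv_mul_eq_div,
    le_div_iff₀ (by positivity)] at h3
  have : C ≤ |C| := le_abs_self C
  nlinarith [pow_nonneg hl 3]

set_option maxHeartbeats 1000000 in
theorem exists_goodParameters (K : ℕ) (hK : 2 ≤ K) {ω : ℝ} (hω : 0 < ω) :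
    ∃ τ₀ : ℕ, ∃ c : ℝ, 0 ≤ c ∧ ∀ τ : ℕ, τ₀ ≤ τ → 1 ≤ Real.log τ ∧
      ∃ n n₁ m : ℕ, GoodParameters K τ ω n n₁ m ∧ (n : ℝ) ≤ c * Real.log τ := by
  have hKc : (2 : ℝ) ≤ K := by exact_mod_cast hK
  -- Chosen so that `exp (-n ω) ≤ τ⁻⁵`: the union over order `τ²` blocks still leaves much less than
  -- `1/τ`.
  set c : ℝ := 5 / ω + 1 with hc
  have hc1 : 1 ≤ c := by rw [hc]; have : 0 < 5 / ω := by positivity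
                         linarith
  have hcω : 5 ≤ c * ω := by
    rw [hc, add_mul, div_mul_cancel₀ _ hω.ne']
    linarith
  have e1 : ∀ᶠ τ : ℕ in Filter.atTop, c + 1 + 2 * K ≤ Real.log τ :=
    (Real.tendsto_log_atTop.comp tendsto_natCast_atTop_atTop).eventually_ge_atTop _
  have e2 := eventually_log_pow_le (8 * K ^ 2 * (c + 3))
  have e3 := eventually_log_pow_mul_exp_le (ε := 1 / (144 * K ^ 4 * (c + 1) ^ 2)) hω (by positivity)
  have e4 : ∀ᶠ τ : ℕ in Filter.atTop, 800 * (K : ℝ) ^ 3 ≤ τ :=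
    tendsto_natCast_atTop_atTop.eventually_ge_atTop _
  obtain ⟨τ₀, hτ₀⟩ := Filter.eventually_atTop.1 (e1.and (e2.and (e3.and e4)))
  refine ⟨τ₀, c + 1, by linarith, fun τ hτ => ?_⟩
  obtain ⟨h1, h2, h3, h4⟩ := hτ₀ τ hτ
  set Λ := Real.log τ with hΛ
  have hΛ4 : 6 ≤ Λ := by linarith
  have hτ0 : (0 : ℝ) < τ := lt_of_lt_of_le (by positivity) h4
  have hexpΛ : Real.exp Λ = τ := Real.exp_log hτ0
  have hτ6 : (6 : ℝ) ≤ τ := by nlinarith [pow_le_pow_left₀ (by norm_num) hKc 3]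
  have hΛ2 : 36 ≤ Λ ^ 2 := by nlinarith
  have hΛ23 : Λ ^ 2 ≤ Λ ^ 3 := pow_le_pow_right₀ (by linarith) (by norm_num)
  set L := flagLength K τ with hL
  have hLle : (L : ℝ) + 1 ≤ K * Λ ^ 2 := by
    have : (L : ℝ) < ((K : ℝ) - 1) * Λ ^ 2 + 1 := Nat.ceil_lt_add_one (by
      have : (0 : ℝ) ≤ (K : ℝ) - 1 := by linarith
      positivity)
    nlinarith
  set n := ⌈c * Λ⌉₊ with hn
  have hn1 : c * Λ ≤ n := Nat.le_ceil _
  have hn2 : (n : ℝ) ≤ (c + 1) * Λ := by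
    have : (n : ℝ) < c * Λ + 1 := Nat.ceil_lt_add_one (by positivity)
    linarith
  set n₁ := ⌊Real.sqrt Λ⌋₊ + 1 with hn₁
  have hn₁' : Real.sqrt Λ < n₁ := by
    rw [hn₁]; push_cast; exact Nat.lt_floor_add_one _
  -- The largest number of stretches fitting in `τ/(2K)` rounds, a duration with at most one
  -- shortage of the leader.
  set m := ⌊(τ : ℝ) / (2 * K * (L + 1))⌋₊ with hm
  have hm1 : (m : ℝ) ≤ (τ : ℝ) / (2 * K * (L + 1)) := Nat.floor_le (by positivity)
  have hm2 : (τ : ℝ) / (2 * K * (L + 1)) < m + 1 := Nat.lt_floor_add_one _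
  have hbig : 4 * K * ((L : ℝ) + 1) * (n + 2) ≤ τ := by
    calc 4 * K * ((L : ℝ) + 1) * (n + 2) ≤ 4 * K * (K * Λ ^ 2) * ((c + 1) * Λ + 2 * Λ) := by
          gcongr
          linarith
      _ = 4 * K ^ 2 * (c + 3) * Λ ^ 3 := by ring
      _ ≤ 8 * K ^ 2 * (c + 3) * Λ ^ 3 := by gcongr; norm_num
      _ ≤ τ := h2
  have hm3 : (τ : ℝ) / (4 * K * (L + 1)) ≤ (m : ℝ) - (n + 1) := by
    have h5 : (τ : ℝ) / (2 * K * (L + 1)) = τ / (4 * K * (L + 1)) + τ / (4 * K * (L + 1)) := by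
      field_simp; ring
    have h6 : (n : ℝ) + 2 ≤ τ / (4 * K * (L + 1)) := by
      rw [le_div_iff₀ (by positivity)]
      linarith
    linarith
  have hq : (0 : ℝ) < τ / (4 * K * (L + 1)) := by positivity
  have hδn : Real.exp (-(n * ω)) ≤ 1 / (τ : ℝ) ^ 5 := by
    have h5 : Real.exp (-(n * ω)) ≤ Real.exp (-(5 * Λ)) := by
      refine Real.exp_le_exp.2 (neg_le_neg ?_)
      nlinarith
    refine h5.trans (le_of_eq ?_)
    rw [Real.exp_neg, one_div, ← hexpΛ, ← Real.exp_nat_mul]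
    norm_num
  have hδ : Real.exp (-(n₁ * ω)) ≤ Real.exp (-(Real.sqrt Λ * ω)) := by
    refine Real.exp_le_exp.2 (neg_le_neg ?_)
    gcongr
  set δ := Real.exp (-(Real.sqrt Λ * ω)) with hδdef
  have hδ0 : 0 < δ := Real.exp_pos _
  have hrel : 2 * K * (20 * (τ : ℝ) * K) ^ 2 * Real.exp (-(n * ω)) ≤ 1 / τ := by
    calc 2 * K * (20 * (τ : ℝ) * K) ^ 2 * Real.exp (-(n * ω))
        ≤ 2 * K * (20 * (τ : ℝ) * K) ^ 2 * (1 / (τ : ℝ) ^ 5) := by gcongr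
      _ = (800 * K ^ 3) / τ / (τ : ℝ) ^ 2 := by field_simp; ring
      _ ≤ 1 / (τ : ℝ) ^ 2 := by
          gcongr
          exact (div_le_one hτ0).2 h4
      _ ≤ 1 / τ := by
          refine one_div_le_one_div_of_le hτ0 ?_
          nlinarith
  refine ⟨by linarith, n, n₁, m, ⟨⟨hK, ?_, ?_, ?_, ?_⟩, ?_, hn₁', ?_, ?_, ?_, hrel, ?_⟩, hn2⟩
  · have h5 : Λ ≤ c * Λ := le_mul_of_one_le_left (by linarith) hc1
    refine le_trans ?_ (h5.trans hn1)
    exact Real.sqrt_le_iff.2 ⟨by linarith, le_self_pow₀ (by linarith) (by norm_num)⟩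
  · refine hn2.trans ?_
    rw [sq]
    gcongr
    linarith
  · have : Λ ≤ Λ ^ 2 := le_self_pow₀ (by linarith) (by norm_num)
    linarith
  · refine le_trans ?_ h2
    have h5 : Λ ^ 2 + 4 ≤ 2 * Λ ^ 3 := by linarith
    calc 4 * (K : ℝ) ^ 2 * (Λ ^ 2 + 4) ≤ 4 * (K : ℝ) ^ 2 * (2 * Λ ^ 3) := by gcongr
      _ = 8 * K ^ 2 * 1 * Λ ^ 3 := by ring
      _ ≤ 8 * K ^ 2 * (c + 3) * Λ ^ 3 := by gcongr; linarith
  · exact Nat.ceil_pos.2 (by positivity)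
  · intro j hj
    exact (Nat.floor_lt (Real.sqrt_nonneg _)).2 hj
  · push_cast
    calc (m : ℝ) * (L + 1) ≤ τ / (2 * K * (L + 1)) * (L + 1) := by gcongr
      _ = τ / (2 * K) := by field_simp
  · have : (n : ℝ) + 1 < m := by linarith
    exact_mod_cast this
  · have a1 : 2 * K * (10 * (τ : ℝ) * K) ^ 2 * Real.exp (-(n * ω)) ≤ 1 / 6 := by
      refine le_trans ?_ (hrel.trans (one_div_le_one_div_of_le (by norm_num) hτ6))
      gcongr
      norm_num
    have hpos : (0 : ℝ) < 144 * K ^ 4 * (c + 1) ^ 2 := by positivity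
    have h3' : (144 * K ^ 4 * (c + 1) ^ 2) * (Λ ^ 3 * δ) ≤ 1 := by
      rw [le_div_iff₀ hpos] at h3
      linarith
    have a2 : 2 * K * (n : ℝ) ^ 2 * Real.exp (-(n₁ * ω)) ≤ 1 / 6 := by
      calc 2 * K * (n : ℝ) ^ 2 * Real.exp (-(n₁ * ω)) ≤ 2 * K * ((c + 1) * Λ) ^ 2 * δ := by gcongr
        _ = 2 * K * (c + 1) ^ 2 * (Λ ^ 2 * δ) := by ring
        _ ≤ 2 * K ^ 4 * (c + 1) ^ 2 * (Λ ^ 3 * δ) := by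
            gcongr
            exact le_self_pow₀ (by linarith) (by norm_num)
        _ ≤ 1 / 6 := by
            have : 0 ≤ K ^ 4 * (c + 1) ^ 2 * (Λ ^ 3 * δ) := by positivity
            linarith
    -- The Markov term: `τ` cancels, leaving one logarithm from `n` and two from `L` against `exp
    -- (-ω √(log τ))`.
    have a3 : K * (6 * (τ : ℝ) * K) * n * Real.exp (-(n₁ * ω)) / ((m : ℝ) - (n + 1)) ≤ 1 / 6 := by
      calc K * (6 * (τ : ℝ) * K) * n * Real.exp (-(n₁ * ω)) / ((m : ℝ) - (n + 1))
          ≤ K * (6 * (τ : ℝ) * K) * ((c + 1) * Λ) * δ / (τ / (4 * K * (L + 1))) := by gcongr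
        _ = 24 * K ^ 3 * ((c + 1) * Λ) * δ * (L + 1) := by field_simp; ring
        _ ≤ 24 * K ^ 3 * ((c + 1) * Λ) * δ * (K * Λ ^ 2) := by gcongr
        _ = 24 * K ^ 4 * (c + 1) * (Λ ^ 3 * δ) := by ring
        _ ≤ 24 * K ^ 4 * (c + 1) ^ 2 * (Λ ^ 3 * δ) := by
            gcongr
            exact le_self_pow₀ (by linarith) (by norm_num)
        _ ≤ 1 / 6 := by linarith
    linarith

end Parameters

/-! ## Probabilities of the good events -/

section Union

variable {K : ℕ} {Ω : Type*} [mΩ : MeasurableSpace Ω] {P : Measure Ω} [IsProbabilityMeasure P]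
  {ℱ : Filtration ℕ mΩ} {ν : ℕ → Fin K → Measure ℝ} {X : ℕ → Fin K → Ω → ℝ} {τ : ℕ}
  {l : Ω → ℕ → Fin K} {A : Ω → ℕ → Finset (Fin K)} {p : Fin K → Measure ℝ} {ω : ℝ} {a b : ℕ}
  {G : Set Ω}

theorem measureReal_badBlock_le (hE : IsEnvironment P ℱ ν X) (h : IsPolicyRun P ℱ X τ l A)
    (hν : ∀ t, a < t → t ≤ b → ν t = p) (hab : a ≤ b) {k : Fin K} {lam ξ : ℝ}
    (hexp : ExpBound (p k) ω lam ξ) (hG : MeasurableSet[ℱ a] G) (i n : ℕ) :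
    P.real (G ∩ {w | BadBlock (A w) (fun t k => X t k w) a b k i n lam ξ}) ≤
      Real.exp (-(n * ω)) * P.real G := by
  classical
  refine le_trans (measureReal_mono ?_) (measureReal_selected_le (P := P) (ℱ := ℱ)
    (Y := fun t => X t k) (p := fun t => ν t k) (ω := ω) (lam := lam) (ξ := ξ) (b := b) (n := n)
    (H := fun t => {w | t ∈ blockTimes (A w) k a b i n})
    (fun t h1 _ => hE.adapted t k (by omega)) (fun t h1 _ => hE.law t k (by omega))
    (fun t h1 _ => hE.indep t k (by omega)) (fun t h1 h2 => by rw [hν t h1 h2]; exact hexp)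
    (fun t h1 _ => h.measurableSet_mem_blockTimes k h1) hG hab)
  rintro w ⟨hw, h1, h2⟩
  have heq : (Finset.Ioc a b).filter (fun t => w ∈ {w | t ∈ blockTimes (A w) k a b i n}) =
      blockTimes (A w) k a b i n := by
    ext t
    simp only [Finset.mem_filter, Set.mem_ofPred_eq, and_iff_right_iff_imp]
    exact fun ht => (Finset.mem_filter.1 ht).1
  refine ⟨hw, ?_⟩
  simp only [Set.mem_ofPred_eq] at heq ⊢
  rw [heq]
  exact ⟨h1, h2⟩

theorem measureReal_not_goodBlocks_le (hE : IsEnvironment P ℱ ν X) (h : IsPolicyRun P ℱ X τ l A)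
    (hν : ∀ t, a < t → t ≤ b → ν t = p) (hab : a ≤ b) {k : Fin K} {lam ξ : ℝ}
    (hexp : ExpBound (p k) ω lam ξ) (hω : 0 < ω) (hG : MeasurableSet[ℱ a] G) {M n₁ n₂ : ℕ}
    (hn₁ : 1 ≤ n₁) :
    P.real (G ∩ {w | ¬ GoodBlocks (A w) (fun t k => X t k w) a b k M n₁ n₂ lam ξ}) ≤
      M * n₂ * Real.exp (-(n₁ * ω)) * P.real G := by
  have hsub : (G ∩ {w | ¬ GoodBlocks (A w) (fun t k => X t k w) a b k M n₁ n₂ lam ξ}) ⊆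
      ⋃ q ∈ Finset.Icc 1 M ×ˢ Finset.Icc n₁ n₂,
        G ∩ {w | BadBlock (A w) (fun t k => X t k w) a b k q.1 q.2 lam ξ} := by
    rintro w ⟨hw, h1⟩
    simp only [GoodBlocks, Set.mem_ofPred_eq] at h1
    push Not at h1
    obtain ⟨i, n, h2, h3, h4, h5, h6⟩ := h1
    simp only [Set.mem_iUnion, exists_prop]
    exact ⟨(i, n), by simp [h2, h3, h4, h5], hw, h6⟩
  refine (measureReal_mono hsub (measure_ne_top _ _)).trans ((measureReal_biUnion_finset_le _ _).trans ?_)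
  refine (Finset.sum_le_card_nsmul _ _ (Real.exp (-(n₁ * ω)) * P.real G) fun q hq => ?_).trans ?_
  · refine (measureReal_badBlock_le hE h hν hab hexp hG _ _).trans ?_
    have h1 := (Finset.mem_Icc.1 (Finset.mem_product.1 hq).2).1
    refine mul_le_mul_of_nonneg_right (Real.exp_le_exp.2 (neg_le_neg ?_)) measureReal_nonneg
    have : (n₁ : ℝ) ≤ q.2 := by exact_mod_cast h1
    gcongr
  · rw [nsmul_eq_mul, Finset.card_product, Nat.card_Icc, Nat.card_Icc]
    have h1 : ((M + 1 - 1) * (n₂ + 1 - n₁) : ℕ) ≤ M * n₂ := Nat.mul_le_mul (by omega) (by omega)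
    have h2 : (((M + 1 - 1) * (n₂ + 1 - n₁) : ℕ) : ℝ) ≤ M * n₂ := by exact_mod_cast h1
    rw [mul_assoc (_ * _)]
    exact mul_le_mul_of_nonneg_right h2 (by positivity)

/-- Exponential separation of the arms from the arm `best`, with explicit tilts and thresholds. -/
def Thresholds (ω : ℝ) (p : Fin K → Measure ℝ) (best : Fin K) (lam lam' ξ : Fin K → ℝ) : Prop :=
  ∀ k, k ≠ best → (0 < lam k ∧ lam' k < 0) ∧ ExpBound (p k) ω (lam k) (ξ k) ∧
    ExpBound (p best) ω (lam' k) (ξ k)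

omit [IsProbabilityMeasure P] in
theorem Separated.exists_thresholds {D : ℝ} {best : Fin K} (h : Separated ω D p best) :
    ∃ lam lam' ξ : Fin K → ℝ, Thresholds ω p best lam lam' ξ := by
  have H : ∀ k, ∃ q : ℝ × ℝ × ℝ, k ≠ best → (0 < q.1 ∧ q.2.1 < 0) ∧
      ExpBound (p k) ω q.1 q.2.2 ∧ ExpBound (p best) ω q.2.1 q.2.2 := by
    intro k
    by_cases hk : k = best
    · exact ⟨0, fun hne => absurd hk hne⟩
    · obtain ⟨u, v, z, h1, h2, h3, h4⟩ := h.sep k hk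
      exact ⟨(u, v, z), fun _ => ⟨⟨h1, h2⟩, h3, h4⟩⟩
  choose q hq using H
  exact ⟨fun k => (q k).1, fun k => (q k).2.1, fun k => (q k).2.2, fun k hk => hq k hk⟩

variable {best : Fin K} {lam lam' ξ : Fin K → ℝ}

theorem measureReal_exists_ne_le {c : ℝ} (hc : 0 ≤ c) {S : Fin K → Set Ω}
    (hS : ∀ k, k ≠ best → P.real (G ∩ S k) ≤ c) :
    P.real (G ∩ {w | ∃ k, k ≠ best ∧ w ∈ S k}) ≤ K * c := by
  have hsub : (G ∩ {w | ∃ k, k ≠ best ∧ w ∈ S k}) ⊆ ⋃ k ∈ Finset.univ.erase best, G ∩ S k := by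
    rintro w ⟨hw, k, hk, hkS⟩
    simp only [Set.mem_iUnion, exists_prop]
    exact ⟨k, by simpa using hk, hw, hkS⟩
  refine (measureReal_mono hsub (measure_ne_top _ _)).trans ((measureReal_biUnion_finset_le _ _).trans ?_)
  refine (Finset.sum_le_card_nsmul _ _ c fun k hk => hS k (by simpa using hk)).trans ?_
  rw [nsmul_eq_mul]
  have : ((Finset.univ.erase best).card : ℝ) ≤ K := by
    exact_mod_cast (Finset.card_le_univ _).trans (by simp)
  gcongr

theorem measureReal_not_reliable_le (hE : IsEnvironment P ℱ ν X) (h : IsPolicyRun P ℱ X τ l A)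
    (hν : ∀ t, a < t → t ≤ b → ν t = p) (hab : a ≤ b) (hthr : Thresholds ω p best lam lam' ξ)
    (hω : 0 < ω) (hG : MeasurableSet[ℱ a] G) {n : ℕ} (hn : 1 ≤ n) :
    P.real (G ∩ {w | ¬ Reliable (A w) (fun t k => X t k w) a b n best lam lam' ξ}) ≤
      2 * K * ((b - a : ℕ) : ℝ) ^ 2 * Real.exp (-(n * ω)) * P.real G := by
  have hsub : (G ∩ {w | ¬ Reliable (A w) (fun t k => X t k w) a b n best lam lam' ξ}) ⊆
      G ∩ {w | ∃ k, k ≠ best ∧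
        w ∈ {w | ¬ GoodBlocks (A w) (fun t k => X t k w) a b k (b - a) n (b - a) (lam k) (ξ k)} ∪
        {w | ¬ GoodBlocks (A w) (fun t k => X t k w) a b best (b - a) n (b - a) (lam' k) (ξ k)}} := by
    rintro w ⟨hw, h1⟩
    refine ⟨hw, ?_⟩
    simp only [Reliable, Set.mem_ofPred_eq] at h1
    push Not at h1
    obtain ⟨k, hk, h2⟩ := h1
    refine ⟨k, hk, ?_⟩
    by_cases h3 : GoodBlocks (A w) (fun t k => X t k w) a b k (b - a) n (b - a) (lam k) (ξ k)
    · exact Or.inr (h2 h3)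
    · exact Or.inl h3
  set c := ((b - a : ℕ) : ℝ) * ((b - a : ℕ) : ℝ) * Real.exp (-(n * ω)) * P.real G with hc
  refine (measureReal_mono hsub (measure_ne_top _ _)).trans ((measureReal_exists_ne_le (c := c + c) (by positivity)
    fun k hk => ?_).trans (le_of_eq (by rw [hc]; ring)))
  rw [Set.inter_union_distrib_left]
  refine (measureReal_union_le _ _).trans (add_le_add ?_ ?_)
  · exact measureReal_not_goodBlocks_le hE h hν hab (hthr k hk).2.1 hω hG hn
  · exact measureReal_not_goodBlocks_le hE h hν hab (hthr k hk).2.2 hω hG hn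

open Classical in
/-- Unless it is locked already, the best arm gets locked with probability at least `1 / 2`. -/
theorem measureReal_not_lockedAt_le {n n₁ m a' : ℕ} (hE : IsEnvironment P ℱ ν X)
    (h : IsPolicyRun P ℱ X τ l A) (hν : ∀ t, a < t → t ≤ b → ν t = p) (hKa : K ≤ a)
    (ha' : a' = a + 4 * τ * K) (hb : b = a' + 6 * τ * K) (hthr : Thresholds ω p best lam lam' ξ)
    (hω : 0 < ω) (hpar : GoodParameters K τ ω n n₁ m) (hG : MeasurableSet[ℱ a] G) :
    P.real (G ∩ {w | ¬ LockedAt τ (l w) (A w) best b}) ≤ 1 / 2 * P.real G := by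
  have hab : a ≤ b := by omega
  have ha'b : a' ≤ b := by omega
  have hn₁ : 1 ≤ n₁ := by
    by_contra hc
    have h1 := hpar.lt_n₁
    rw [show n₁ = 0 by omega] at h1
    have := Real.sqrt_nonneg (Real.log τ)
    simp only [Nat.cast_zero] at h1
    linarith
  have hν' : ∀ t, a' < t → t ≤ b → ν t = p := fun t h1 h2 => hν t (by omega) h2
  have hG' : MeasurableSet[ℱ a'] G := ℱ.mono (by omega) _ hG
  set Q := ((Finset.univ.erase best) ×ˢ (Finset.Icc 1 (b - a'))) ×ˢ (Finset.Icc n₁ n) with hQ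
  set B : (Fin K × ℕ) × ℕ → Set Ω := fun q => {w | BadBlock (A w) (fun t k => X t k w) a' b q.1.1
    (q.1.2 + 1 - q.2) q.2 (lam q.1.1) (ξ q.1.1)} with hB
  set S₁ := {w | ¬ Reliable (A w) (fun t k => X t k w) a b n best lam lam' ξ} with hS₁
  set S₂ : Fin K → Set Ω := fun k => {w | ¬ GoodBlocks (A w) (fun t k => X t k w) a' b best (2 * n)
    n₁ n (lam' k) (ξ k)} with hS₂
  set S₃ := {w | m ≤ n + 1 + (Q.filter (fun q => w ∈ B q)).card} with hS₃
  -- Three causes of failure: an unreliable long block, a bad short block of the best arm, or many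
  -- bad short blocks of other arms. Union bounds handle the first two and Markov's inequality the
  -- third.
  have hsub : (G ∩ {w | ¬ LockedAt τ (l w) (A w) best b}) ⊆
      G ∩ S₁ ∪ G ∩ {w | ∃ k, k ≠ best ∧ w ∈ S₂ k} ∪ G ∩ S₃ := by
    rintro w ⟨hw, hlock⟩
    by_contra hcon
    simp only [Set.mem_union, Set.mem_inter_iff, hw, true_and, not_or] at hcon
    obtain ⟨⟨h1, h2⟩, h3⟩ := hcon
    simp only [hS₂, Set.mem_ofPred_eq] at h2
    push Not at h2
    refine hlock (lockedAt_of_reliable (h.isRun w) hpar.admissible hpar.one_le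
      (fun k hk => (hthr k hk).1) (not_not.1 h1) hKa ha' hb hpar.lt_n₁ hpar.n₁_le h2 hpar.mul_le ?_)
    simp only [hS₃, Set.mem_ofPred_eq, not_le] at h3
    exact h3
  have p1 := measureReal_not_reliable_le hE h hν hab hthr hω hG hpar.one_le
  have hba : (b - a : ℕ) = 10 * τ * K := by
    have e1 : 4 * τ * K = 4 * (τ * K) := by ring
    have e2 : 6 * τ * K = 6 * (τ * K) := by ring
    have e3 : 10 * τ * K = 10 * (τ * K) := by ring
    omega
  have hba' : (b - a' : ℕ) = 6 * τ * K := by omega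
  rw [hba] at p1
  have p2 := measureReal_exists_ne_le (P := P) (G := G) (best := best) (S := S₂)
    (c := (2 * n : ℕ) * n * Real.exp (-(n₁ * ω)) * P.real G) (by positivity)
    (fun k hk => measureReal_not_goodBlocks_le hE h hν' ha'b (hthr k hk).2.2 hω hG' hn₁)
  have hlt : (0 : ℝ) < (m : ℝ) - (n + 1) := by
    have : ((n + 1 : ℕ) : ℝ) < m := by exact_mod_cast hpar.lt_m
    push_cast at this
    linarith
  have p3 : ((m : ℝ) - (n + 1)) * P.real (G ∩ S₃) ≤
      K * (6 * (τ : ℝ) * K) * n * Real.exp (-(n₁ * ω)) * P.real G := by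
    refine (mul_measureReal_card_le Q (fun q => G ∩ B q) _ _ ?_).trans ?_
    · rintro w ⟨hw, hwS⟩
      have h1 : ∑ q ∈ Q, (G ∩ B q).indicator (fun _ => (1 : ℝ)) w =
          (Q.filter (fun q => w ∈ B q)).card := by
        rw [Finset.card_filter]
        push_cast
        refine Finset.sum_congr rfl fun q _ => ?_
        simp [Set.indicator, hw]
      rw [h1]
      have h2 : (m : ℝ) ≤ ((n + 1 + (Q.filter (fun q => w ∈ B q)).card : ℕ) : ℝ) := by
        exact_mod_cast hwS
      push_cast at h2
      linarith
    · refine (Finset.sum_le_card_nsmul _ _ (Real.exp (-(n₁ * ω)) * P.real G) fun q hq => ?_).trans ?_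
      · obtain ⟨hq1, hq2⟩ := Finset.mem_product.1 hq
        have hk : q.1.1 ≠ best := by simpa using (Finset.mem_product.1 hq1).1
        refine (measureReal_badBlock_le hE h hν' ha'b (hthr _ hk).2.1 hG' _ _).trans ?_
        refine mul_le_mul_of_nonneg_right (Real.exp_le_exp.2 (neg_le_neg ?_)) measureReal_nonneg
        have : (n₁ : ℝ) ≤ q.2 := by exact_mod_cast (Finset.mem_Icc.1 hq2).1
        gcongr
      · rw [nsmul_eq_mul, ← mul_assoc]
        refine mul_le_mul_of_nonneg_right (mul_le_mul_of_nonneg_right ?_ (Real.exp_pos _).le)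
          measureReal_nonneg
        have h1 : Q.card ≤ K * (6 * τ * K) * n := by
          rw [hQ, Finset.card_product, Finset.card_product, Nat.card_Icc, Nat.card_Icc, hba']
          refine Nat.mul_le_mul (Nat.mul_le_mul ?_ (by omega)) (by omega)
          exact (Finset.card_le_univ _).trans (by simp)
        exact_mod_cast h1
  rw [mul_comm, ← le_div_iff₀ hlt] at p3
  refine (measureReal_mono hsub (measure_ne_top _ _)).trans ((measureReal_union_le _ _).trans
    ((add_le_add (measureReal_union_le _ _) le_rfl).trans
      ((add_le_add (add_le_add p1 p2) p3).trans ?_)))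
  refine le_trans (le_of_eq ?_) (mul_le_mul_of_nonneg_right hpar.locking measureReal_nonneg)
  push_cast
  ring

end Union

/-! ## The regret -/

section Regret

variable {K : ℕ} {ω D : ℝ}

open Classical in
/-- Number of times in `S` at which an arm other than `star t` is pulled. -/
noncomputable def wrongPulls (A : ℕ → Finset (Fin K)) (star : ℕ → Fin K) (S : Finset ℕ) : ℕ :=
  (S.filter (fun t => ∃ k, k ≠ star t ∧ PulledAt A t k)).card

theorem wrongPulls_le_card (A : ℕ → Finset (Fin K)) (star : ℕ → Fin K) (S : Finset ℕ) :
    wrongPulls A star S ≤ S.card := by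
  classical
  exact Finset.card_filter_le _ _

open Classical in
theorem regret_bounds {ν : ℕ → Fin K → Measure ℝ} {star : ℕ → Fin K} {T : ℕ}
    (hstar : ∀ t, 1 ≤ t → t ≤ T → Separated ω D (ν t) (star t)) (A : ℕ → Finset (Fin K)) :
    0 ≤ (∑ t ∈ Finset.Icc 1 T, ∑ k : Fin K,
      if PulledAt A t k then bestMean ν t - mean (ν t k) else 0) ∧
    (∑ t ∈ Finset.Icc 1 T, ∑ k : Fin K,
      if PulledAt A t k then bestMean ν t - mean (ν t k) else 0) ≤
      |D| * wrongPulls A star (Finset.Icc 1 T) := by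
  have hbest : ∀ t, 1 ≤ t → t ≤ T → bestMean ν t = mean (ν t (star t)) := fun t h1 h2 =>
    (hstar t h1 h2).iSup_mean
  have hle : ∀ t, 1 ≤ t → t ≤ T → ∀ k, 0 ≤ bestMean ν t - mean (ν t k) := by
    intro t h1 h2 k
    rw [hbest t h1 h2]
    by_cases hk : k = star t
    · rw [hk]; simp
    · linarith [(hstar t h1 h2).gap_pos k hk]
  constructor
  · refine Finset.sum_nonneg fun t ht => Finset.sum_nonneg fun k _ => ?_
    obtain ⟨h1, h2⟩ := Finset.mem_Icc.1 ht
    split_ifs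
    · exact hle t h1 h2 k
    · exact le_rfl
  · unfold wrongPulls
    rw [Finset.card_filter]
    push_cast
    rw [Finset.mul_sum]
    refine Finset.sum_le_sum fun t ht => ?_
    obtain ⟨h1, h2⟩ := Finset.mem_Icc.1 ht
    by_cases hp : ∃ k, PulledAt A t k
    · obtain ⟨k, hk⟩ := hp
      rw [Finset.sum_eq_single k (fun j _ hj => if_neg fun hj' => hj (hj'.unique hk)) (by simp),
        if_pos hk, hbest t h1 h2]
      by_cases hks : k = star t
      · rw [hks, sub_self]
        split_ifs <;> simp
      · rw [if_pos ⟨k, hks, hk⟩, mul_one]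
        exact ((hstar t h1 h2).gap_le k hks).trans (le_abs_self D)
    · push Not at hp
      rw [Finset.sum_eq_zero fun k _ => if_neg (hp k)]
      split_ifs <;> simp

/-- The distributions are constant during the blocks of times `((j - 1) W, j W]` and
`(j W, (j + 1) W]`. -/
def Clean (ν : ℕ → Fin K → Measure ℝ) (T W j : ℕ) : Prop :=
  1 ≤ j ∧ (j + 1) * W ≤ T ∧ ∀ t, (j - 1) * W < t → t ≤ (j + 1) * W → ν t = ν (j * W)

open Classical in
-- A breakpoint spoils its own block and the next one; the first and last indices are discarded, the
-- latter because its block may run past `T`.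
theorem card_not_clean_le {ν : ℕ → Fin K → Measure ℝ} {T W : ℕ} (hW : 1 ≤ W) :
    ((Finset.range (T / W + 1)).filter (fun j => ¬ Clean ν T W j)).card ≤
      2 + 2 * numBreakpoints ν T := by
  unfold numBreakpoints
  set B := (Finset.Ico 1 T).filter (fun t => ∃ k, ν t k ≠ ν (t + 1) k) with hB
  have hsub : (Finset.range (T / W + 1)).filter (fun j => ¬ Clean ν T W j) ⊆
      {0, T / W} ∪ B.biUnion (fun t => {t / W, t / W + 1}) := by
    intro j hj
    obtain ⟨hj1, hj2⟩ := Finset.mem_filter.1 hj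
    have hjT := Finset.mem_range.1 hj1
    by_cases h0 : j = 0 ∨ j = T / W
    · refine Finset.mem_union_left _ ?_
      simpa using h0
    push Not at h0
    have hle : (j + 1) * W ≤ T := by
      have : j + 1 ≤ T / W := by omega
      exact (Nat.mul_le_mul_right W this).trans (Nat.div_mul_le_self T W)
    refine Finset.mem_union_right _ ?_
    by_contra hcon
    refine hj2 ⟨by omega, hle, ?_⟩
    have hstep : ∀ t, (j - 1) * W < t → t < (j + 1) * W → ν t = ν (t + 1) := by
      intro t h1 h2
      by_contra hne
      refine hcon (Finset.mem_biUnion.2 ⟨t, ?_, ?_⟩)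
      · refine Finset.mem_filter.2 ⟨Finset.mem_Ico.2 ⟨by omega, by omega⟩, ?_⟩
        exact Function.ne_iff.1 hne
      · have h3 : t / W < j + 1 := (Nat.div_lt_iff_lt_mul (by omega)).2 h2
        have h4 : j - 1 ≤ t / W := (Nat.le_div_iff_mul_le (by omega)).2 h1.le
        simp only [Finset.mem_insert, Finset.mem_singleton]
        omega
    have hall : ∀ t, (j - 1) * W + 1 ≤ t → t ≤ (j + 1) * W → ν t = ν ((j - 1) * W + 1) := by
      intro t ht
      induction t, ht using Nat.le_induction with
      | base => exact fun _ => rfl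
      | succ t ht ih =>
        intro h2
        rw [← hstep t ht (by omega), ih (by omega)]
    have h5 : (j - 1) * W + W = j * W := by
      rw [← Nat.succ_mul, Nat.succ_eq_add_one, Nat.sub_add_cancel (by omega)]
    have h6 : (j + 1) * W = j * W + W := by ring
    intro t h1 h2
    rw [hall t h1 h2, hall (j * W) (by omega) (by omega)]
  refine (Finset.card_le_card hsub).trans ((Finset.card_union_le _ _).trans
    (Nat.add_le_add Finset.card_le_two ?_))
  rw [mul_comm]
  exact Finset.card_biUnion_le_card_mul _ _ _ fun t _ => Finset.card_le_two

variable {Ω : Type*} [mΩ : MeasurableSpace Ω] {P : Measure Ω} [IsProbabilityMeasure P]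
  {ℱ : Filtration ℕ mΩ} {ν : ℕ → Fin K → Measure ℝ} {X : ℕ → Fin K → Ω → ℝ} {τ : ℕ}
  {l : Ω → ℕ → Fin K} {A : Ω → ℕ → Finset (Fin K)} {star : ℕ → Fin K} {T n n₁ m : ℕ}

/-- The best arm at the beginning of block `j` is not locked then. -/
def Unlocked (τ : ℕ) (l : Ω → ℕ → Fin K) (A : Ω → ℕ → Finset (Fin K)) (star : ℕ → Fin K)
    (W j : ℕ) : Set Ω :=
  {w | ¬ LockedAt τ (l w) (A w) (star (j * W)) (j * W)}

/-- The exceptional event `R` concerns both blocks, since preserving the lock uses observations from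
the preceding one. Locking uses only the current block, so it can be conditioned on the past at time
`j * W`; this gives the factor `1/2`. -/
theorem Clean.step (hω : 0 < ω) (hpar : GoodParameters K τ ω n n₁ m)
    (hstar : ∀ t, 1 ≤ t → t ≤ T → Separated ω D (ν t) (star t))
    (hE : IsEnvironment P ℱ ν X) (h : IsPolicyRun P ℱ X τ l A) {j : ℕ}
    (hc : Clean ν T (10 * τ * K) j) :
    ∃ R : Set Ω, P.real R ≤ 1 / τ ∧
      (∀ w, w ∉ R → w ∉ Unlocked τ l A star (10 * τ * K) j →
        wrongPulls (A w) star (Finset.Ioc (j * (10 * τ * K)) ((j + 1) * (10 * τ * K))) ≤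
          K * ((10 * K + 1) * (n + 1))) ∧
      P.real (Unlocked τ l A star (10 * τ * K) (j + 1)) ≤
        1 / 2 * P.real (Unlocked τ l A star (10 * τ * K) j) + 1 / τ := by
  classical
  obtain ⟨hj, hT, hν⟩ := hc
  set W := 10 * τ * K with hW
  have hK := hpar.admissible.two_le
  have hτ := hpar.admissible.add_le
  have e10 : W = 10 * (τ * K) := by rw [hW]; ring
  have e3 : 3 * τ * K = 3 * (τ * K) := by ring
  have e4 : 4 * τ * K = 4 * (τ * K) := by ring
  have e6 : 6 * τ * K = 6 * (τ * K) := by ring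
  have hτK : K ≤ τ * K := Nat.le_mul_of_pos_left _ (by omega)
  have h5 : (j - 1) * W + W = j * W := by
    rw [← Nat.succ_mul, Nat.succ_eq_add_one, Nat.sub_add_cancel hj]
  have h6 : (j + 1) * W = j * W + W := by ring
  have hsep := hstar (j * W) (by omega) (by omega)
  have hstar_eq : ∀ t, (j - 1) * W < t → t ≤ (j + 1) * W → star t = star (j * W) := by
    intro t h1 h2
    have h3 := hstar t (by omega) (by omega)
    rw [hν t h1 h2] at h3
    exact h3.unique hsep
  obtain ⟨lam, lam', ξ, hthr⟩ := hsep.exists_thresholds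
  set R : Set Ω := {w | ¬ Reliable (A w) (fun t k => X t k w) ((j - 1) * W) ((j + 1) * W) n
    (star (j * W)) lam lam' ξ} with hR
  have hRP : P.real R ≤ 1 / τ := by
    have h1 := measureReal_not_reliable_le (G := Set.univ) (n := n) hE h hν (by omega) hthr hω
      MeasurableSet.univ hpar.one_le
    rw [Set.univ_inter, probReal_univ, mul_one,
      show (j + 1) * W - (j - 1) * W = 20 * τ * K by
        have : 20 * τ * K = 20 * (τ * K) := by ring
        omega] at h1
    push_cast at h1
    exact h1.trans hpar.reliable
  have hstep : ∀ w, w ∉ R → w ∉ Unlocked τ l A star W j →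
      LockedAt τ (l w) (A w) (star (j * W)) ((j + 1) * W) ∧
        wrongPulls (A w) star (Finset.Ioc (j * W) ((j + 1) * W)) ≤
          K * ((10 * K + 1) * (n + 1)) := by
    intro w hw1 hw2
    have h1 := LockedAt.step (m := 10 * K + 1) (a := j * W) (b := (j + 1) * W)
      (h.isRun w) hpar.admissible hpar.one_le
      (fun k hk => (hthr k hk).1) (not_not.1 hw1) (by omega) (by omega)
      (by
        have : (10 * K + 1) * τ = 10 * (τ * K) + τ := by ring
        omega) (not_not.1 hw2)
    refine ⟨h1.1, le_trans (le_of_eq ?_) h1.2⟩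
    unfold wrongPulls
    congr 1
    refine Finset.filter_congr fun t ht => ?_
    obtain ⟨h2, h3⟩ := Finset.mem_Ioc.1 ht
    rw [hstar_eq t (by omega) h3]
  refine ⟨R, hRP, fun w h1 h2 => (hstep w h1 h2).2, ?_⟩
  have hsub : Unlocked τ l A star W (j + 1) ⊆ (Unlocked τ l A star W j ∩
      {w | ¬ LockedAt τ (l w) (A w) (star (j * W)) ((j + 1) * W)}) ∪ R := by
    intro w hw
    have hw' : ¬ LockedAt τ (l w) (A w) (star (j * W)) ((j + 1) * W) := by
      rw [← hstar_eq ((j + 1) * W) (by omega) le_rfl]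
      exact hw
    by_cases hwR : w ∈ R
    · exact Or.inr hwR
    · by_cases hwU : w ∈ Unlocked τ l A star W j
      · exact Or.inl ⟨hwU, hw'⟩
      · exact absurd (hstep w hwR hwU).1 hw'
  have hG : MeasurableSet[ℱ (j * W)] (Unlocked τ l A star W j) :=
    (h.measurableSet_lockedAt (star (j * W)) (j * W)).compl
  have hlock := measureReal_not_lockedAt_le (a := j * W) (a' := j * W + 4 * τ * K)
    (b := (j + 1) * W) hE h (fun t h1 h2 => hν t (by omega) h2) (by omega) rfl (by omega) hthr hω
    hpar hG
  exact (measureReal_mono hsub).trans ((measureReal_union_le _ _).trans (add_le_add hlock hRP))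

theorem sum_le_of_contraction {u : ℕ → ℝ} {v : ℕ → ℝ} (h0 : u 0 ≤ 1) (hu : ∀ j, 0 ≤ u j)
    (h : ∀ j, u (j + 1) ≤ 1 / 2 * u j + v j) (hv : ∀ j, 0 ≤ v j) (N : ℕ) :
    ∑ j ∈ Finset.range (N + 1), u j ≤ 2 + 2 * ∑ j ∈ Finset.range (N + 1), v j := by
  have h1 : ∑ j ∈ Finset.range N, u (j + 1) ≤
      1 / 2 * ∑ j ∈ Finset.range N, u j + ∑ j ∈ Finset.range N, v j := by
    rw [Finset.mul_sum, ← Finset.sum_add_distrib]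
    exact Finset.sum_le_sum fun j _ => h j
  rw [Finset.sum_range_succ']
  have h2 := Finset.sum_range_succ' u N
  have h3 := Finset.sum_range_succ u N
  have h4 := Finset.sum_range_succ v N
  have h5 := hu N
  have h6 := hv N
  linarith

open Classical in
/-- The regret of a run with a large window, in terms of the window. -/
theorem dynamicRegret_le (hω : 0 < ω) (hpar : GoodParameters K τ ω n n₁ m)
    (hstar : ∀ t, 1 ≤ t → t ≤ T → Separated ω D (ν t) (star t))
    (hE : IsEnvironment P ℱ ν X) (h : IsPolicyRun P ℱ X τ l A) {Γ : ℕ}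
    (hΓ : numBreakpoints ν T ≤ Γ) :
    dynamicRegret P ν A T ≤ |D| * (10 * τ * K * (8 + 6 * Γ) +
      ((T : ℝ) / (10 * τ * K) + 1) * (K * ((10 * K + 1) * (n + 1)) + 30 * K)) := by
  set W := 10 * τ * K with hW
  have hK := hpar.admissible.two_le
  have hτ := hpar.admissible.add_le
  have hWpos : 1 ≤ W := Nat.mul_pos (by omega) (by omega)
  have hτ0 : (0 : ℝ) < τ := by
    have : 0 < τ := by omega
    exact_mod_cast this
  set M₀ := K * ((10 * K + 1) * (n + 1)) with hM₀
  have hex : ∀ j, ∃ R : Set Ω, P.real R ≤ 1 / τ ∧ (Clean ν T W j →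
      (∀ w, w ∉ R → w ∉ Unlocked τ l A star W j →
        wrongPulls (A w) star (Finset.Ioc (j * W) ((j + 1) * W)) ≤ M₀) ∧
      P.real (Unlocked τ l A star W (j + 1)) ≤
        1 / 2 * P.real (Unlocked τ l A star W j) + 1 / τ) := by
    intro j
    by_cases hc : Clean ν T W j
    · obtain ⟨R, h1, h2, h3⟩ := hc.step hω hpar hstar hE h
      exact ⟨R, h1, fun _ => ⟨h2, h3⟩⟩
    · exact ⟨∅, by simp, fun hc' => absurd hc' hc⟩
  choose R hR1 hR2 using hex
  set c : ℕ → ℝ := fun j => if Clean ν T W j then 0 else 1 with hc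
  have hc0 : ∀ j, 0 ≤ c j := fun j => by simp only [hc]; split_ifs <;> norm_num
  set U := Unlocked τ l A star W with hU
  have hcsum : ∑ j ∈ Finset.range (T / W + 1), c j ≤ 2 + 2 * Γ := by
    have h1 := card_not_clean_le (ν := ν) (T := T) hWpos
    have h2 : ∑ j ∈ Finset.range (T / W + 1), c j =
        ((Finset.range (T / W + 1)).filter (fun j => ¬ Clean ν T W j)).card := by
      rw [Finset.card_filter]
      push_cast
      refine Finset.sum_congr rfl fun j _ => ?_
      simp only [hc]
      split_ifs <;> rfl
    rw [h2]
    have h3 : ((Finset.range (T / W + 1)).filter (fun j => ¬ Clean ν T W j)).card ≤ 2 + 2 * Γ := by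
      omega
    exact_mod_cast h3
  have husum : ∑ j ∈ Finset.range (T / W + 1), P.real (U j) ≤
      2 + 2 * ∑ j ∈ Finset.range (T / W + 1), (1 / (τ : ℝ) + c j) := by
    refine sum_le_of_contraction (u := fun j => P.real (U j)) measureReal_le_one
      (fun j => measureReal_nonneg) (fun j => ?_) (fun j => add_nonneg (by positivity) (hc0 j)) _
    by_cases hcl : Clean ν T W j
    · simp only [hc, if_pos hcl, add_zero]
      exact (hR2 j hcl).2
    · simp only [hc, if_neg hcl]
      have h1 : P.real (U (j + 1)) ≤ 1 := measureReal_le_one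
      have h2 : 0 ≤ P.real (U j) := measureReal_nonneg
      have h3 : (0 : ℝ) ≤ 1 / τ := by positivity
      linarith
  -- An integrable majorant of the regret: a block costs `M₀` if clean, locked and reliable, and
  -- otherwise at most `W`. Measurable hulls replace the events, so only their outer measures
  -- matter.
  set g : Ω → ℝ := fun w => ∑ j ∈ Finset.range (T / W + 1), |D| * (W * c j + M₀ +
    W * (toMeasurable P (U j)).indicator (fun _ => (1 : ℝ)) w +
    W * (toMeasurable P (R j)).indicator (fun _ => (1 : ℝ)) w) with hg
  have hind : ∀ S : Set Ω, Integrable ((toMeasurable P S).indicator (fun _ => (1 : ℝ))) P :=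
    fun S => (integrable_const (1 : ℝ)).indicator (measurableSet_toMeasurable _ _)
  have hterm : ∀ j, Integrable (fun w => |D| * (W * c j + M₀ +
      W * (toMeasurable P (U j)).indicator (fun _ => (1 : ℝ)) w +
      W * (toMeasurable P (R j)).indicator (fun _ => (1 : ℝ)) w)) P := fun j =>
    (((integrable_const _).add ((hind _).const_mul _)).add ((hind _).const_mul _)).const_mul _
  have hgi : Integrable g P := integrable_finsetSum _ fun j _ => hterm j
  have hindI : ∀ S : Set Ω, ∫ w, (toMeasurable P S).indicator (fun _ => (1 : ℝ)) w ∂P = P.real S := by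
    intro S
    rw [integral_indicator_const _ (measurableSet_toMeasurable _ _), smul_eq_mul, mul_one]
    simp [Measure.real, measure_toMeasurable]
  have hgI : ∫ w, g w ∂P = ∑ j ∈ Finset.range (T / W + 1),
      |D| * (W * c j + M₀ + W * P.real (U j) + W * P.real (R j)) := by
    rw [hg, integral_finsetSum _ fun j _ => hterm j]
    refine Finset.sum_congr rfl fun j _ => ?_
    have j1 : Integrable (fun w => (W * c j + M₀ : ℝ) +
        W * (toMeasurable P (U j)).indicator (fun _ => (1 : ℝ)) w) P :=
      (integrable_const _).add ((hind _).const_mul _)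
    rw [integral_const_mul, integral_add j1 ((hind _).const_mul _),
      integral_add (integrable_const _) ((hind _).const_mul _),
      integral_const_mul, integral_const_mul, hindI, hindI]
    simp
  have hfg : ∀ w, |D| * wrongPulls (A w) star (Finset.Icc 1 T) ≤ g w := by
    intro w
    rw [hg]
    simp only
    rw [← Finset.mul_sum]
    refine mul_le_mul_of_nonneg_left ?_ (abs_nonneg D)
    have h1 : wrongPulls (A w) star (Finset.Icc 1 T) ≤ ∑ j ∈ Finset.range (T / W + 1),
        wrongPulls (A w) star (Finset.Ioc (j * W) ((j + 1) * W)) := by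
      unfold wrongPulls
      refine le_trans (Finset.card_le_card ?_) Finset.card_biUnion_le
      intro t ht
      obtain ⟨ht1, ht2⟩ := Finset.mem_filter.1 ht
      obtain ⟨ht3, ht4⟩ := Finset.mem_Icc.1 ht1
      refine Finset.mem_biUnion.2 ⟨(t - 1) / W, ?_, Finset.mem_filter.2 ⟨?_, ht2⟩⟩
      · have : (t - 1) / W ≤ T / W := Nat.div_le_div_right (by omega)
        exact Finset.mem_range.2 (by omega)
      · have h2 := Nat.div_mul_le_self (t - 1) W
        have h3 := Nat.lt_mul_div_succ (t - 1) (show 0 < W by omega)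
        rw [mul_comm] at h3
        exact Finset.mem_Ioc.2 ⟨by omega, by omega⟩
    have h2 : (wrongPulls (A w) star (Finset.Icc 1 T) : ℝ) ≤ ∑ j ∈ Finset.range (T / W + 1),
        (wrongPulls (A w) star (Finset.Ioc (j * W) ((j + 1) * W)) : ℝ) := by exact_mod_cast h1
    refine h2.trans (Finset.sum_le_sum fun j _ => ?_)
    have h3 : (wrongPulls (A w) star (Finset.Ioc (j * W) ((j + 1) * W)) : ℝ) ≤ W := by
      have h4 := wrongPulls_le_card (A w) star (Finset.Ioc (j * W) ((j + 1) * W))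
      rw [Nat.card_Ioc, show (j + 1) * W - j * W = W by rw [add_mul, one_mul]; omega] at h4
      exact_mod_cast h4
    have i1 : (0 : ℝ) ≤ (toMeasurable P (U j)).indicator (fun _ => (1 : ℝ)) w :=
      Set.indicator_nonneg (fun _ _ => zero_le_one) w
    have i2 : (0 : ℝ) ≤ (toMeasurable P (R j)).indicator (fun _ => (1 : ℝ)) w :=
      Set.indicator_nonneg (fun _ _ => zero_le_one) w
    have hW0 : (0 : ℝ) ≤ W := Nat.cast_nonneg _
    have hM0 : (0 : ℝ) ≤ M₀ := Nat.cast_nonneg _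
    have m1 := mul_nonneg hW0 i1
    have m2 := mul_nonneg hW0 i2
    have m3 := mul_nonneg hW0 (hc0 j)
    by_cases hcl : Clean ν T W j
    · by_cases hwU : w ∈ toMeasurable P (U j)
      · rw [Set.indicator_of_mem hwU]
        linarith
      · by_cases hwR : w ∈ toMeasurable P (R j)
        · rw [Set.indicator_of_mem hwR]
          linarith
        · have h5 := (hR2 j hcl).1 w (fun hh => hwR (subset_toMeasurable P _ hh))
            (fun hh => hwU (subset_toMeasurable P _ hh))
          have h6 : (wrongPulls (A w) star (Finset.Ioc (j * W) ((j + 1) * W)) : ℝ) ≤ M₀ := by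
            exact_mod_cast h5
          linarith
    · have : c j = 1 := by simp only [hc, if_neg hcl]
      rw [this] at m3 ⊢
      linarith
  have hmain : dynamicRegret P ν A T ≤ ∫ w, g w ∂P := by
    unfold dynamicRegret
    refine integral_mono_of_nonneg (Filter.Eventually.of_forall fun w => ?_) hgi
      (Filter.Eventually.of_forall fun w => ?_)
    · exact (regret_bounds hstar (A w)).1
    · exact (regret_bounds hstar (A w)).2.trans (hfg w)
  refine hmain.trans ?_
  rw [hgI, ← Finset.mul_sum]
  refine mul_le_mul_of_nonneg_left ?_ (abs_nonneg D)
  set N := T / W with hN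
  have hRsum : ∑ j ∈ Finset.range (N + 1), P.real (R j) ≤ ((N : ℝ) + 1) * (1 / τ) := by
    refine (Finset.sum_le_card_nsmul _ _ (1 / (τ : ℝ)) fun j _ => hR1 j).trans (le_of_eq ?_)
    simp
  have hNle : (N : ℝ) ≤ (T : ℝ) / W := Nat.cast_div_le
  have hWc : (W : ℝ) = 10 * τ * K := by rw [hW]; push_cast; ring
  have hW0 : (0 : ℝ) ≤ W := Nat.cast_nonneg _
  simp only [Finset.sum_add_distrib, ← Finset.mul_sum, Finset.sum_const, Finset.card_range,
    nsmul_eq_mul] at husum ⊢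
  push_cast at husum ⊢
  rw [← hWc]
  have hWτ : (W : ℝ) * (((N : ℝ) + 1) * (1 / τ)) = ((N : ℝ) + 1) * (10 * K) := by
    rw [hWc]
    field_simp
  have q1 := mul_le_mul_of_nonneg_left husum hW0
  have q2 := mul_le_mul_of_nonneg_left hRsum hW0
  have q3 := mul_le_mul_of_nonneg_left hcsum hW0
  have hM₀c : (M₀ : ℝ) = K * ((10 * K + 1) * (n + 1)) := by rw [hM₀]; push_cast; ring
  rw [hM₀c]
  have q4 : ((N : ℝ) + 1) * (K * ((10 * K + 1) * (n + 1)) + 30 * K) ≤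
      ((T : ℝ) / W + 1) * (K * ((10 * K + 1) * (n + 1)) + 30 * K) := by gcongr
  have q5 : (W : ℝ) * (2 + 2 * (((N : ℝ) + 1) * (1 / τ) + ∑ j ∈ Finset.range (N + 1), c j)) =
      2 * W + 2 * (W * (((N : ℝ) + 1) * (1 / τ))) + 2 * (W * ∑ j ∈ Finset.range (N + 1), c j) := by
    ring
  rw [q5] at q1
  rw [hWτ] at q1 q2
  -- With `2 + 2Γ` unclean blocks, the unlocked sum adds `6 + 4Γ` blocks, giving `W * (8 + 6Γ)`; the
  -- `1/τ` terms, two from unlocked blocks and one from `R`, give `30 * K` per block.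
  linarith

end Regret

/-! ### Crude regret bounds, window arithmetic and the final constant -/

theorem dynamicRegret_le_abs_mul {K : ℕ} {ω D : ℝ} {Ω : Type*} [MeasurableSpace Ω]
    {P : Measure Ω} [IsProbabilityMeasure P] {ν : ℕ → Fin K → Measure ℝ}
    {A : Ω → ℕ → Finset (Fin K)} {star : ℕ → Fin K} {T : ℕ}
    (hstar : ∀ t, 1 ≤ t → t ≤ T → Separated ω D (ν t) (star t)) :
    dynamicRegret P ν A T ≤ |D| * T := by
  classical
  have h1 : ∫ _w, |D| * (T : ℝ) ∂P = |D| * T := by simp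
  rw [← h1]
  refine integral_mono_of_nonneg (Filter.Eventually.of_forall fun w => ?_) (integrable_const _)
    (Filter.Eventually.of_forall fun w => ?_)
  · exact (regret_bounds hstar (A w)).1
  · refine (regret_bounds hstar (A w)).2.trans (mul_le_mul_of_nonneg_left ?_ (abs_nonneg D))
    have := wrongPulls_le_card (A w) star (Finset.Icc 1 T)
    rw [Nat.card_Icc, Nat.add_sub_cancel] at this
    exact_mod_cast this

theorem dynamicRegret_nonpos {K : ℕ} (hK : K ≤ 1) {ω D : ℝ} {Ω : Type*} [MeasurableSpace Ω]
    {P : Measure Ω} [IsProbabilityMeasure P] {ν : ℕ → Fin K → Measure ℝ}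
    {A : Ω → ℕ → Finset (Fin K)} {star : ℕ → Fin K} {T : ℕ}
    (hstar : ∀ t, 1 ≤ t → t ≤ T → Separated ω D (ν t) (star t)) :
    dynamicRegret P ν A T ≤ 0 := by
  classical
  refine integral_nonpos fun w => ?_
  refine (regret_bounds hstar (A w)).2.trans (le_of_eq ?_)
  have : wrongPulls (A w) star (Finset.Icc 1 T) = 0 := by
    unfold wrongPulls
    rw [Finset.card_eq_zero, Finset.filter_eq_empty_iff]
    rintro t - ⟨k, hk, -⟩
    exact hk (Fin.ext (by omega))
  rw [this]
  simp

/-- The relation between the window and the horizon. -/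
theorem sqrt_mul_sqrt_window {T Γ : ℕ} (hΓ : 1 ≤ Γ) (hT : 1 ≤ T) :
    Real.sqrt (T * Real.log T / Γ) * Real.sqrt (T * Γ * Real.log T) = T * Real.log T ∧
      Γ * Real.sqrt (T * Real.log T / Γ) = Real.sqrt (T * Γ * Real.log T) := by
  have hl : 0 ≤ Real.log T := Real.log_nonneg (by exact_mod_cast hT)
  have hΓ0 : (0 : ℝ) < Γ := by exact_mod_cast hΓ
  constructor
  · rw [← Real.sqrt_mul (by positivity)]
    rw [show (T : ℝ) * Real.log T / Γ * (T * Γ * Real.log T) = (T * Real.log T) ^ 2 by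
      field_simp]
    exact Real.sqrt_sq (by positivity)
  · rw [show (T : ℝ) * Γ * Real.log T = Γ ^ 2 * (T * Real.log T / Γ) by field_simp,
      Real.sqrt_mul (by positivity), Real.sqrt_sq hΓ0.le]

theorem log_window_le {T Γ τ : ℕ} {c₂ : ℝ} (hT : 2 ≤ T) (hΓ : 1 ≤ Γ) (hτ : 1 ≤ τ)
    (h : (τ : ℝ) ≤ c₂ * Real.sqrt (T * Real.log T / Γ)) :
    Real.log τ ≤ (|Real.log c₂| / Real.log 2 + 1) * Real.log T := by
  have hT0 : (2 : ℝ) ≤ T := by exact_mod_cast hT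
  have hl2 : 0 < Real.log 2 := Real.log_pos (by norm_num)
  have hl : Real.log 2 ≤ Real.log T := Real.log_le_log (by norm_num) hT0
  have hΓ0 : (1 : ℝ) ≤ Γ := by exact_mod_cast hΓ
  have hτ0 : (1 : ℝ) ≤ τ := by exact_mod_cast hτ
  have hs : Real.sqrt (T * Real.log T / Γ) ≤ T := by
    refine Real.sqrt_le_iff.2 ⟨by linarith, ?_⟩
    rw [div_le_iff₀ (by linarith)]
    have h1 : Real.log T ≤ T := Real.log_le_self (by linarith)
    calc (T : ℝ) * Real.log T ≤ T * T := by gcongr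
      _ = T ^ 2 * 1 := by ring
      _ ≤ T ^ 2 * Γ := by gcongr
  have hc : 0 < c₂ := by
    by_contra hcon
    have := mul_nonpos_of_nonpos_of_nonneg (not_lt.1 hcon)
      (Real.sqrt_nonneg ((T : ℝ) * Real.log T / Γ))
    linarith
  have h1 : (τ : ℝ) ≤ c₂ * T := h.trans (by gcongr)
  have h2 := Real.log_le_log (by linarith) h1
  rw [Real.log_mul hc.ne' (by linarith)] at h2
  have h3 : |Real.log c₂| ≤ |Real.log c₂| / Real.log 2 * Real.log T := by
    rw [div_mul_eq_mul_div, le_div_iff₀ hl2]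
    gcongr
  have := le_abs_self (Real.log c₂)
  linarith

end SWBandit

theorem theorem3 (K : ℕ) (ω D c₁ c₂ : ℝ) (hω : 0 < ω) (hc₁ : 0 < c₁) :
    ∃ C : ℝ, ∀ (T Γ τ : ℕ), 2 ≤ T → 1 ≤ Γ → 1 ≤ τ →
      c₁ * Real.sqrt (T * Real.log T / Γ) ≤ τ →
      (τ : ℝ) ≤ c₂ * Real.sqrt (T * Real.log T / Γ) →
      ∀ (Ω : Type*) [mΩ : MeasurableSpace Ω] (P : MeasureTheory.Measure Ω)
        [MeasureTheory.IsProbabilityMeasure P] (ℱ : MeasureTheory.Filtration ℕ mΩ)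
        (ν : ℕ → Fin K → MeasureTheory.Measure ℝ) (X : ℕ → Fin K → Ω → ℝ)
        (l : Ω → ℕ → Fin K) (A : Ω → ℕ → Finset (Fin K)),
        (∀ t, 1 ≤ t → t ≤ T → SWBandit.IsExpFamModel ω D (ν t)) →
        SWBandit.numBreakpoints ν T ≤ Γ →
        SWBandit.IsEnvironment P ℱ ν X →
        SWBandit.IsPolicyRun P ℱ X τ l A →
        SWBandit.dynamicRegret P ν A T ≤ C * Real.sqrt (T * Γ * Real.log T) := by
  open SWBandit in
  rcases Nat.lt_or_ge K 2 with hK | hK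
  · refine ⟨0, ?_⟩
    intro T Γ τ hT hΓ hτ _ _ Ω mΩ P _ ℱ ν X l A hmodel _ _ _
    obtain ⟨w⟩ := nonempty_of_isProbabilityMeasure P
    have hex : ∀ t, ∃ b : Fin K, 1 ≤ t → t ≤ T → Separated ω D (ν t) b := by
      intro t
      by_cases h : 1 ≤ t ∧ t ≤ T
      · obtain ⟨b, hb⟩ := (hmodel t h.1 h.2).exists_separated hω
        exact ⟨b, fun _ _ => hb⟩
      -- An arbitrary arm, for times outside the horizon.
      · exact ⟨l w 0, fun h1 h2 => absurd ⟨h1, h2⟩ h⟩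
    choose star hstar using hex
    rw [zero_mul]
    exact dynamicRegret_nonpos (by omega) hstar
  obtain ⟨τ₀, c, hc0, hpar⟩ := exists_goodParameters K hK hω
  set E : ℝ := K * ((10 * K + 1) * (c + 1)) + 30 * K with hE
  set c₃ : ℝ := |Real.log c₂| / Real.log 2 + 1 with hc₃
  have hl2 : 0 < Real.log 2 := Real.log_pos (by norm_num)
  have hc₃0 : 0 ≤ c₃ := by positivity
  have hE0 : 0 ≤ E := by positivity
  -- The first term covers windows below `τ₀`, where the trivial bound `|D| * T` suffices because `T
  -- log T ≤ τ S / c₁`; the second covers large windows.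
  refine ⟨|D| * (τ₀ / (c₁ * Real.log 2)) +
    |D| * ((140 * K + E) * |c₂| + E * c₃ / c₁), ?_⟩
  intro T Γ τ hT hΓ hτ h1 h2 Ω mΩ P _ ℱ ν X l A hmodel hbreak henv hrun
  obtain ⟨w⟩ := nonempty_of_isProbabilityMeasure P
  have hex : ∀ t, ∃ b : Fin K, 1 ≤ t → t ≤ T → Separated ω D (ν t) b := by
    intro t
    by_cases h : 1 ≤ t ∧ t ≤ T
    · obtain ⟨b, hb⟩ := (hmodel t h.1 h.2).exists_separated hω
      exact ⟨b, fun _ _ => hb⟩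
    · exact ⟨l w 0, fun h1 h2 => absurd ⟨h1, h2⟩ h⟩
  choose star hstar using hex
  have hT0 : (2 : ℝ) ≤ T := by exact_mod_cast hT
  have hl : Real.log 2 ≤ Real.log T := Real.log_le_log (by norm_num) hT0
  have hlT : 0 < Real.log T := by linarith
  have hΓ0 : (1 : ℝ) ≤ Γ := by exact_mod_cast hΓ
  have hτ0 : (1 : ℝ) ≤ τ := by exact_mod_cast hτ
  have hKc : (2 : ℝ) ≤ K := by exact_mod_cast hK
  obtain ⟨e1, e2⟩ := sqrt_mul_sqrt_window (T := T) hΓ (by omega)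
  set S := Real.sqrt (T * Γ * Real.log T) with hS
  set s := Real.sqrt (T * Real.log T / Γ) with hs
  have hS0 : 0 ≤ S := Real.sqrt_nonneg _
  have hs0 : 0 ≤ s := Real.sqrt_nonneg _
  have hTlog : T * Real.log T ≤ τ * S / c₁ := by
    rw [le_div_iff₀ hc₁, ← e1]
    calc s * S * c₁ = c₁ * s * S := by ring
      _ ≤ τ * S := by gcongr
  rcases Nat.lt_or_ge τ τ₀ with hlt | hge
  · refine (dynamicRegret_le_abs_mul hstar).trans ?_
    have hT' : (T : ℝ) ≤ τ₀ / (c₁ * Real.log 2) * S := by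
      rw [div_mul_eq_mul_div, le_div_iff₀ (by positivity)]
      calc (T : ℝ) * (c₁ * Real.log 2) = c₁ * (T * Real.log 2) := by ring
        _ ≤ c₁ * (T * Real.log T) := by gcongr
        _ ≤ c₁ * (τ * S / c₁) := by gcongr
        _ = τ * S := by field_simp
        _ ≤ τ₀ * S := by gcongr
    calc |D| * T ≤ |D| * (τ₀ / (c₁ * Real.log 2) * S) := by gcongr
      _ = |D| * (τ₀ / (c₁ * Real.log 2)) * S := by ring
      _ ≤ _ := by
        refine mul_le_mul_of_nonneg_right (le_add_of_nonneg_right ?_) hS0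
        positivity
  · obtain ⟨hlog, n, n₁, m, hgp, hn⟩ := hpar τ hge
    refine (dynamicRegret_le hω hgp hstar henv hrun hbreak).trans ?_
    have hlogτ := log_window_le hT hΓ hτ h2
    have hlogle : Real.log τ ≤ τ := Real.log_le_self (by linarith)
    -- The upper bound on the window controls the cost of breakpoints; the lower bound, through
    -- `hTlog`, controls that of exploration in `a2`.
    have hΓτ : Γ * τ ≤ |c₂| * S := by
      calc (Γ : ℝ) * τ ≤ Γ * (c₂ * s) := by gcongr
        _ = c₂ * S := by rw [← e2]; ring
        _ ≤ |c₂| * S := by gcongr; exact le_abs_self c₂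
    have hEn : (K : ℝ) * ((10 * K + 1) * (n + 1)) + 30 * K ≤ E * Real.log τ := by
      calc (K : ℝ) * ((10 * K + 1) * (n + 1)) + 30 * K
          ≤ K * ((10 * K + 1) * (c * Real.log τ + Real.log τ)) + 30 * K * Real.log τ := by
            have b1 : 30 * (K : ℝ) ≤ 30 * K * Real.log τ :=
              le_mul_of_one_le_right (by positivity) hlog
            refine add_le_add ?_ b1
            gcongr
        _ = E * Real.log τ := by rw [hE]; ring
    have a1 : 10 * (τ : ℝ) * K * (8 + 6 * Γ) ≤ 140 * K * (|c₂| * S) := by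
      calc 10 * (τ : ℝ) * K * (8 + 6 * Γ) ≤ 10 * (τ : ℝ) * K * (8 * Γ + 6 * Γ) := by
            gcongr
            linarith
        _ = 140 * K * (Γ * τ) := by ring
        _ ≤ 140 * K * (|c₂| * S) := by gcongr
    have a2 : (T : ℝ) / (10 * τ * K) * (E * Real.log τ) ≤ E * c₃ / c₁ * S := by
      calc (T : ℝ) / (10 * τ * K) * (E * Real.log τ) ≤ T / τ * (E * (c₃ * Real.log T)) := by
            gcongr
            nlinarith
        _ = E * c₃ * (T * Real.log T) / τ := by ring
        _ ≤ E * c₃ * (τ * S / c₁) / τ := by gcongr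
        _ = E * c₃ / c₁ * S := by field_simp
    have a3 : E * Real.log τ ≤ E * (|c₂| * S) := by
      gcongr
      refine hlogle.trans (le_trans ?_ hΓτ)
      exact le_mul_of_one_le_left (by linarith) hΓ0
    have a4 : ((T : ℝ) / (10 * τ * K) + 1) * (K * ((10 * K + 1) * (n + 1)) + 30 * K) ≤
        E * c₃ / c₁ * S + E * (|c₂| * S) := by
      calc ((T : ℝ) / (10 * τ * K) + 1) * (K * ((10 * K + 1) * (n + 1)) + 30 * K)
          ≤ ((T : ℝ) / (10 * τ * K) + 1) * (E * Real.log τ) := by gcongr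
        _ = (T : ℝ) / (10 * τ * K) * (E * Real.log τ) + E * Real.log τ := by ring
        _ ≤ _ := add_le_add a2 a3
    calc |D| * (10 * τ * K * (8 + 6 * Γ) +
          ((T : ℝ) / (10 * τ * K) + 1) * (K * ((10 * K + 1) * (n + 1)) + 30 * K))
        ≤ |D| * (140 * K * (|c₂| * S) + (E * c₃ / c₁ * S + E * (|c₂| * S))) := by gcongr
      _ = |D| * ((140 * K + E) * |c₂| + E * c₃ / c₁) * S := by ring
      _ ≤ _ := by
        refine mul_le_mul_of_nonneg_right (le_add_of_nonneg_left ?_) hS0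
        positivity
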